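/- Let $\mathbb{T}=\mathbb{R}/2\pi\mathbb{Z}$, let $X_0:\mathbb{T}\to\mathbb{R}^2$, and let $X(s,t)\in\mathbb{R}^2$ ($s\in\mathbb{T}$, $t\ge 0$) describe a closed string. Let $J\subseteq(0,\infty)$ be the set of times at which the equations are imposed (for instance $J=(0,\infty)$, $J=(0,T)$, or a subset of full measure of one of these). Assume that for every $t\in J$ we have $X(\cdot,t)\in H^2(\mathbb{T})$ and that $X(\cdot,t)$ is well-stretched, i.e. there is $\lambda>0$ (possibly depending on $t$) with $$|X(s_1,t)-X(s_2,t)|\ge\lambda\,|s_1-s_2|\qquad\forall\,s_1,s_2\in\mathbb{T},$$ where $|s_1-s_2|$ is the distance on $\mathbb{T}$. Write $X'=X_s$, and set $$G(x)=\frac1{4\pi}\Big(-\ln|x|\,\mathrm{Id}+\frac{x\otimes x}{|x|^2}\Big),\qquad Q(x)=\frac{x}{2\pi|x|^2}.$$ *Stokes immersed boundary problem.* A pair $(u,p)$ solves it together with $X$ if for every $t\in J$: $u(\cdot,t)$ is continuous on $\mathbb{R}^2$, $p(\cdot,t)$ is locally integrable, in the sense of distributions $$-\Delta u+\nabla p=\int_{\mathbb{T}}X_{ss}(s,t)\,\delta(x-X(s,t))\,ds,\qquad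 \mathrm{div}\,u=0\quad\text{in }\mathbb{R}^2,$$ $|u|\to0$ and $|p|\to0$ as $|x|\to\infty$ (for $p$, outside a null set), and $X_t(s,t)=u(X(s,t),t)$ for all $s\in\mathbb{T}$; and if $X(s,0)=X_0(s)$ for all $s$, with $t\mapsto X(s,t)$ right-continuous at $t=0$. *Contour dynamic formulation.* For all $t\in J$ and $s\in\mathbb{T}$, $$X_t(s,t)=-\tfrac14(-\Delta)^{1/2}X(s,t)+g_X(s,t),$$ and $X(s,0)=X_0(s)$ for all $s$, with $t\mapsto X(s,t)$ right-continuous at $t=0$. Here $$g_X(s,t)=\int_{\mathbb{T}}\Gamma_0(s,s',t)\,ds'+\tfrac14(-\Delta)^{1/2}X(s,t),$$ $$\Gamma_0(s,s',t)=-\partial_{s'}\big[G(X(s,t)-X(s',t))\big]\,\big(X'(s',t)-X'(s,t)\big),$$ $$(-\Delta)^{1/2}Y(s)=-\frac1\pi\,\mathrm{p.v.}\!\int_{\mathbb{T}}\frac{Y(s')-Y(s)}{4\sin^2\left(\frac{s'-s}{2}\right)}\,ds'.$$ Then the following hold. 1. For every $t\in J$ the following integrands are integrable over $\mathbb{T}$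 in $s'$: $\Gamma_0(s,s',t)$ for every $s$; $G(x-X(s',t))X_{ss}(s',t)$ for every $x\in\mathbb{R}^2$; and $Q(x-X(s',t))\cdot X_{ss}(s',t)$ for every $x\notin X(\mathbb{T},t)$. The principal value defining $(-\Delta)^{1/2}X(s,t)$ exists for every $s$, and it agrees with the Fourier multiplier: $(-\Delta)^{1/2}X(s,t)=\sum_{k\in\mathbb{Z}}|k|\,\hat X_k(t)e^{iks}$. 2. There exist $u,p$ solving the Stokes immersed boundary problem together with $X$ if and only if $X$ satisfies the contour dynamic formulation. 3. For any $u$ and $p$, the pair $(u,p)$ solves the Stokes immersed boundary problem together with $X$ if and only if $X$ satisfies the contour dynamic formulation and, for every $t\in J$, $$u(x,t)=\int_{\mathbb{T}}G(x-X(s',t))X_{ss}(s',t)\,ds'\quad\text{for all }x\in\mathbb{R}^2,$$ $$p(x,t)=\int_{\mathbb{T}}Q(x-X(s',t))\cdot X_{ss}(s',t)\,ds'\quad\text{for a.e. }x\in\mathbb{R}^2.$$ -/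

import Mathlib

open Set Filter Topology MeasureTheory
open scoped ContDiff Laplacian

noncomputable section

namespace StokesIB

/-- The Euclidean plane `ℝ²`. -/
abbrev Plane : Type := EuclideanSpace ℝ (Fin 2)

/-! ### Functions on the torus `𝕋 = ℝ / 2πℤ`

A function on `𝕋` is a `2π`-periodic function on `ℝ`. -/

/-- Distance of (the classes of) two parameters on `𝕋 = ℝ / 2πℤ`. -/
def torusDist (s₁ s₂ : ℝ) : ℝ := ‖((s₁ - s₂ : ℝ) : AddCircle (2 * Real.pi))‖

/-- `Z` is the weak derivative of `Y` on `𝕋`: `∫_𝕋 φ' Y = - ∫_𝕋 φ Z` for all smooth `φ` on `𝕋`. -/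
def HasWeakDerivTorus (Y Z : ℝ → Plane) : Prop :=
  ∀ φ : ℝ → ℝ, ContDiff ℝ ∞ φ → Function.Periodic φ (2 * Real.pi) →
    ∫ s in (0 : ℝ)..(2 * Real.pi), deriv φ s • Y s =
      - ∫ s in (0 : ℝ)..(2 * Real.pi), φ s • Z s

/-- `Y ∈ L²(𝕋)` (only the values on one period matter). -/
def MemL2Torus (Y : ℝ → Plane) : Prop :=
  MemLp Y 2 (volume.restrict (Ioc 0 (2 * Real.pi)))

/-- `Y ∈ H²(𝕋)`, where `Y` is the continuous representative of its class: `Y` and its weak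
derivatives of orders one and two are square integrable. -/
structure MemH2Torus (Y : ℝ → Plane) : Prop where
  periodic : Function.Periodic Y (2 * Real.pi)
  continuous : Continuous Y
  memL2 : MemL2Torus Y
  weakDerivs : ∃ Y₁ Y₂ : ℝ → Plane, MemL2Torus Y₁ ∧ MemL2Torus Y₂ ∧
    HasWeakDerivTorus Y Y₁ ∧ HasWeakDerivTorus Y₁ Y₂

/-- The well-stretched assumption, for some constant `lam > 0`. -/
def WellStretched (Y : ℝ → Plane) : Prop :=
  ∃ lam : ℝ, 0 < lam ∧ ∀ s₁ s₂ : ℝ, lam * torusDist s₁ s₂ ≤ ‖Y s₁ - Y s₂‖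

/-- The second derivative `Y''`. A function in `H²(𝕋)` is continuously differentiable with
absolutely continuous derivative, so that `Y'` is `deriv Y`, and the weak derivative `Y''` is
almost everywhere the classical derivative of `Y'`. -/
def secondDeriv (Y : ℝ → Plane) (s : ℝ) : Plane := deriv (deriv Y) s

/-! ### The half Laplacian on the torus -/

/-- The integral of the kernel of the half Laplacian over `ε ≤ |s' - s| ≤ π`, with its factor
`-1/π`. -/
def halfLaplacianTrunc (Y : ℝ → Plane) (s ε : ℝ) : Plane :=
  (-(1 / Real.pi)) •
    ((∫ r in (s - Real.pi)..(s - ε), (1 / (4 * Real.sin ((r - s) / 2) ^ 2)) • (Y r - Y s)) +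
      ∫ r in (s + ε)..(s + Real.pi), (1 / (4 * Real.sin ((r - s) / 2) ^ 2)) • (Y r - Y s))

/-- The half Laplacian `(-Δ)^{1/2}` on `𝕋` as a principal value integral. -/
def halfLaplacian (Y : ℝ → Plane) (s : ℝ) : Plane :=
  limUnder (𝓝[>] (0 : ℝ)) (halfLaplacianTrunc Y s)

/-- The `k`-th Fourier coefficient of the `i`-th component of `Y`. -/
def fourierCoef (Y : ℝ → Plane) (i : Fin 2) (k : ℤ) : ℂ :=
  (1 / (2 * Real.pi) : ℂ) * ∫ s in (0 : ℝ)..(2 * Real.pi),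
    Complex.exp (-(Complex.I * (k : ℂ) * (s : ℂ))) * ((Y s i : ℝ) : ℂ)

/-! ### Fundamental solution -/

/-- `G(x) = (1 / 4π) (- ln |x| Id + x ⊗ x / |x|²)`, as a linear map of the plane. -/
def stokeslet (x : Plane) : Plane →L[ℝ] Plane :=
  (1 / (4 * Real.pi)) • (-(Real.log ‖x‖ • ContinuousLinearMap.id ℝ Plane) +
    (1 / ‖x‖ ^ 2) • (innerSL ℝ x).smulRight x)

/-- `Q(x) = x / (2π |x|²)`, the pressure of the fundamental solution. -/
def pressureKernel (x : Plane) : Plane := (1 / (2 * Real.pi * ‖x‖ ^ 2)) • x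

/-- `u_Y(x) = ∫_𝕋 G(x - Y(s')) Y''(s') ds'`. -/
def velocityOf (Y : ℝ → Plane) (x : Plane) : Plane :=
  ∫ r in (0 : ℝ)..(2 * Real.pi), stokeslet (x - Y r) (secondDeriv Y r)

/-- `p_Y(x) = ∫_𝕋 Q(x - Y(s')) · Y''(s') ds'`. -/
def pressureOf (Y : ℝ → Plane) (x : Plane) : ℝ :=
  ∫ r in (0 : ℝ)..(2 * Real.pi), inner ℝ (pressureKernel (x - Y r)) (secondDeriv Y r)

/-! ### The contour dynamic formulation -/

/-- `Γ₀(s, s') = - ∂_{s'} [G(Y(s) - Y(s'))] (Y'(s') - Y'(s))`. -/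
def Gamma0 (Y : ℝ → Plane) (s s' : ℝ) : Plane :=
  -(deriv (fun r : ℝ => stokeslet (Y s - Y r)) s' (deriv Y s' - deriv Y s))

/-- `ℒ Y = - (1/4) (-Δ)^{1/2} Y`. -/
def opL (Y : ℝ → Plane) (s : ℝ) : Plane := (-(1 / 4 : ℝ)) • halfLaplacian Y s

/-- `g_Y(s) = ∫_𝕋 Γ₀(s, s') ds' + (1/4) (-Δ)^{1/2} Y(s)`. -/
def gTerm (Y : ℝ → Plane) (s : ℝ) : Plane :=
  (∫ s' in (0 : ℝ)..(2 * Real.pi), Gamma0 Y s s') + (1 / 4 : ℝ) • halfLaplacian Y s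

/-- The initial condition `X(s, 0) = X₀(s)`, attained continuously in time from the right. -/
def InitialCondition (X : ℝ → ℝ → Plane) (X₀ : ℝ → Plane) : Prop :=
  ∀ s : ℝ, X 0 s = X₀ s ∧ ContinuousWithinAt (fun t => X t s) (Ici 0) 0

/-- The contour dynamic formulation, with the equation imposed at the times in `J`.
Here `X t s` is `X(s, t)`. -/
structure IsContourSolution (J : Set ℝ) (X : ℝ → ℝ → Plane) (X₀ : ℝ → Plane) : Prop where
  evolution : ∀ t ∈ J, ∀ s : ℝ,
    HasDerivAt (fun τ => X τ s) (opL (X t) s + gTerm (X t) s) t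
  initial : InitialCondition X X₀

/-! ### The Stokes immersed boundary problem -/

/-- Divergence of a vector field on the plane. -/
def divergence (φ : Plane → Plane) (x : Plane) : ℝ :=
  ∑ i : Fin 2, (fderiv ℝ φ x (EuclideanSpace.single i 1)) i

/-- `(u, p)` solves, in the sense of distributions on the plane,
`-Δ u + ∇ p = ∫_𝕋 Y''(s) δ(x - Y(s)) ds`, `div u = 0`, with `|u|, |p| → 0` at infinity.
The velocity is continuous, so that it can be evaluated on the string; the pressure is a class of
locally integrable functions, and its decay is understood outside a null set. -/
structure IsStokesFlow (Y : ℝ → Plane) (u : Plane → Plane) (p : Plane → ℝ) : Prop where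
  continuous_u : Continuous u
  locallyIntegrable_p : LocallyIntegrable p volume
  momentum : ∀ φ : Plane → Plane, ContDiff ℝ ∞ φ → HasCompactSupport φ →
    -(∫ x, inner ℝ (u x) (Laplacian.laplacian φ x)) - ∫ x, p x * divergence φ x =
      ∫ s in (0 : ℝ)..(2 * Real.pi), inner ℝ (secondDeriv Y s) (φ (Y s))
  incompressible : ∀ ψ : Plane → ℝ, ContDiff ℝ ∞ ψ → HasCompactSupport ψ →
    ∫ x, fderiv ℝ ψ x (u x) = 0
  decay_u : Tendsto u (cocompact Plane) (𝓝 0)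
  decay_p : Tendsto p (cocompact Plane ⊓ ae volume) (𝓝 0)

/-- The Stokes immersed boundary problem with the equations imposed at the times in `J`:
the fluid is at each such time the Stokes flow driven by the string, and the string moves with
the fluid. -/
structure IsImmersedBoundarySolution (J : Set ℝ) (X : ℝ → ℝ → Plane) (X₀ : ℝ → Plane)
    (u : ℝ → Plane → Plane) (p : ℝ → Plane → ℝ) : Prop where
  stokes : ∀ t ∈ J, IsStokesFlow (X t) (u t) (p t)
  kinematic : ∀ t ∈ J, ∀ s : ℝ, HasDerivAt (fun τ => X τ s) (u t (X t s)) t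
  initial : InitialCondition X X₀

end StokesIB

end

noncomputable section

namespace StokesIB

/-! ### Weak derivatives on the torus and Fourier coefficients -/

/-! The analysis is done at one fixed time, for a single well-stretched curve `Y` in `H²`. Time
enters only through the derivative of the string, which both formulations equate with a vector
depending on `Y` alone. Three facts give the equivalence.

Existence. The potentials `velocityOf Y` and `pressureOf Y` form a decaying Stokes flow driven by
`Y''` (`IsH2Curve.isStokesFlow`). The distributional identities for `G` and `Q` reduce to `Δ log |x|
= 2πδ` (`integral_logKernel_lap`, `stokesletPairing_lap`), and Fubini transfers them to the curve.
The velocity is Hölder continuous across the string because well-stretchedness bounds the singular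
integrals uniformly in `x`. It decays, although `G` grows logarithmically, because `Y''` has mean
zero.

Uniqueness. Subtract two decaying flows with the same force. Testing with gradients shows that the
pressure difference is weakly harmonic, so it vanishes almost everywhere. Each velocity component is
then weakly harmonic too, and vanishes (`IsStokesFlow.pressure_unique`,
`IsStokesFlow.velocity_unique`). The Liouville statement behind this,
`ae_eq_zero_of_weakly_harmonic`, combines mollification with the maximum principle.

Restriction to the string. Integrating by parts in `∫ G(Y(s) - Y(s')) Y''(s') ds'` against the
primitive `Y'(s') - Y'(s)` gives `∫ Γ₀` (`IsH2Curve.velocityOf_eq_integral_Gamma0`). The boundary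
terms at `s' = s` vanish because `Y'` is Hölder of exponent `1/2`, which beats the logarithm. The
half Laplacian cancels between the two terms of the contour equation, so that equation says exactly
`X_t = u(X)`.

The statement on the half Laplacian is independent of this. The Fourier symbol of the truncated
operator is the integral of a Fejér-type polynomial, lies between `0` and `|k|`, and tends to `|k|`;
since `|k| |c_k|` is summable, the limit passes through the series (`tendsto_halfLaplacianTrunc`).
-/

/-- The weak derivative on the torus, for scalar functions. -/
def HasScalarWeakDeriv (U Z : ℝ → ℝ) : Prop :=
  ∀ φ : ℝ → ℝ, ContDiff ℝ ∞ φ → Function.Periodic φ (2 * Real.pi) →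
    ∫ s in (0 : ℝ)..(2 * Real.pi), deriv φ s * U s =
      - ∫ s in (0 : ℝ)..(2 * Real.pi), φ s * Z s

/-- Fourier coefficients of a scalar function. -/
def scalarFourierCoef (U : ℝ → ℝ) (k : ℤ) : ℂ :=
  (1 / (2 * Real.pi) : ℂ) * ∫ s in (0 : ℝ)..(2 * Real.pi),
    Complex.exp (-(Complex.I * (k : ℂ) * (s : ℂ))) * ((U s : ℝ) : ℂ)

theorem fourierCoef_eq_scalar (Y : ℝ → Plane) (i : Fin 2) (k : ℤ) :
    fourierCoef Y i k = scalarFourierCoef (fun s => Y s i) k := rfl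

theorem scalarFourierCoef_eq_fourierCoeffOn (U : ℝ → ℝ) (k : ℤ) :
    scalarFourierCoef U k = fourierCoeffOn Real.two_pi_pos (fun s => (U s : ℂ)) k := by
  rw [fourierCoeffOn_eq_integral, scalarFourierCoef]
  simp only [sub_zero, fourier_coe_apply, smul_eq_mul]
  rw [Complex.real_smul]
  push_cast
  congr 1
  refine intervalIntegral.integral_congr fun s _ => ?_
  congr 2
  have : (Real.pi : ℂ) ≠ 0 := by exact_mod_cast Real.pi_ne_zero
  field_simp

theorem intervalIntegrable_of_memLp_two {U : ℝ → ℝ}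
    (hU : MemLp U 2 (volume.restrict (Ioc 0 (2 * Real.pi)))) :
    IntervalIntegrable U volume 0 (2 * Real.pi) := by
  rw [intervalIntegrable_iff_integrableOn_Ioc_of_le Real.two_pi_pos.le]
  exact hU.integrable (by norm_num)

theorem integral_exp_mul_eq {U : ℝ → ℝ} (hU : IntervalIntegrable U volume 0 (2 * Real.pi))
    (k : ℤ) :
    ∫ s in (0 : ℝ)..(2 * Real.pi), Complex.exp (-(Complex.I * (k : ℂ) * (s : ℂ))) * (U s : ℂ) =
      ((∫ s in (0 : ℝ)..(2 * Real.pi), Real.cos (k * s) * U s : ℝ) : ℂ) -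
        Complex.I * ((∫ s in (0 : ℝ)..(2 * Real.pi), Real.sin (k * s) * U s : ℝ) : ℂ) := by
  rw [← intervalIntegral.integral_ofReal, ← intervalIntegral.integral_ofReal,
    ← intervalIntegral.integral_const_mul, ← intervalIntegral.integral_sub]
  · refine intervalIntegral.integral_congr fun s _ => ?_
    have h : -(Complex.I * (k : ℂ) * (s : ℂ)) = ((-(k * s : ℝ) : ℝ) : ℂ) * Complex.I := by
      push_cast; ring
    simp only [h, Complex.exp_mul_I]
    rw [← Complex.ofReal_cos, ← Complex.ofReal_sin, Real.cos_neg, Real.sin_neg]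
    push_cast
    ring
  · have := hU.continuousOn_mul (g := fun s => Real.cos (k * s)) (by fun_prop)
    exact ⟨this.1.ofReal, this.2.ofReal⟩
  · have := hU.continuousOn_mul (g := fun s => Real.sin (k * s)) (by fun_prop)
    exact IntervalIntegrable.const_mul ⟨this.1.ofReal, this.2.ofReal⟩ _

/-- Test functions are real, so the exponential is tested through `cos (k s)` and `sin (k s)`
separately and reassembled with `I² = -1`. -/
theorem HasScalarWeakDeriv.fourier_eq {U Z : ℝ → ℝ} (h : HasScalarWeakDeriv U Z)
    (hU : IntervalIntegrable U volume 0 (2 * Real.pi))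
    (hZ : IntervalIntegrable Z volume 0 (2 * Real.pi)) (k : ℤ) :
    scalarFourierCoef Z k = Complex.I * k * scalarFourierCoef U k := by
  unfold StokesIB.scalarFourierCoef
  rw [integral_exp_mul_eq hU, integral_exp_mul_eq hZ]
  have hper : ∀ x : ℝ, (k : ℝ) * (x + 2 * Real.pi) = k * x + k * (2 * Real.pi) := fun x => by ring
  have h1 := h (fun s => Real.cos (k * s)) (by fun_prop)
    (fun x => by simp only [hper]; rw [Real.cos_add_int_mul_two_pi])
  have h2 := h (fun s => Real.sin (k * s)) (by fun_prop)
    (fun x => by simp only [hper]; rw [Real.sin_add_int_mul_two_pi])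
  have d1 : deriv (fun s : ℝ => Real.cos (k * s)) = fun s => -(k * Real.sin (k * s)) := by
    ext s
    have := ((hasDerivAt_id s).const_mul (k : ℝ)).cos.deriv
    simp only [id] at this
    rw [this]; ring
  have d2 : deriv (fun s : ℝ => Real.sin (k * s)) = fun s => k * Real.cos (k * s) := by
    ext s
    have := ((hasDerivAt_id s).const_mul (k : ℝ)).sin.deriv
    simp only [id] at this
    rw [this]; ring
  rw [d1] at h1
  rw [d2] at h2
  simp only [neg_mul, mul_assoc, intervalIntegral.integral_neg,
    intervalIntegral.integral_const_mul, neg_inj] at h1 h2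
  have h2' : ∫ s in (0 : ℝ)..(2 * Real.pi), Real.sin (k * s) * Z s =
      -(k * ∫ s in (0 : ℝ)..(2 * Real.pi), Real.cos (k * s) * U s) := by linarith
  rw [← h1, h2']
  push_cast
  linear_combination ((1 / (2 * Real.pi : ℂ)) * k *
    ((∫ s in (0 : ℝ)..(2 * Real.pi), Real.sin (k * s) * U s : ℝ) : ℂ)) * Complex.I_sq

/-- Integration by parts of a `C¹` function against a primitive of an integrable function. -/
theorem integral_mul_eq_sub_of_primitive {f Z W : ℝ → ℝ} {a b : ℝ}
    (hf : ContDiffOn ℝ 1 f (uIcc a b)) (hZ : IntervalIntegrable Z volume a b)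
    (hW : ∀ x ∈ uIcc a b, W x = W a + ∫ t in a..x, Z t) :
    ∫ x in a..b, f x * Z x = f b * W b - f a * W a - ∫ x in a..b, deriv f x * W x := by
  -- The primitive is only absolutely continuous, with derivative `Z` almost everywhere; this
  -- suffices for integration by parts.
  have hac := hZ.absolutelyContinuousOnInterval_intervalIntegral (c := a) (by simp)
  have hfac := hf.absolutelyContinuousOnInterval
  have hderiv : ∀ᵐ x, x ∈ uIoc a b → deriv (fun y => ∫ t in a..y, Z t) x = Z x := by
    filter_upwards [hZ.ae_hasDerivAt_integral] with x hx hm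
    exact (hx (uIoc_subset_uIcc hm) a (by simp)).deriv
  have key := hfac.integral_mul_deriv_eq_deriv_mul hac
  have e1 : ∫ x in a..b, f x * deriv (fun y => ∫ t in a..y, Z t) x = ∫ x in a..b, f x * Z x := by
    refine intervalIntegral.integral_congr_ae ?_
    filter_upwards [hderiv] with x hx hm
    rw [hx hm]
  have e2 : ∫ x in a..b, deriv f x * W x =
      (∫ x in a..b, deriv f x * W a) + ∫ x in a..b, deriv f x * ∫ t in a..x, Z t := by
    rw [← intervalIntegral.integral_add]
    · refine intervalIntegral.integral_congr fun x hx => ?_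
      rw [hW x hx]; ring
    · exact hfac.intervalIntegrable_deriv.mul_const _
    · exact hfac.intervalIntegrable_deriv.mul_continuousOn hac.continuousOn
  rw [e1] at key
  rw [e2, key, intervalIntegral.integral_mul_const, hfac.integral_deriv_eq_sub,
    hW b (by simp)]
  simp only [intervalIntegral.integral_same]
  ring

/-- Parseval: all coefficients vanish, hence so does the `L²` norm. -/
theorem ae_eq_zero_of_scalarFourierCoef_eq_zero {V : ℝ → ℝ}
    (hV : MemLp V 2 (volume.restrict (Ioc 0 (2 * Real.pi))))
    (h : ∀ k, scalarFourierCoef V k = 0) :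
    V =ᵐ[volume.restrict (Ioc 0 (2 * Real.pi))] 0 := by
  have hVc : MemLp (fun s => (V s : ℂ)) 2 (volume.restrict (Ioc 0 (2 * Real.pi))) := hV.ofReal
  have hs := tsum_sq_fourierCoeffOn Real.two_pi_pos hVc
  simp only [← scalarFourierCoef_eq_fourierCoeffOn, h, norm_zero, ne_eq, OfNat.ofNat_ne_zero,
    not_false_eq_true, zero_pow, tsum_zero, sub_zero, smul_eq_mul] at hs
  have hz : ∫ x in (0 : ℝ)..(2 * Real.pi), ‖(V x : ℂ)‖ ^ 2 = 0 := by
    rcases mul_eq_zero.1 hs.symm with h | h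
    · exact absurd h (inv_ne_zero Real.two_pi_pos.ne')
    · exact h
  rw [intervalIntegral.integral_of_le Real.two_pi_pos.le, integral_eq_zero_iff_of_nonneg
    (fun _ => by positivity) hVc.integrable_norm_pow'] at hz
  filter_upwards [hz] with x hx
  simpa using hx

/-- A square integrable function with square integrable weak derivative is almost everywhere a
primitive of that derivative. -/
theorem HasScalarWeakDeriv.exists_ae_eq_primitive {U Z : ℝ → ℝ} (h : HasScalarWeakDeriv U Z)
    (hU : MemLp U 2 (volume.restrict (Ioc 0 (2 * Real.pi))))
    (hZ : MemLp Z 2 (volume.restrict (Ioc 0 (2 * Real.pi)))) :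
    (∫ s in (0 : ℝ)..(2 * Real.pi), Z s = 0) ∧
      ∃ c : ℝ, ∀ᵐ s ∂(volume.restrict (Ioc 0 (2 * Real.pi))), U s = c + ∫ t in (0 : ℝ)..s, Z t := by
  have hUi := intervalIntegrable_of_memLp_two hU
  have hZi := intervalIntegrable_of_memLp_two hZ
  -- Testing with the constant `1` gives mean zero, so the primitive `W` takes the same value at
  -- both ends of the period.
  have h0 : ∫ s in (0 : ℝ)..(2 * Real.pi), Z s = 0 := by
    have := h (fun _ => 1) contDiff_const (fun _ => rfl)
    simp at this
    linarith
  refine ⟨h0, ?_⟩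
  set W : ℝ → ℝ := fun s => ∫ t in (0 : ℝ)..s, Z t with hWdef
  have hWc : ContinuousOn W (uIcc 0 (2 * Real.pi)) :=
    (hZi.absolutelyContinuousOnInterval_intervalIntegral (c := 0) (by simp)).continuousOn
  have hWi : IntervalIntegrable W volume 0 (2 * Real.pi) := hWc.intervalIntegrable
  have hWL : MemLp W 2 (volume.restrict (Ioc 0 (2 * Real.pi))) := by
    rw [uIcc_of_le Real.two_pi_pos.le] at hWc
    obtain ⟨C, hC⟩ := isCompact_Icc.exists_bound_of_continuousOn hWc
    refine MemLp.of_bound ((hWc.mono Ioc_subset_Icc_self).aestronglyMeasurable measurableSet_Ioc) C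
      ?_
    filter_upwards [ae_restrict_mem measurableSet_Ioc] with x hx
    exact hC x (Ioc_subset_Icc_self hx)
  have hWw : HasScalarWeakDeriv W Z := by
    intro φ hφ _
    have := integral_mul_eq_sub_of_primitive (f := φ) (W := W)
      ((hφ.of_le (by exact_mod_cast le_top)).contDiffOn) hZi (fun x _ => by simp [hWdef])
    have hW0 : W 0 = 0 := by simp [hWdef]
    have hW1 : W (2 * Real.pi) = 0 := h0
    rw [hW0, hW1] at this
    linarith
  -- The mean of `U - W`. Subtracting it kills the zeroth Fourier coefficient; the others vanish
  -- because `U - W - c` has weak derivative zero.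
  set c : ℝ := (1 / (2 * Real.pi)) * ∫ s in (0 : ℝ)..(2 * Real.pi), (U s - W s) with hc
  have hV : MemLp (fun s => U s - W s - c) 2 (volume.restrict (Ioc 0 (2 * Real.pi))) :=
    (hU.sub hWL).sub (memLp_const c)
  have hVi := intervalIntegrable_of_memLp_two hV
  have hVw : HasScalarWeakDeriv (fun s => U s - W s - c) (fun _ => 0) := by
    intro φ hφ hφp
    have hd : ContinuousOn (deriv φ) (uIcc 0 (2 * Real.pi)) :=
      (hφ.continuous_deriv (by simp)).continuousOn
    have e : ∫ s in (0 : ℝ)..(2 * Real.pi), deriv φ s * (U s - W s - c) =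
        (∫ s in (0 : ℝ)..(2 * Real.pi), deriv φ s * U s) -
        (∫ s in (0 : ℝ)..(2 * Real.pi), deriv φ s * W s) -
        ∫ s in (0 : ℝ)..(2 * Real.pi), deriv φ s * c := by
      rw [← intervalIntegral.integral_sub (hUi.continuousOn_mul hd) (hWi.continuousOn_mul hd),
        ← intervalIntegral.integral_sub
          ((hUi.continuousOn_mul hd).sub (hWi.continuousOn_mul hd)) (hd.intervalIntegrable.mul_const c)]
      refine intervalIntegral.integral_congr fun s _ => ?_
      ring
    have e2 : ∫ s in (0 : ℝ)..(2 * Real.pi), deriv φ s = 0 := by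
      rw [intervalIntegral.integral_deriv_eq_sub (fun x _ => hφ.differentiable (by simp) x)
        hd.intervalIntegrable]
      have := hφp 0
      rw [zero_add] at this
      rw [this, sub_self]
    rw [e, h φ hφ hφp, hWw φ hφ hφp, intervalIntegral.integral_mul_const, e2]
    simp
  refine ⟨c, ?_⟩
  have hz := ae_eq_zero_of_scalarFourierCoef_eq_zero hV (fun k => by
    have hk := hVw.fourier_eq hVi intervalIntegrable_const k
    have h0' : scalarFourierCoef (fun _ => (0 : ℝ)) k = 0 := by simp [StokesIB.scalarFourierCoef]
    rw [h0'] at hk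
    rcases eq_or_ne k 0 with rfl | hk0
    · have : ∫ s in (0 : ℝ)..(2 * Real.pi), (U s - W s - c) = 0 := by
        rw [intervalIntegral.integral_sub (hUi.sub hWi) intervalIntegrable_const,
          intervalIntegral.integral_const, hc]
        have := Real.pi_ne_zero
        simp only [sub_zero, smul_eq_mul]
        field_simp
        ring
      rw [StokesIB.scalarFourierCoef, integral_exp_mul_eq hVi]
      simp [this]
    · have : (k : ℂ) ≠ 0 := by exact_mod_cast hk0
      simpa [Complex.I_ne_zero, this] using hk.symm)
  filter_upwards [hz] with s hs
  simp only [Pi.zero_apply] at hs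
  linarith

/-! ### Regularity of curves in `H²` -/

/-- The coordinate functionals of the plane. -/
def coordinate (i : Fin 2) : Plane →L[ℝ] ℝ := EuclideanSpace.proj i

@[simp]
theorem coordinate_apply (i : Fin 2) (x : Plane) : coordinate i x = x i := rfl

theorem MemL2Torus.component {Y : ℝ → Plane} (hY : MemL2Torus Y) (i : Fin 2) :
    MemLp (fun s => Y s i) 2 (volume.restrict (Ioc 0 (2 * Real.pi))) :=
  (coordinate i).comp_memLp' hY

theorem MemL2Torus.intervalIntegrable {Y : ℝ → Plane} (hY : MemL2Torus Y) :
    IntervalIntegrable Y volume 0 (2 * Real.pi) := by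
  rw [intervalIntegrable_iff_integrableOn_Ioc_of_le Real.two_pi_pos.le]
  exact MemLp.integrable (by norm_num) hY

theorem intervalIntegral_component {Y : ℝ → Plane} {a b : ℝ}
    (hY : IntervalIntegrable Y volume a b) (i : Fin 2) :
    (∫ s in a..b, Y s) i = ∫ s in a..b, Y s i :=
  ((coordinate i).intervalIntegral_comp_comm hY).symm

theorem intervalIntegrable_component {Y : ℝ → Plane} {a b : ℝ}
    (hY : IntervalIntegrable Y volume a b) (i : Fin 2) :
    IntervalIntegrable (fun s => Y s i) volume a b :=
  ⟨(coordinate i).integrable_comp hY.1,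
    (coordinate i).integrable_comp hY.2⟩

theorem HasWeakDerivTorus.component {U Z : ℝ → Plane} (h : HasWeakDerivTorus U Z)
    (hU : MemL2Torus U) (hZ : MemL2Torus Z) (i : Fin 2) :
    HasScalarWeakDeriv (fun s => U s i) (fun s => Z s i) := by
  intro φ hφ hφp
  have hd : ContinuousOn (deriv φ) (uIcc 0 (2 * Real.pi)) :=
    (hφ.continuous_deriv (by simp)).continuousOn
  have := congrArg (fun v : Plane => v i) (h φ hφ hφp)
  simp only [PiLp.neg_apply] at this
  rw [intervalIntegral_component (hU.intervalIntegrable.continuousOn_smul hd),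
    intervalIntegral_component
      (hZ.intervalIntegrable.continuousOn_smul hφ.continuous.continuousOn)] at this
  simpa using this

theorem MemLp.uIoc_zero {Z : ℝ → Plane} (hZ : MemL2Torus Z) {s : ℝ}
    (hs : s ∈ Ioc 0 (2 * Real.pi)) : IntervalIntegrable Z volume 0 s :=
  hZ.intervalIntegrable.mono_set (by
    rw [uIcc_of_le hs.1.le, uIcc_of_le Real.two_pi_pos.le]
    exact Icc_subset_Icc_right hs.2)

theorem HasWeakDerivTorus.exists_ae_eq_primitive {U Z : ℝ → Plane} (h : HasWeakDerivTorus U Z)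
    (hU : MemL2Torus U) (hZ : MemL2Torus Z) :
    (∫ s in (0 : ℝ)..(2 * Real.pi), Z s = 0) ∧
      ∃ c : Plane, ∀ᵐ s ∂(volume.restrict (Ioc 0 (2 * Real.pi))), U s = c + ∫ t in (0 : ℝ)..s, Z t := by
  have H := fun i => (h.component hU hZ i).exists_ae_eq_primitive (hU.component i) (hZ.component i)
  refine ⟨?_, ?_⟩
  · ext i
    rw [intervalIntegral_component hZ.intervalIntegrable, (H i).1]
    rfl
  · choose c hc using fun i => (H i).2
    refine ⟨WithLp.toLp 2 c, ?_⟩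
    filter_upwards [hc 0, hc 1, ae_restrict_mem measurableSet_Ioc] with s h0 h1 hs
    ext i
    rw [PiLp.add_apply, intervalIntegral_component (MemLp.uIoc_zero hZ hs)]
    fin_cases i
    · simpa using h0
    · simpa using h1

/-- Curves on the torus whose derivative is absolutely continuous with square integrable
derivative. -/
structure IsH2Curve (Y : ℝ → Plane) : Prop where
  periodic : Function.Periodic Y (2 * Real.pi)
  hasDerivAt : ∀ s, HasDerivAt Y (deriv Y s) s
  continuous_deriv : Continuous (deriv Y)
  memLp : MemLp (secondDeriv Y) 2 (volume.restrict (Ioc 0 (2 * Real.pi)))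
  integrable : ∀ a b, IntervalIntegrable (secondDeriv Y) volume a b
  integral_secondDeriv : ∀ a b, ∫ s in a..b, secondDeriv Y s = deriv Y b - deriv Y a

/-- Integrating the second weak derivative twice produces a periodic `C¹` function, the means of
both weak derivatives being zero. It agrees with `Y` almost everywhere on a period, hence everywhere
by continuity and periodicity. Lebesgue differentiation then identifies the pointwise `Y''` with the
weak one almost everywhere. -/
theorem MemH2Torus.isH2Curve {Y : ℝ → Plane} (hY : MemH2Torus Y) : IsH2Curve Y := by
  obtain ⟨Y₁, Y₂, hY₁, hY₂, hw₁, hw₂⟩ := hY.weakDerivs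
  obtain ⟨hi₁, c', hc'⟩ := hw₁.exists_ae_eq_primitive hY.memL2 hY₁
  obtain ⟨hi₂, c, hc⟩ := hw₂.exists_ae_eq_primitive hY₁ hY₂
  -- The weak derivatives are constrained only on one period, so `Y₂` is replaced by the periodic
  -- extension of its values on `(0, 2π]`.
  set Z : ℝ → Plane := fun s => Y₂ (toIocMod Real.two_pi_pos 0 s) with hZ
  have hZper : Function.Periodic Z (2 * Real.pi) := fun s => by simp [hZ]
  have hZeq : ∀ s ∈ Ioc 0 (2 * Real.pi), Z s = Y₂ s := fun s hs => by
    simp only [hZ]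
    rw [(toIocMod_eq_self Real.two_pi_pos).2 (by simpa using hs)]
  have hZae : Z =ᵐ[volume.restrict (Ioc 0 (2 * Real.pi))] Y₂ := by
    filter_upwards [ae_restrict_mem measurableSet_Ioc] with s hs using hZeq s hs
  have hZL : MemLp Z 2 (volume.restrict (Ioc 0 (2 * Real.pi))) := MemLp.ae_eq hZae.symm hY₂
  have hZi : ∀ a b, IntervalIntegrable Z volume a b :=
    hZper.intervalIntegrable₀ Real.two_pi_pos.ne' (MemL2Torus.intervalIntegrable hZL)
  have hZ0 : ∫ s in (0 : ℝ)..(2 * Real.pi), Z s = 0 := by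
    rw [← hi₂]
    refine intervalIntegral.integral_congr_ae (Eventually.of_forall fun s hs => ?_)
    rw [uIoc_of_le Real.two_pi_pos.le] at hs
    exact hZeq s hs
  set D : ℝ → Plane := fun s => c + ∫ t in (0 : ℝ)..s, Z t with hD
  have hDc : Continuous D := continuous_const.add (intervalIntegral.continuous_primitive hZi 0)
  have hDper : Function.Periodic D (2 * Real.pi) := fun s => by
    simp only [hD]
    rw [hZper.intervalIntegral_add_eq_add 0 s hZi, zero_add, hZ0, add_zero]
  have hDae : ∀ᵐ s ∂(volume.restrict (Ioc 0 (2 * Real.pi))), Y₁ s = D s := by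
    filter_upwards [hc, ae_restrict_mem measurableSet_Ioc] with s h1 hs
    rw [h1]
    simp only [hD]
    congr 1
    refine intervalIntegral.integral_congr_ae (Eventually.of_forall fun t ht => ?_)
    rw [uIoc_of_le hs.1.le] at ht
    exact (hZeq t ⟨ht.1, ht.2.trans hs.2⟩).symm
  have hprim : ∀ s ∈ Ioc 0 (2 * Real.pi), ∫ t in (0 : ℝ)..s, Y₁ t = ∫ t in (0 : ℝ)..s, D t := by
    intro s hs
    refine intervalIntegral.integral_congr_ae ?_
    rw [uIoc_of_le hs.1.le, ← ae_restrict_iff' measurableSet_Ioc]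
    exact ae_restrict_of_ae_restrict_of_subset (Ioc_subset_Ioc_right hs.2) hDae
  set F : ℝ → Plane := fun s => c' + ∫ t in (0 : ℝ)..s, D t with hF
  have hFd : ∀ s, HasDerivAt F (D s) s := fun s =>
    (intervalIntegral.integral_hasDerivAt_right (hDc.intervalIntegrable _ _)
      (hDc.stronglyMeasurableAtFilter _ _) hDc.continuousAt).const_add c'
  have hFc : Continuous F := continuous_iff_continuousAt.2 fun s => (hFd s).continuousAt
  have hD0 : ∫ s in (0 : ℝ)..(2 * Real.pi), D s = 0 := by
    rw [← hprim _ ⟨Real.two_pi_pos, le_rfl⟩, hi₁]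
  have hFper : Function.Periodic F (2 * Real.pi) := fun s => by
    simp only [hF]
    rw [hDper.intervalIntegral_add_eq_add 0 s (fun a b => hDc.intervalIntegrable a b), zero_add,
      hD0, add_zero]
  have hYFae : Y =ᵐ[volume.restrict (Ioc 0 (2 * Real.pi))] F := by
    filter_upwards [hc', ae_restrict_mem measurableSet_Ioc] with s h1 hs
    rw [h1, hprim s hs]
  have hYFon : EqOn Y F (Ioc 0 (2 * Real.pi)) :=
    Measure.eqOn_Ioc_of_ae_eq volume hYFae hY.continuous.continuousOn hFc.continuousOn
  have hYF : Y = F := by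
    ext1 s
    have h1 := hY.periodic.sub_zsmul_eq (x := s) (toIocDiv Real.two_pi_pos 0 s)
    have h2 := hFper.sub_zsmul_eq (x := s) (toIocDiv Real.two_pi_pos 0 s)
    rw [← h1, ← h2]
    exact hYFon (by simpa using toIocMod_mem_Ioc Real.two_pi_pos 0 s)
  have hdY : deriv Y = D := by rw [hYF]; ext1 s; exact (hFd s).deriv
  have hloc : LocallyIntegrable Z volume := fun x =>
    ⟨Ioc (x - 1) (x + 1), Ioc_mem_nhds (by linarith) (by linarith), (hZi _ _).1⟩
  have hsec : secondDeriv Y =ᵐ[volume] Z := by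
    filter_upwards [LocallyIntegrable.ae_hasDerivAt_integral hloc] with s hs
    unfold secondDeriv
    rw [hdY]
    exact ((hs 0).const_add c).deriv
  refine ⟨hY.periodic, fun s => ?_, hdY ▸ hDc, hZL.ae_eq (ae_restrict_of_ae hsec.symm), fun a b => ?_,
    fun a b => ?_⟩
  · rw [hdY, hYF]; exact hFd s
  · exact (hZi a b).congr_ae (ae_restrict_of_ae hsec.symm)
  · rw [hdY, intervalIntegral.integral_congr_ae (g := Z) (by filter_upwards [hsec] with s hs _ using hs)]
    simp only [hD]
    rw [add_sub_add_left_eq_sub, intervalIntegral.integral_interval_sub_left (hZi _ _) (hZi _ _)]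

/-! ### Decay of the Fourier coefficients of an `H²` curve. -/

theorem summable_sq_scalarFourierCoef {U : ℝ → ℝ}
    (hU : MemLp U 2 (volume.restrict (Ioc 0 (2 * Real.pi)))) :
    Summable fun k => ‖scalarFourierCoef U k‖ ^ 2 := by
  have hUc : MemLp (fun s => (U s : ℂ)) 2 (volume.restrict (Ioc 0 (2 * Real.pi))) := hU.ofReal
  simp only [scalarFourierCoef_eq_fourierCoeffOn]
  exact (hasSum_sq_fourierCoeffOn Real.two_pi_pos hUc).summable

/-- For `k ≠ 0`, `2 |k| |c_k| ≤ |k|⁴ |c_k|² + k⁻²`; the first term on the right is the squared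
coefficient of the second weak derivative. -/
theorem MemH2Torus.summable_abs_mul_fourierCoef {Y : ℝ → Plane} (hY : MemH2Torus Y) (i : Fin 2) :
    Summable fun k : ℤ => ((|k| : ℤ) : ℝ) * ‖fourierCoef Y i k‖ := by
  obtain ⟨Y₁, Y₂, hY₁, hY₂, hw₁, hw₂⟩ := hY.weakDerivs
  have hii := fun {Z : ℝ → Plane} (h : MemL2Torus Z) =>
    intervalIntegrable_of_memLp_two (h.component i)
  have e1 := (hw₁.component hY.memL2 hY₁ i).fourier_eq (hii hY.memL2) (hii hY₁)
  have e2 := (hw₂.component hY₁ hY₂ i).fourier_eq (hii hY₁) (hii hY₂)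
  have hs := summable_sq_scalarFourierCoef (hY₂.component i)
  have hk : Summable fun k : ℤ => 1 / (k : ℝ) ^ 2 := Real.summable_one_div_int_pow.2 (by norm_num)
  refine Summable.of_nonneg_of_le (fun k => by positivity) (fun k => ?_) (hs.add hk)
  rw [e2, e1, ← fourierCoef_eq_scalar]
  simp only [norm_mul, Complex.norm_I, one_mul, Complex.norm_intCast, Int.cast_abs]
  rcases eq_or_ne k 0 with rfl | hk0
  · simp
  set m : ℝ := |(k : ℝ)| with hm
  have hm0 : 0 < m := abs_pos.2 (by exact_mod_cast hk0)
  set c := ‖fourierCoef Y i k‖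
  rw [show (k : ℝ) ^ 2 = m ^ 2 from (sq_abs _).symm]
  have : (m * (m * c)) ^ 2 + 1 / m ^ 2 - 2 * (m * c) = (m * (m * c) - 1 / m) ^ 2 := by
    field_simp
    ring
  have h0 : 0 ≤ m * c := by positivity
  nlinarith [sq_nonneg (m * (m * c) - 1 / m)]

/-! ### The half Laplacian -/

/-- `P` is the quotient `(1 - cos nr) / (1 - cos r)` and `D` its increment in `n`, both continuous
through `r = 0`. Since `D` itself increases by `2 cos ((n + 1) r)`, whose integral over `[0, π]` is
zero, the integral of `P` grows by `π` at each step. -/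
theorem exists_fejer_poly (n : ℕ) : ∃ P D : ℝ → ℝ, Continuous P ∧ Continuous D ∧
    (∀ r, (1 - Real.cos r) * P r = 1 - Real.cos (n * r)) ∧
    (∀ r, (1 - Real.cos r) * D r = Real.cos (n * r) - Real.cos ((n + 1) * r)) ∧
    ∫ r in (0 : ℝ)..Real.pi, P r = n * Real.pi ∧ ∫ r in (0 : ℝ)..Real.pi, D r = Real.pi := by
  induction n with
  | zero => exact ⟨fun _ => 0, fun _ => 1, continuous_const, continuous_const, by simp, by simp,
      by simp, by simp⟩
  | succ n ih =>
    obtain ⟨P, D, hP, hD, eP, eD, iP, iD⟩ := ih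
    refine ⟨fun r => P r + D r, fun r => D r + 2 * Real.cos ((n + 1) * r), hP.add hD,
      hD.add (by fun_prop), fun r => ?_, fun r => ?_, ?_, ?_⟩
    · rw [mul_add, eP, eD]; push_cast; ring
    · rw [mul_add, eD]
      have h1 : Real.cos ((n + 1 + 1) * r) =
          Real.cos ((n + 1) * r) * Real.cos r - Real.sin ((n + 1) * r) * Real.sin r := by
        rw [← Real.cos_add]; ring_nf
      have h2 : Real.cos (n * r) =
          Real.cos ((n + 1) * r) * Real.cos r + Real.sin ((n + 1) * r) * Real.sin r := by
        rw [← Real.cos_sub]; ring_nf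
      push_cast
      rw [h1, h2]; ring
    · rw [intervalIntegral.integral_add (hP.intervalIntegrable _ _) (hD.intervalIntegrable _ _),
        iP, iD]
      push_cast; ring
    · have h0 : ∫ r in (0 : ℝ)..Real.pi, 2 * Real.cos ((n + 1) * r) = 0 := by
        have hn : (n : ℝ) + 1 ≠ 0 := by positivity
        rw [intervalIntegral.integral_const_mul,
          intervalIntegral.integral_comp_mul_left (fun x => Real.cos x) hn, integral_cos]
        have := Real.sin_nat_mul_pi (n + 1)
        push_cast at this
        simp [this]
      rw [intervalIntegral.integral_add (hD.intervalIntegrable _ _)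
        (Continuous.intervalIntegrable (by fun_prop) _ _), iD, h0, add_zero]

/-- The Fourier multiplier of the truncated half Laplacian. -/
def truncMultiplier (k : ℤ) (ε : ℝ) : ℝ :=
  (1 / Real.pi) * ∫ r in ε..Real.pi,
    (1 / (4 * Real.sin (r / 2) ^ 2)) * (2 - 2 * Real.cos (k * r))

theorem four_mul_sin_half_sq (r : ℝ) : 4 * Real.sin (r / 2) ^ 2 = 2 * (1 - Real.cos r) := by
  have h := Real.sin_sq_add_cos_sq (r / 2)
  have : Real.cos (r / 2) ^ 2 = 1 / 2 + Real.cos r / 2 := by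
    rw [Real.cos_sq]; ring_nf
  linarith

theorem one_sub_cos_pos {r : ℝ} (h0 : 0 < r) (h1 : r ≤ Real.pi) : 0 < 1 - Real.cos r := by
  have := Real.cos_lt_cos_of_nonneg_of_le_pi le_rfl h1 h0
  rw [Real.cos_zero] at this
  linarith

theorem truncMultiplier_eq {k : ℤ} {P : ℝ → ℝ}
    (hP : ∀ r, (1 - Real.cos r) * P r = 1 - Real.cos (k.natAbs * r)) {ε : ℝ} (h0 : 0 < ε)
    (h1 : ε ≤ Real.pi) : truncMultiplier k ε = (1 / Real.pi) * ∫ r in ε..Real.pi, P r := by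
  unfold truncMultiplier
  congr 1
  refine intervalIntegral.integral_congr fun r hr => ?_
  rw [uIcc_of_le h1] at hr
  have hpos := one_sub_cos_pos (h0.trans_le hr.1) hr.2
  have hk : Real.cos (k * r) = Real.cos (k.natAbs * r) := by
    rcases Int.natAbs_eq k with h | h
    · rw [h]; simp
    · rw [h]; simp
  rw [four_mul_sin_half_sq, hk, ← mul_one_sub, ← hP]
  field_simp

/-- The Fejér quotient is nonnegative on `(0, π]`, so truncating its integral can only lower the
full value `|k| π`. This is the domination used when the truncation is removed. -/
theorem truncMultiplier_nonneg_le (k : ℤ) {ε : ℝ} (h0 : 0 < ε) (h1 : ε ≤ Real.pi) :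
    0 ≤ truncMultiplier k ε ∧ truncMultiplier k ε ≤ |(k : ℝ)| := by
  obtain ⟨P, D, hP, -, eP, -, iP, -⟩ := exists_fejer_poly k.natAbs
  rw [truncMultiplier_eq eP h0 h1]
  have hnn : ∀ r, 0 < r → r ≤ Real.pi → 0 ≤ P r := fun r h h' => by
    have h2 : 0 ≤ (1 - Real.cos r) * P r := by
      rw [eP]; linarith [Real.cos_le_one (k.natAbs * r)]
    exact nonneg_of_mul_nonneg_right h2 (one_sub_cos_pos h h')
  have hsplit := intervalIntegral.integral_add_adjacent_intervals
    (hP.intervalIntegrable (μ := volume) 0 ε) (hP.intervalIntegrable ε Real.pi)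
  have hA : 0 ≤ ∫ r in (0 : ℝ)..ε, P r := by
    rw [intervalIntegral.integral_of_le h0.le]
    exact setIntegral_nonneg measurableSet_Ioc fun r hr => hnn r hr.1 (hr.2.trans h1)
  have hB : 0 ≤ ∫ r in ε..Real.pi, P r := by
    rw [intervalIntegral.integral_of_le h1]
    exact setIntegral_nonneg measurableSet_Ioc fun r hr => hnn r (h0.trans hr.1) hr.2
  have hk : ((k.natAbs : ℕ) : ℝ) = |(k : ℝ)| := by
    rw [Nat.cast_natAbs, Int.cast_abs]
  rw [iP, hk] at hsplit
  refine ⟨by have := Real.pi_pos; positivity, ?_⟩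
  rw [one_div, inv_mul_le_iff₀ Real.pi_pos]
  linarith

theorem tendsto_truncMultiplier (k : ℤ) :
    Tendsto (truncMultiplier k) (𝓝[>] 0) (𝓝 |(k : ℝ)|) := by
  obtain ⟨P, D, hP, -, eP, -, iP, -⟩ := exists_fejer_poly k.natAbs
  have hk : ((k.natAbs : ℕ) : ℝ) = |(k : ℝ)| := by
    rw [Nat.cast_natAbs, Int.cast_abs]
  have hc : Continuous fun ε : ℝ => (1 / Real.pi) * ∫ r in ε..Real.pi, P r := by
    have : (fun ε : ℝ => ∫ r in ε..Real.pi, P r) = fun ε => -∫ r in Real.pi..ε, P r :=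
      funext fun ε => intervalIntegral.integral_symm _ _
    refine continuous_const.mul ?_
    rw [this]
    exact (intervalIntegral.continuous_primitive
      (fun a b => hP.intervalIntegrable a b) Real.pi).neg
  have h := (hc.tendsto 0).mono_left (nhdsWithin_le_nhds (s := Ioi 0))
  rw [iP, hk] at h
  have e : (1 / Real.pi) * (|(k : ℝ)| * Real.pi) = |(k : ℝ)| := by
    have := Real.pi_ne_zero
    field_simp
  rw [e] at h
  refine h.congr' ?_
  filter_upwards [Ioc_mem_nhdsGT Real.pi_pos] with ε hε
  exact (truncMultiplier_eq eP hε.1 hε.2).symm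

theorem continuousOn_halfLaplacian_kernel {ε : ℝ} (h0 : 0 < ε) :
    ContinuousOn (fun r : ℝ => 1 / (4 * Real.sin (r / 2) ^ 2)) (Icc ε Real.pi) := by
  refine ContinuousOn.div continuousOn_const (by fun_prop) fun r hr => ?_
  rw [four_mul_sin_half_sq]
  have := one_sub_cos_pos (h0.trans_le hr.1) hr.2
  positivity

/-- Reflecting the left half of the integral about `s` turns the integrand into a symmetric second
difference. -/
theorem halfLaplacianTrunc_component {Y : ℝ → Plane} (hY : Continuous Y) (s : ℝ) {ε : ℝ}
    (h0 : 0 < ε) (h1 : ε ≤ Real.pi) (i : Fin 2) :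
    halfLaplacianTrunc Y s ε i = -(1 / Real.pi) * ∫ r in ε..Real.pi,
      (1 / (4 * Real.sin (r / 2) ^ 2)) * (Y (s + r) i + Y (s - r) i - 2 * Y s i) := by
  have hK : ContinuousOn (fun r : ℝ => 1 / (4 * Real.sin (r / 2) ^ 2)) (uIcc ε Real.pi) := by
    rw [uIcc_of_le h1]; exact continuousOn_halfLaplacian_kernel h0
  set f : ℝ → Plane := fun r => (1 / (4 * Real.sin ((r - s) / 2) ^ 2)) • (Y r - Y s) with hf
  have e1 : ∫ r in (s - Real.pi)..(s - ε), f r = ∫ r in ε..Real.pi, f (s - r) :=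
    (intervalIntegral.integral_comp_sub_left f s).symm
  have e2 : ∫ r in (s + ε)..(s + Real.pi), f r = ∫ r in ε..Real.pi, f (s + r) :=
    (intervalIntegral.integral_comp_add_left f s).symm
  have g1 : (fun r => f (s - r)) =
      fun r => (1 / (4 * Real.sin (r / 2) ^ 2)) • (Y (s - r) - Y s) := by
    ext1 r
    simp only [hf]
    rw [show (s - r - s) / 2 = -(r / 2) by ring, Real.sin_neg, neg_sq]
  have g2 : (fun r => f (s + r)) =
      fun r => (1 / (4 * Real.sin (r / 2) ^ 2)) • (Y (s + r) - Y s) := by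
    ext1 r
    simp only [hf]
    rw [show (s + r - s) / 2 = r / 2 by ring]
  have i1 : IntervalIntegrable (fun r => (1 / (4 * Real.sin (r / 2) ^ 2)) • (Y (s - r) - Y s))
      volume ε Real.pi :=
    (hK.smul (Continuous.continuousOn (by fun_prop))).intervalIntegrable
  have i2 : IntervalIntegrable (fun r => (1 / (4 * Real.sin (r / 2) ^ 2)) • (Y (s + r) - Y s))
      volume ε Real.pi :=
    (hK.smul (Continuous.continuousOn (by fun_prop))).intervalIntegrable
  unfold halfLaplacianTrunc
  rw [show (∫ r in (s - Real.pi)..(s - ε), (1 / (4 * Real.sin ((r - s) / 2) ^ 2)) • (Y r - Y s)) =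
    ∫ r in (s - Real.pi)..(s - ε), f r from rfl,
    show (∫ r in (s + ε)..(s + Real.pi), (1 / (4 * Real.sin ((r - s) / 2) ^ 2)) • (Y r - Y s)) =
    ∫ r in (s + ε)..(s + Real.pi), f r from rfl, e1, e2, g1, g2,
    ← intervalIntegral.integral_add i1 i2, PiLp.smul_apply, smul_eq_mul,
    intervalIntegral_component (i1.add i2)]
  congr 1
  refine intervalIntegral.integral_congr fun r _ => ?_
  simp only [PiLp.add_apply, PiLp.smul_apply, PiLp.sub_apply, smul_eq_mul]
  ring

theorem hasSum_fourierCoef {Y : ℝ → Plane} (hper : Function.Periodic Y (2 * Real.pi))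
    (hY : Continuous Y) (i : Fin 2) (hs : Summable (fourierCoef Y i)) (x : ℝ) :
    HasSum (fun k : ℤ => fourierCoef Y i k * Complex.exp (Complex.I * (k : ℂ) * (x : ℂ)))
      ((Y x i : ℝ) : ℂ) := by
  have hT : Fact (0 < 2 * Real.pi) := ⟨Real.two_pi_pos⟩
  have hp : Function.Periodic (fun s => ((Y s i : ℝ) : ℂ)) (2 * Real.pi) := fun s => by
    simp only [hper s]
  have hc : Continuous fun s => ((Y s i : ℝ) : ℂ) :=
    Complex.continuous_ofReal.comp ((coordinate i).continuous.comp hY)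
  let f : C(AddCircle (2 * Real.pi), ℂ) := ⟨hp.lift, hc.quotient_lift _⟩
  have hf : ∀ s : ℝ, f (s : AddCircle (2 * Real.pi)) = ((Y s i : ℝ) : ℂ) := fun s => rfl
  have hcoef : fourierCoeff f = fourierCoef Y i := by
    ext1 k
    rw [fourierCoef_eq_scalar, scalarFourierCoef, fourierCoeff_eq_intervalIntegral _ _ 0, zero_add]
    simp only [hf, fourier_coe_apply, smul_eq_mul]
    rw [Complex.real_smul]
    push_cast
    congr 1
    refine intervalIntegral.integral_congr fun s _ => ?_
    congr 2
    have : (Real.pi : ℂ) ≠ 0 := by exact_mod_cast Real.pi_ne_zero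
    field_simp
  have := has_pointwise_sum_fourier_series_of_summable (f := f) (by rw [hcoef]; exact hs)
    (x : AddCircle (2 * Real.pi))
  rw [hf, hcoef] at this
  convert! this using 2 with k
  rw [fourier_coe_apply, smul_eq_mul]
  congr 2
  have : (Real.pi : ℂ) ≠ 0 := by exact_mod_cast Real.pi_ne_zero
  push_cast
  field_simp

theorem summable_norm_of_summable_abs_mul {c : ℤ → ℂ}
    (h : Summable fun k : ℤ => ((|k| : ℤ) : ℝ) * ‖c k‖) : Summable fun k => ‖c k‖ := by
  have h0 : Summable fun k : ℤ => if k = 0 then ‖c 0‖ else 0 :=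
    summable_of_ne_finset_zero (s := {0}) fun k hk => by simp at hk; simp [hk]
  refine Summable.of_nonneg_of_le (fun k => norm_nonneg _) (fun k => ?_) (h.add h0)
  by_cases hk : k = 0
  · simp [hk]
  · have : (1 : ℝ) ≤ ((|k| : ℤ) : ℝ) := by exact_mod_cast Int.one_le_abs hk
    simp only [hk, if_false, add_zero]
    exact le_mul_of_one_le_left (norm_nonneg _) this

/-- The second difference of `exp (iks)` is `(2 cos kr - 2) exp (iks)`. On `[ε, π]` the kernel is
bounded, so absolute summability of the coefficients allows termwise integration. -/
theorem hasSum_halfLaplacianTrunc {Y : ℝ → Plane} (hper : Function.Periodic Y (2 * Real.pi))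
    (hY : Continuous Y) (i : Fin 2) (hs : Summable fun k => ‖fourierCoef Y i k‖) (s : ℝ) {ε : ℝ}
    (h0 : 0 < ε) (h1 : ε ≤ Real.pi) :
    HasSum (fun k : ℤ => (truncMultiplier k ε : ℂ) * (fourierCoef Y i k *
      Complex.exp (Complex.I * (k : ℂ) * (s : ℂ)))) ((halfLaplacianTrunc Y s ε i : ℝ) : ℂ) := by
  rw [halfLaplacianTrunc_component hY s h0 h1 i]
  set c := fourierCoef Y i
  have hser := hasSum_fourierCoef hper hY i hs.of_norm
  set K : ℝ → ℝ := fun r => 1 / (4 * Real.sin (r / 2) ^ 2) with hKdef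
  have hK : ContinuousOn K (Icc ε Real.pi) := continuousOn_halfLaplacian_kernel h0
  have hKm : Measurable K := by simp only [hKdef]; fun_prop
  have hKnn : ∀ r, 0 ≤ K r := fun r => by simp only [hKdef]; positivity
  set F : ℤ → ℝ → ℂ := fun k r => ((K r * (2 * Real.cos (k * r) - 2) : ℝ) : ℂ) *
    (c k * Complex.exp (Complex.I * (k : ℂ) * (s : ℂ))) with hF
  have hexp : ∀ (k : ℤ), ‖Complex.exp (Complex.I * (k : ℂ) * (s : ℂ))‖ = 1 := fun k => by
    rw [show Complex.I * (k : ℂ) * (s : ℂ) = ((k * s : ℝ) : ℂ) * Complex.I by push_cast; ring]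
    exact Complex.norm_exp_ofReal_mul_I _
  have key : HasSum (fun k => ∫ r in ε..Real.pi, F k r) (∫ r in ε..Real.pi,
      ((K r * (Y (s + r) i + Y (s - r) i - 2 * Y s i) : ℝ) : ℂ)) := by
    refine intervalIntegral.hasSum_integral_of_dominated_convergence
      (fun k r => K r * 4 * ‖c k‖) (fun k => ?_) (fun k => ?_) ?_ ?_ ?_
    · exact (by simp only [hF]; fun_prop : Measurable (F k)).aestronglyMeasurable
    · refine Eventually.of_forall fun r _ => ?_
      simp only [hF]
      rw [norm_mul, norm_mul, hexp, mul_one, Complex.norm_real, Real.norm_eq_abs, abs_mul,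
        abs_of_nonneg (hKnn r)]
      have : |2 * Real.cos (k * r) - 2| ≤ 4 := by
        rw [abs_le]
        constructor <;> linarith [Real.cos_le_one (k * r), Real.neg_one_le_cos (k * r)]
      gcongr
    · exact Eventually.of_forall fun r _ => hs.mul_left _
    · simp only [tsum_mul_left]
      refine ContinuousOn.intervalIntegrable ?_
      rw [uIcc_of_le h1]
      exact (hK.mul continuousOn_const).mul continuousOn_const
    · refine Eventually.of_forall fun r _ => ?_
      have h := ((((hser (s + r)).add (hser (s - r))).sub ((hser s).mul_left 2)).mul_left (K r : ℂ))
      convert! h using 1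
      · ext1 k
        simp only [hF]
        have e1 : Complex.exp (Complex.I * k * ((s + r : ℝ) : ℂ)) =
            Complex.exp (Complex.I * k * s) * Complex.exp ((k * r : ℝ) * Complex.I) := by
          rw [← Complex.exp_add]; congr 1; push_cast; ring
        have e2 : Complex.exp (Complex.I * k * ((s - r : ℝ) : ℂ)) =
            Complex.exp (Complex.I * k * s) * Complex.exp ((-(k * r) : ℝ) * Complex.I) := by
          rw [← Complex.exp_add]; congr 1; push_cast; ring
        rw [e1, e2, Complex.exp_mul_I, Complex.exp_mul_I, ← Complex.ofReal_cos,
          ← Complex.ofReal_cos, ← Complex.ofReal_sin, ← Complex.ofReal_sin, Real.cos_neg,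
          Real.sin_neg]
        push_cast
        ring
      · push_cast; ring
  have key2 := key.mul_left (-(1 / Real.pi) : ℂ)
  convert! key2 using 1
  · ext1 k
    simp only [hF]
    have e : truncMultiplier k ε =
        -(1 / Real.pi) * ∫ r in ε..Real.pi, K r * (2 * Real.cos (k * r) - 2) := by
      unfold truncMultiplier
      rw [show (fun r => K r * (2 * Real.cos (k * r) - 2)) =
        fun r => -(K r * (2 - 2 * Real.cos (k * r))) by ext1 r; ring, intervalIntegral.integral_neg]
      ring
    rw [intervalIntegral.integral_mul_const, intervalIntegral.integral_ofReal, e]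
    push_cast
    ring
  · rw [intervalIntegral.integral_ofReal]
    push_cast
    rfl

/-- The principal value defining the half Laplacian exists and is given by the Fourier
multiplier `|k|`. -/
theorem tendsto_halfLaplacianTrunc {Y : ℝ → Plane} (hper : Function.Periodic Y (2 * Real.pi))
    (hY : Continuous Y)
    (hs : ∀ i, Summable fun k : ℤ => ((|k| : ℤ) : ℝ) * ‖fourierCoef Y i k‖) (s : ℝ) :
    Tendsto (halfLaplacianTrunc Y s) (𝓝[>] (0 : ℝ)) (𝓝 (halfLaplacian Y s)) ∧
    ∀ i, HasSum (fun k : ℤ => ((|k| : ℤ) : ℂ) * fourierCoef Y i k *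
          Complex.exp (Complex.I * (k : ℂ) * (s : ℂ))) ((halfLaplacian Y s i : ℝ) : ℂ) := by
  have hexp : ∀ (k : ℤ), ‖Complex.exp (Complex.I * (k : ℂ) * (s : ℂ))‖ = 1 := fun k => by
    rw [show Complex.I * (k : ℂ) * (s : ℂ) = ((k * s : ℝ) : ℂ) * Complex.I by push_cast; ring]
    exact Complex.norm_exp_ofReal_mul_I _
  set T : Fin 2 → ℤ → ℂ := fun i k => ((|k| : ℤ) : ℂ) * fourierCoef Y i k *
          Complex.exp (Complex.I * (k : ℂ) * (s : ℂ)) with hT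
  have hnorm : ∀ i k, ‖T i k‖ = ((|k| : ℤ) : ℝ) * ‖fourierCoef Y i k‖ := fun i k => by
    simp only [hT, norm_mul, hexp, mul_one, Complex.norm_intCast]
    simp
  have hTs : ∀ i, Summable (T i) := fun i => by
    refine Summable.of_norm ?_
    simp only [hnorm]
    exact hs i
  have hlim : ∀ i, Tendsto (fun ε => ((halfLaplacianTrunc Y s ε i : ℝ) : ℂ)) (𝓝[>] 0)
      (𝓝 (∑' k, T i k)) := by
    intro i
    -- Dominated convergence for series, with the `ε`-independent majorant `|k| |c_k|`.
    have h := tendsto_tsum_of_dominated_convergence (𝓕 := 𝓝[>] (0 : ℝ)) (hs i)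
      (f := fun ε k => (truncMultiplier k ε : ℂ) * (fourierCoef Y i k *
        Complex.exp (Complex.I * (k : ℂ) * (s : ℂ)))) (g := T i) (fun k => ?_) ?_
    · refine h.congr' ?_
      filter_upwards [Ioc_mem_nhdsGT Real.pi_pos] with ε hε
      exact (hasSum_halfLaplacianTrunc hper hY i (summable_norm_of_summable_abs_mul (hs i)) s
        hε.1 hε.2).tsum_eq
    · have h1 := ((Complex.continuous_ofReal.tendsto _).comp (tendsto_truncMultiplier k)).mul_const
        (fourierCoef Y i k * Complex.exp (Complex.I * (k : ℂ) * (s : ℂ)))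
      have e : T i k = ((|(k : ℝ)| : ℝ) : ℂ) * (fourierCoef Y i k *
          Complex.exp (Complex.I * (k : ℂ) * (s : ℂ))) := by
        rw [← Int.cast_abs, Complex.ofReal_intCast, ← mul_assoc]
      rw [e]
      exact h1
    · filter_upwards [Ioc_mem_nhdsGT Real.pi_pos] with ε hε k
      rw [norm_mul, norm_mul, hexp, mul_one, Complex.norm_real, Real.norm_eq_abs,
        abs_of_nonneg (truncMultiplier_nonneg_le k hε.1 hε.2).1, Int.cast_abs]
      gcongr
      exact (truncMultiplier_nonneg_le k hε.1 hε.2).2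
  have hre : ∀ i, Tendsto (fun ε => halfLaplacianTrunc Y s ε i) (𝓝[>] 0)
      (𝓝 (∑' k, T i k).re) := fun i => by
    simpa [Function.comp_def] using (Complex.continuous_re.tendsto _).comp (hlim i)
  have hv : Tendsto (halfLaplacianTrunc Y s) (𝓝[>] (0 : ℝ))
      (𝓝 (WithLp.toLp 2 fun i => (∑' k, T i k).re)) :=
    ((PiLp.continuous_toLp 2 (fun _ : Fin 2 => ℝ)).tendsto _).comp (tendsto_pi_nhds.2 hre)
  have hL : halfLaplacian Y s = WithLp.toLp 2 fun i => (∑' k, T i k).re := hv.limUnder_eq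
  refine ⟨hL ▸ hv, fun i => ?_⟩
  have he : ((halfLaplacian Y s i : ℝ) : ℂ) = ∑' k, T i k := by
    rw [hL]
    refine tendsto_nhds_unique ?_ (hlim i)
    exact (Complex.continuous_ofReal.tendsto _).comp (hre i)
  rw [he]
  exact (hTs i).hasSum

/-! ### Bounds for the fundamental solution -/

theorem stokeslet_apply (x F : Plane) :
    stokeslet x F = (1 / (4 * Real.pi)) • (-(Real.log ‖x‖ • F) +
      (1 / ‖x‖ ^ 2) • (inner ℝ x F) • x) := by
  simp [stokeslet]

theorem measurable_stokeslet_apply {α : Type*} [MeasurableSpace α] {f g : α → Plane}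
    (hf : Measurable f) (hg : Measurable g) : Measurable fun a => stokeslet (f a) (g a) := by
  simp only [stokeslet_apply]
  fun_prop

theorem log_one_add_le {t : ℝ} (ht : 0 ≤ t) : Real.log (1 + t) ≤ 8 * t ^ (1 / 4 : ℝ) := by
  rcases le_total t 1 with h | h
  · have h1 : Real.log (1 + t) ≤ t := by
      have := Real.log_le_sub_one_of_pos (show 0 < 1 + t by linarith)
      linarith
    have h2 : t ≤ t ^ (1 / 4 : ℝ) := by
      rcases ht.eq_or_lt with rfl | h0
      · rw [Real.zero_rpow (by norm_num)]
      · conv_lhs => rw [← Real.rpow_one t]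
        exact Real.rpow_le_rpow_of_exponent_ge h0 h (by norm_num)
    have : 0 ≤ t ^ (1 / 4 : ℝ) := by positivity
    linarith
  · have h1 := Real.log_le_rpow_div (show 0 ≤ 1 + t by linarith) (show (0 : ℝ) < 1 / 4 by norm_num)
    -- The generous factor `16` is chosen because its fourth root is `2`.
    have h2 : (1 + t) ^ (1 / 4 : ℝ) ≤ (16 * t) ^ (1 / 4 : ℝ) :=
      Real.rpow_le_rpow (by linarith) (by linarith) (by norm_num)
    have h3 : (16 * t) ^ (1 / 4 : ℝ) = 2 * t ^ (1 / 4 : ℝ) := by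
      rw [Real.mul_rpow (by norm_num) ht, show (16 : ℝ) = 2 ^ (4 : ℝ) by norm_num,
        ← Real.rpow_mul (by norm_num)]
      norm_num
    rw [h3] at h2
    have h4 : (1 + t) ^ (1 / 4 : ℝ) / (1 / 4) = 4 * (1 + t) ^ (1 / 4 : ℝ) := by ring
    linarith

theorem min_le_rpow {t : ℝ} (ht : 0 ≤ t) : min 1 t ≤ t ^ (1 / 4 : ℝ) := by
  rcases le_total t 1 with h | h
  · rw [min_eq_right h]
    rcases ht.eq_or_lt with rfl | h0
    · rw [Real.zero_rpow (by norm_num)]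
    · conv_lhs => rw [← Real.rpow_one t]
      exact Real.rpow_le_rpow_of_exponent_ge h0 h (by norm_num)
  · rw [min_eq_left h]
    exact Real.one_le_rpow h (by norm_num)

theorem norm_normalize_sub_le {a b : Plane} (ha : a ≠ 0) (hb : b ≠ 0) :
    ‖‖a‖⁻¹ • a - ‖b‖⁻¹ • b‖ ≤ 2 * (‖a - b‖ / ‖a‖) := by
  have ha' := norm_pos_iff.2 ha
  have hb' := norm_pos_iff.2 hb
  have e : ‖a‖⁻¹ • a - ‖b‖⁻¹ • b = ‖a‖⁻¹ • (a - b) + (‖a‖⁻¹ - ‖b‖⁻¹) • b := by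
    module
  rw [e]
  refine (norm_add_le _ _).trans ?_
  rw [norm_smul, norm_smul, norm_inv, norm_norm, Real.norm_eq_abs]
  have e2 : |‖a‖⁻¹ - ‖b‖⁻¹| * ‖b‖ = |‖b‖ - ‖a‖| / ‖a‖ := by
    rw [inv_sub_inv ha'.ne' hb'.ne', abs_div, abs_of_pos (mul_pos ha' hb')]
    field_simp
  rw [e2]
  have := abs_norm_sub_norm_le b a
  rw [norm_sub_rev] at this
  have h2 : |‖b‖ - ‖a‖| / ‖a‖ ≤ ‖a - b‖ / ‖a‖ := by gcongr
  have h3 : ‖a‖⁻¹ * ‖a - b‖ = ‖a - b‖ / ‖a‖ := by ring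
  linarith

/-- With unit vectors `α`, `β` along `a`, `b`, the difference of kernels splits into a difference of
logarithms and `α ⊗ α - β ⊗ β`, the latter bounded by `2 |α - β|`. The factor `1/12` bounds
`1/(4π)`. -/
theorem norm_stokeslet_sub_apply_le_aux {a b : Plane} (ha : a ≠ 0) (hb : b ≠ 0) (F : Plane) :
    ‖stokeslet a F - stokeslet b F‖ ≤ (1 / 12) * (|Real.log ‖b‖ - Real.log ‖a‖| +
      2 * ‖‖a‖⁻¹ • a - ‖b‖⁻¹ • b‖) * ‖F‖ := by
  have ha' := norm_pos_iff.2 ha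
  have hb' := norm_pos_iff.2 hb
  set α : Plane := ‖a‖⁻¹ • a with hα
  set β : Plane := ‖b‖⁻¹ • b with hβ
  have nα : ‖α‖ = 1 := by rw [hα, norm_smul, norm_inv, norm_norm, inv_mul_cancel₀ ha'.ne']
  have nβ : ‖β‖ = 1 := by rw [hβ, norm_smul, norm_inv, norm_norm, inv_mul_cancel₀ hb'.ne']
  have e : stokeslet a F - stokeslet b F = (1 / (4 * Real.pi)) •
      ((Real.log ‖b‖ - Real.log ‖a‖) • F + (inner ℝ (α - β) F • α + inner ℝ β F • (α - β))) := by
    rw [stokeslet_apply, stokeslet_apply, ← smul_sub, inner_sub_left]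
    congr 1
    have e1 : (1 / ‖a‖ ^ 2) • (inner ℝ a F) • a = inner ℝ α F • α := by
      rw [hα, inner_smul_left, smul_smul, smul_smul]
      congr 1
      simp only [conj_trivial]
      field_simp
    have e2 : (1 / ‖b‖ ^ 2) • (inner ℝ b F) • b = inner ℝ β F • β := by
      rw [hβ, inner_smul_left, smul_smul, smul_smul]
      congr 1
      simp only [conj_trivial]
      field_simp
    rw [e1, e2]
    module
  rw [e, norm_smul, Real.norm_of_nonneg (by positivity)]
  have hb1 : ‖(Real.log ‖b‖ - Real.log ‖a‖) • F +
      (inner ℝ (α - β) F • α + inner ℝ β F • (α - β))‖ ≤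
      (|Real.log ‖b‖ - Real.log ‖a‖| + 2 * ‖α - β‖) * ‖F‖ := by
    refine (norm_add_le _ _).trans ((add_le_add_right (norm_add_le _ _) _).trans ?_)
    rw [norm_smul _ F, norm_smul _ α, norm_smul _ (α - β), nα]
    have h1 : ‖(inner ℝ (α - β) F : ℝ)‖ ≤ ‖α - β‖ * ‖F‖ := norm_inner_le_norm _ _
    have h2 : ‖(inner ℝ β F : ℝ)‖ ≤ ‖F‖ := by
      simpa [nβ] using norm_inner_le_norm (𝕜 := ℝ) β F
    have h3 : ‖(inner ℝ β F : ℝ)‖ * ‖α - β‖ ≤ ‖F‖ * ‖α - β‖ := by gcongr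
    rw [Real.norm_eq_abs (Real.log ‖b‖ - Real.log ‖a‖)]
    linarith
  have hpi : 1 / (4 * Real.pi) ≤ 1 / 12 :=
    one_div_le_one_div_of_le (by norm_num) (by linarith [Real.pi_gt_three])
  rw [mul_assoc (1 / 12 : ℝ)]
  exact mul_le_mul hpi hb1 (norm_nonneg _) (by norm_num)

theorem abs_log_norm_sub_le {a b : Plane} (ha : a ≠ 0) (hab : ‖a‖ ≤ ‖b‖) :
    |Real.log ‖b‖ - Real.log ‖a‖| ≤ Real.log (1 + ‖a - b‖ / ‖a‖) := by
  have ha' := norm_pos_iff.2 ha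
  have hb' := ha'.trans_le hab
  rw [abs_of_nonneg (sub_nonneg.2 (Real.log_le_log ha' hab)), ← Real.log_div hb'.ne' ha'.ne']
  refine Real.log_le_log (by positivity) ?_
  rw [div_le_iff₀ ha', add_mul, div_mul_cancel₀ _ ha'.ne', one_mul]
  have := norm_sub_norm_le b a
  rw [norm_sub_rev] at this
  linarith

theorem norm_stokeslet_sub_apply_le_div {a b : Plane} (ha : a ≠ 0) (hab : ‖a‖ ≤ ‖b‖) (F : Plane) :
    ‖stokeslet a F - stokeslet b F‖ ≤ ‖a - b‖ / ‖a‖ * ‖F‖ := by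
  have hb : b ≠ 0 := norm_pos_iff.1 ((norm_pos_iff.2 ha).trans_le hab)
  refine (norm_stokeslet_sub_apply_le_aux ha hb F).trans ?_
  set t := ‖a - b‖ / ‖a‖ with ht
  have ht0 : 0 ≤ t := by positivity
  have h1 := (abs_log_norm_sub_le ha hab).trans
    (Real.log_le_sub_one_of_pos (show 0 < 1 + t by linarith))
  have h2 : ‖‖a‖⁻¹ • a - ‖b‖⁻¹ • b‖ ≤ 2 * t := norm_normalize_sub_le ha hb
  gcongr
  linarith

/-- With `t = |a - b| / |a|`, both terms of the auxiliary bound are at most a multiple of `t^(1/4)`: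
the logarithm contributes `8` and the unit vectors `2 · 2`, which the factor `1/12` absorbs exactly.
The exponent is small enough that the square of the weight, `|·|^(-1/2)`, is integrable along the
curve. -/
theorem norm_stokeslet_sub_apply_le_rpow {a b : Plane} (ha : a ≠ 0) (hab : ‖a‖ ≤ ‖b‖)
    (F : Plane) :
    ‖stokeslet a F - stokeslet b F‖ ≤ ‖a - b‖ ^ (1 / 4 : ℝ) * ‖a‖ ^ (-(1 / 4) : ℝ) * ‖F‖ := by
  have ha' := norm_pos_iff.2 ha
  have hb : b ≠ 0 := norm_pos_iff.1 ((norm_pos_iff.2 ha).trans_le hab)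
  refine (norm_stokeslet_sub_apply_le_aux ha hb F).trans ?_
  set t := ‖a - b‖ / ‖a‖ with ht
  have ht0 : 0 ≤ t := by positivity
  have hT : ‖a - b‖ ^ (1 / 4 : ℝ) * ‖a‖ ^ (-(1 / 4) : ℝ) = t ^ (1 / 4 : ℝ) := by
    rw [ht, Real.div_rpow (norm_nonneg _) (norm_nonneg _), Real.rpow_neg (norm_nonneg _)]
    rfl
  have hlog := (abs_log_norm_sub_le ha hab).trans (log_one_add_le ht0)
  have hn : ∀ c : Plane, c ≠ 0 → ‖‖c‖⁻¹ • c‖ = 1 := fun c hc => by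
    rw [norm_smul, norm_inv, norm_norm, inv_mul_cancel₀ (norm_pos_iff.2 hc).ne']
  have h1 : ‖‖a‖⁻¹ • a - ‖b‖⁻¹ • b‖ ≤ 2 * t := norm_normalize_sub_le ha hb
  have h2 : ‖‖a‖⁻¹ • a - ‖b‖⁻¹ • b‖ ≤ 2 :=
    (norm_sub_le _ _).trans (by rw [hn a ha, hn b hb]; norm_num)
  have h3 := min_le_rpow ht0
  have h4 : ‖‖a‖⁻¹ • a - ‖b‖⁻¹ • b‖ ≤ 2 * min 1 t := by
    rcases min_choice 1 t with h | h <;> rw [h] <;> linarith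
  rw [hT]
  gcongr
  linarith

/-- The fundamental solution is locally Hölder continuous, with an explicit singular weight. -/
theorem norm_stokeslet_sub_apply_le {a b : Plane} (ha : a ≠ 0) (hb : b ≠ 0) (F : Plane) :
    ‖stokeslet a F - stokeslet b F‖ ≤
      ‖a - b‖ ^ (1 / 4 : ℝ) * (‖a‖ ^ (-(1 / 4) : ℝ) + ‖b‖ ^ (-(1 / 4) : ℝ)) * ‖F‖ := by
  have h1 : 0 ≤ ‖a - b‖ ^ (1 / 4 : ℝ) * ‖a‖ ^ (-(1 / 4) : ℝ) * ‖F‖ := by positivity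
  have h2 : 0 ≤ ‖a - b‖ ^ (1 / 4 : ℝ) * ‖b‖ ^ (-(1 / 4) : ℝ) * ‖F‖ := by positivity
  rcases le_total ‖a‖ ‖b‖ with h | h
  · have := norm_stokeslet_sub_apply_le_rpow ha h F
    linarith
  · have := norm_stokeslet_sub_apply_le_rpow hb h F
    rw [norm_sub_rev, norm_sub_rev b a] at this
    linarith

theorem abs_log_le_rpow {r : ℝ} (hr : 0 < r) :
    |Real.log r| ≤ 4 * r ^ (1 / 4 : ℝ) + 4 * r ^ (-(1 / 4) : ℝ) := by
  have h1 := Real.log_le_rpow_div hr.le (show (0 : ℝ) < 1 / 4 by norm_num)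
  have h2 := Real.log_le_rpow_div (inv_pos.2 hr).le (show (0 : ℝ) < 1 / 4 by norm_num)
  rw [Real.log_inv, Real.inv_rpow hr.le, ← Real.rpow_neg hr.le] at h2
  have h3 : 0 ≤ r ^ (1 / 4 : ℝ) := by positivity
  have h4 : 0 ≤ r ^ (-(1 / 4) : ℝ) := by positivity
  rw [abs_le]
  constructor <;> linarith

theorem norm_stokeslet_apply_le_log (a F : Plane) :
    ‖stokeslet a F‖ ≤ (|Real.log ‖a‖| + 1) * ‖F‖ := by
  rw [stokeslet_apply, norm_smul, Real.norm_of_nonneg (by positivity), one_div,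
    inv_mul_le_iff₀ (by positivity)]
  have h1 : ‖-(Real.log ‖a‖ • F)‖ = |Real.log ‖a‖| * ‖F‖ := by
    rw [norm_neg, norm_smul, Real.norm_eq_abs]
  have h2 : ‖(1 / ‖a‖ ^ 2) • (inner ℝ a F : ℝ) • a‖ ≤ ‖F‖ := by
    rcases eq_or_ne a 0 with rfl | ha
    · simp
    have ha' := norm_pos_iff.2 ha
    rw [norm_smul, norm_smul, Real.norm_of_nonneg (by positivity), one_div,
      inv_mul_le_iff₀ (by positivity)]
    have := norm_inner_le_norm (𝕜 := ℝ) a F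
    nlinarith [norm_nonneg a, norm_nonneg F]
  have hpi : 1 ≤ 4 * Real.pi := by linarith [Real.pi_gt_three]
  have h3 := norm_add_le (-(Real.log ‖a‖ • F)) ((1 / ‖a‖ ^ 2) • (inner ℝ a F : ℝ) • a)
  have h4 : 0 ≤ (|Real.log ‖a‖| + 1) * ‖F‖ := by positivity
  nlinarith

theorem norm_stokeslet_apply_le {a : Plane} (ha : a ≠ 0) (F : Plane) :
    ‖stokeslet a F‖ ≤
      (4 * ‖a‖ ^ (1 / 4 : ℝ) + 4 * ‖a‖ ^ (-(1 / 4) : ℝ) + 1) * ‖F‖ := by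
  refine (norm_stokeslet_apply_le_log a F).trans ?_
  gcongr
  exact abs_log_le_rpow (norm_pos_iff.2 ha)

theorem abs_inner_pressureKernel_le (a F : Plane) :
    |inner ℝ (pressureKernel a) F| ≤ ‖a‖⁻¹ * ‖F‖ := by
  rcases eq_or_ne a 0 with rfl | ha
  · simp [pressureKernel]
  have ha' := norm_pos_iff.2 ha
  refine (abs_real_inner_le_norm _ _).trans ?_
  gcongr
  rw [pressureKernel, norm_smul, Real.norm_of_nonneg (by positivity), one_div,
    inv_mul_le_iff₀ (by positivity)]
  have : 2 * Real.pi * ‖a‖ ^ 2 * ‖a‖⁻¹ = 2 * Real.pi * ‖a‖ := by field_simp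
  rw [this]
  nlinarith [Real.pi_gt_three]

theorem measurable_inner_pressureKernel {α : Type*} [MeasurableSpace α] {f g : α → Plane}
    (hf : Measurable f) (hg : Measurable g) :
    Measurable fun a => (inner ℝ (pressureKernel (f a)) (g a) : ℝ) := by
  simp only [pressureKernel]
  fun_prop

/-! ### Singular integrals along a well-stretched curve -/

theorem intervalIntegrable_abs_rpow {c : ℝ} (hc : 0 ≤ c) :
    IntervalIntegrable (fun t : ℝ => (c * |t|) ^ (-(1 / 2) : ℝ)) volume (-Real.pi) Real.pi := by
  have h1 : IntervalIntegrable (fun t : ℝ => |t| ^ (-(1 / 2) : ℝ)) volume 0 Real.pi := by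
    refine (intervalIntegral.intervalIntegrable_rpow' (r := -(1 / 2)) (by norm_num)).congr
      fun t ht => ?_
    rw [uIoc_of_le Real.pi_pos.le] at ht
    rw [abs_of_pos ht.1]
  have h2 : IntervalIntegrable (fun t : ℝ => |t| ^ (-(1 / 2) : ℝ)) volume (-Real.pi) 0 := by
    have := (h1.comp_mul_left (c := -1)).symm
    simpa [div_neg] using this
  have h3 := (h2.trans h1).const_mul (|c| ^ (-(1 / 2) : ℝ))
  refine h3.congr fun t _ => ?_
  rw [abs_of_nonneg hc, Real.mul_rpow hc (abs_nonneg t)]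

theorem torusDist_eq_abs {s r : ℝ} (h : |s - r| ≤ Real.pi) : torusDist s r = |s - r| := by
  unfold torusDist
  rw [AddCircle.norm_coe_eq_abs_iff _ Real.two_pi_pos.ne', abs_of_pos Real.two_pi_pos]
  linarith

/-- Take `s₀` to be the parameter of a nearest point on the curve. Then `|Y s₀ - Y r| ≤ 2 |x - Y
r|`, so a point off the curve inherits the stretching bound with half the constant. -/
theorem WellStretched.exists_nearest {Y : ℝ → Plane} (hc : Continuous Y)
    (hper : Function.Periodic Y (2 * Real.pi)) {lam : ℝ}
    (hw : ∀ s₁ s₂ : ℝ, lam * torusDist s₁ s₂ ≤ ‖Y s₁ - Y s₂‖) (x : Plane) :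
    ∃ s₀ : ℝ, ∀ r, lam / 2 * torusDist s₀ r ≤ ‖x - Y r‖ := by
  obtain ⟨s₀, _, h₀⟩ := isCompact_Icc.exists_isMinOn
    (nonempty_Icc.2 (show (0 : ℝ) ≤ 2 * Real.pi from Real.two_pi_pos.le))
    (f := fun r => ‖x - Y r‖) (by fun_prop)
  refine ⟨s₀, fun r => ?_⟩
  have h1 : ‖x - Y s₀‖ ≤ ‖x - Y r‖ := by
    obtain ⟨r', hr', e⟩ := hper.exists_mem_Ico₀ Real.two_pi_pos r
    rw [e]
    exact h₀ (Ico_subset_Icc_self hr')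
  have h2 := hw s₀ r
  have h3 : ‖Y s₀ - Y r‖ ≤ ‖x - Y s₀‖ + ‖x - Y r‖ := by
    rw [show Y s₀ - Y r = (x - Y r) - (x - Y s₀) by abel]
    exact (norm_sub_le _ _).trans (add_comm _ _).le
  linarith

/-- Over the period centred at the nearest parameter, the integrand is dominated by a translate of a
fixed power of `|t|`. The bound `M` is therefore uniform in `x`, which the continuity of the
velocity requires. -/
theorem exists_integral_rpow_le {Y : ℝ → Plane} (hc : Continuous Y)
    (hper : Function.Periodic Y (2 * Real.pi)) (hws : WellStretched Y) :
    ∃ M, ∀ x, IntervalIntegrable (fun r => ‖x - Y r‖ ^ (-(1 / 2) : ℝ)) volume 0 (2 * Real.pi) ∧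
      ∫ r in (0 : ℝ)..(2 * Real.pi), ‖x - Y r‖ ^ (-(1 / 2) : ℝ) ≤ M := by
  obtain ⟨lam, hlam, hw⟩ := hws
  refine ⟨∫ t in (-Real.pi)..Real.pi, (lam / 2 * |t|) ^ (-(1 / 2) : ℝ), fun x => ?_⟩
  obtain ⟨s₀, h₀⟩ := WellStretched.exists_nearest hc hper hw x
  set f : ℝ → ℝ := fun r => ‖x - Y r‖ ^ (-(1 / 2) : ℝ) with hf
  have hfper : Function.Periodic f (2 * Real.pi) := fun r => by simp only [hf, hper r]
  have hfm : Measurable f := by simp only [hf]; fun_prop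
  set g : ℝ → ℝ := fun r => (lam / 2 * |r - s₀|) ^ (-(1 / 2) : ℝ) with hg
  have hgi : IntervalIntegrable g volume (s₀ - Real.pi) (s₀ + Real.pi) := by
    have := (intervalIntegrable_abs_rpow (half_pos hlam).le).comp_sub_right s₀
    rwa [add_comm Real.pi, neg_add_eq_sub] at this
  have hle : s₀ - Real.pi ≤ s₀ + Real.pi := by linarith [Real.pi_pos]
  have hfg : ∀ᵐ r ∂(volume.restrict (Ioc (s₀ - Real.pi) (s₀ + Real.pi))), f r ≤ g r := by
    filter_upwards [ae_restrict_mem measurableSet_Ioc, ae_restrict_of_ae (Measure.ae_ne volume s₀)]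
      with r hr hne
    have h1 := h₀ r
    have habs : |s₀ - r| ≤ Real.pi := by rw [abs_le]; constructor <;> linarith [hr.1, hr.2]
    rw [torusDist_eq_abs habs, abs_sub_comm] at h1
    have h2 : 0 < lam / 2 * |r - s₀| := mul_pos (by linarith) (abs_pos.2 (sub_ne_zero.2 hne))
    exact Real.rpow_le_rpow_of_nonpos h2 h1 (by norm_num)
  have hfi : IntervalIntegrable f volume (s₀ - Real.pi) (s₀ + Real.pi) := by
    rw [intervalIntegrable_iff_integrableOn_Ioc_of_le hle] at hgi ⊢
    refine Integrable.mono' hgi hfm.aestronglyMeasurable ?_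
    filter_upwards [hfg] with r hr
    rwa [Real.norm_of_nonneg (by simp only [hf]; positivity)]
  have e : s₀ + Real.pi = s₀ - Real.pi + 2 * Real.pi := by ring
  refine ⟨hfper.intervalIntegrable Real.two_pi_pos.ne' (t := s₀ - Real.pi) (e ▸ hfi) _ _, ?_⟩
  have h1 := hfper.intervalIntegral_add_eq 0 (s₀ - Real.pi)
  rw [zero_add, ← e] at h1
  have h2 : ∫ r in (s₀ - Real.pi)..(s₀ + Real.pi), g r =
      ∫ t in (-Real.pi)..Real.pi, (lam / 2 * |t|) ^ (-(1 / 2) : ℝ) := by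
    have := intervalIntegral.integral_comp_sub_right (a := s₀ - Real.pi) (b := s₀ + Real.pi)
      (fun t => (lam / 2 * |t|) ^ (-(1 / 2) : ℝ)) s₀
    rw [add_sub_cancel_left, sub_sub_cancel_left] at this
    exact this
  rw [h1, ← h2]
  exact intervalIntegral.integral_mono_ae_restrict hle hfi hgi
    (by rw [← restrict_Ioc_eq_restrict_Icc]; exact hfg)

/-! ### The single layer potentials -/

theorem IsH2Curve.continuous {Y : ℝ → Plane} (hY : IsH2Curve Y) : Continuous Y :=
  continuous_iff_continuousAt.2 fun s => (hY.hasDerivAt s).continuousAt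

theorem measurable_secondDeriv (Y : ℝ → Plane) : Measurable (secondDeriv Y) :=
  measurable_deriv (deriv Y)

theorem IsH2Curve.periodic_deriv {Y : ℝ → Plane} (hY : IsH2Curve Y) :
    Function.Periodic (deriv Y) (2 * Real.pi) := fun s => by
  rw [← deriv_comp_add_const]
  congr 1
  exact funext hY.periodic

theorem IsH2Curve.periodic_secondDeriv {Y : ℝ → Plane} (hY : IsH2Curve Y) :
    Function.Periodic (secondDeriv Y) (2 * Real.pi) := fun s => by
  unfold secondDeriv
  rw [← deriv_comp_add_const]
  congr 1
  exact funext hY.periodic_deriv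

theorem IsH2Curve.integral_secondDeriv_eq_zero {Y : ℝ → Plane} (hY : IsH2Curve Y) :
    ∫ r in (0 : ℝ)..(2 * Real.pi), secondDeriv Y r = 0 := by
  have := hY.periodic_deriv 0
  rw [zero_add] at this
  rw [hY.integral_secondDeriv, this, sub_self]

theorem IsH2Curve.integrable_sq {Y : ℝ → Plane} (hY : IsH2Curve Y) :
    IntervalIntegrable (fun r => ‖secondDeriv Y r‖ ^ 2) volume 0 (2 * Real.pi) := by
  rw [intervalIntegrable_iff_integrableOn_Ioc_of_le Real.two_pi_pos.le]
  exact (memLp_two_iff_integrable_sq_norm hY.memLp.1).1 hY.memLp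

/-- By well-stretchedness, a parameter at which the curve passes through `x` is congruent to `s₀`
modulo `2π`, so such parameters form a countable set. -/
theorem IsH2Curve.ae_ne {Y : ℝ → Plane} (hY : IsH2Curve Y) (hws : WellStretched Y) (x : Plane) :
    ∀ᵐ r, x - Y r ≠ 0 := by
  obtain ⟨lam, hlam, hw⟩ := hws
  obtain ⟨s₀, h₀⟩ := WellStretched.exists_nearest hY.continuous hY.periodic hw x
  have hcount : (range fun n : ℤ => s₀ - n • (2 * Real.pi)).Countable := countable_range _
  filter_upwards [hcount.ae_notMem volume] with r hr h
  have h1 := h₀ r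
  rw [h, norm_zero] at h1
  have h2 : torusDist s₀ r = 0 := le_antisymm
    (nonpos_of_mul_nonpos_right h1 (half_pos hlam)) (norm_nonneg _)
  obtain ⟨n, hn⟩ := (AddCircle.coe_eq_zero_iff _).1 (norm_eq_zero.1 h2)
  exact hr ⟨n, by simp only; rw [hn]; ring⟩

/-- Young's inequality splits the product into `|x - Y|^(-1/2)`, with integral bounded uniformly in
`x`, and the integrable `|Y''|²`. -/
theorem IsH2Curve.exists_integral_weight_le {Y : ℝ → Plane} (hY : IsH2Curve Y)
    (hws : WellStretched Y) : ∃ M, ∀ x,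
      IntervalIntegrable (fun r => ‖x - Y r‖ ^ (-(1 / 4) : ℝ) * ‖secondDeriv Y r‖) volume
        0 (2 * Real.pi) ∧
      ∫ r in (0 : ℝ)..(2 * Real.pi), ‖x - Y r‖ ^ (-(1 / 4) : ℝ) * ‖secondDeriv Y r‖ ≤ M := by
  obtain ⟨M, hM⟩ := exists_integral_rpow_le hY.continuous hY.periodic hws
  refine ⟨M + ∫ r in (0 : ℝ)..(2 * Real.pi), ‖secondDeriv Y r‖ ^ 2, fun x => ?_⟩
  have hi := (hM x).1.add hY.integrable_sq
  have hc := hY.continuous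
  have hbd : ∀ r, ‖x - Y r‖ ^ (-(1 / 4) : ℝ) * ‖secondDeriv Y r‖ ≤
      ‖x - Y r‖ ^ (-(1 / 2) : ℝ) + ‖secondDeriv Y r‖ ^ 2 := fun r => by
    have e : ‖x - Y r‖ ^ (-(1 / 2) : ℝ) = (‖x - Y r‖ ^ (-(1 / 4) : ℝ)) ^ 2 := by
      rw [← Real.rpow_natCast, ← Real.rpow_mul (norm_nonneg _)]; norm_num
    rw [e]
    nlinarith [sq_nonneg (‖x - Y r‖ ^ (-(1 / 4) : ℝ) - ‖secondDeriv Y r‖),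
      sq_nonneg (‖x - Y r‖ ^ (-(1 / 4) : ℝ)), sq_nonneg ‖secondDeriv Y r‖]
  have hint : IntervalIntegrable (fun r => ‖x - Y r‖ ^ (-(1 / 4) : ℝ) * ‖secondDeriv Y r‖) volume
        0 (2 * Real.pi) := by
    refine hi.mono_fun (Measurable.aestronglyMeasurable ?_) (Eventually.of_forall fun r => ?_)
    · have := measurable_secondDeriv Y
      fun_prop
    · simp only
      rw [Real.norm_of_nonneg (by positivity), Real.norm_of_nonneg (by positivity)]
      exact hbd r
  refine ⟨hint, ?_⟩
  refine (intervalIntegral.integral_mono Real.two_pi_pos.le hint hi hbd).trans ?_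
  rw [intervalIntegral.integral_add (hM x).1 hY.integrable_sq]
  linarith [(hM x).2]

theorem IsH2Curve.exists_norm_le {Y : ℝ → Plane} (hY : IsH2Curve Y) :
    ∃ R, 0 ≤ R ∧ ∀ r, ‖Y r‖ ≤ R := by
  obtain ⟨R, hR⟩ := isCompact_Icc.exists_bound_of_continuousOn
    (hY.continuous.continuousOn (s := Icc 0 (2 * Real.pi)))
  have h : ∀ r, ‖Y r‖ ≤ R := fun r => by
    obtain ⟨r', hr', e⟩ := hY.periodic.exists_mem_Ico₀ Real.two_pi_pos r
    rw [e]
    exact hR r' (Ico_subset_Icc_self hr')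
  exact ⟨R, (norm_nonneg _).trans (h 0), h⟩

theorem IsH2Curve.integrable_stokeslet {Y : ℝ → Plane} (hY : IsH2Curve Y)
    (hws : WellStretched Y) (x : Plane) :
    IntervalIntegrable (fun r => stokeslet (x - Y r) (secondDeriv Y r)) volume 0 (2 * Real.pi) := by
  obtain ⟨M, hM⟩ := hY.exists_integral_weight_le hws
  obtain ⟨R, hR0, hR⟩ := hY.exists_norm_le
  have hc := hY.continuous
  have hi := (((hY.integrable 0 (2 * Real.pi)).norm.const_mul
    (4 * (‖x‖ + R) ^ (1 / 4 : ℝ) + 1))).add ((hM x).1.const_mul 4)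
  refine hi.mono_fun (Measurable.aestronglyMeasurable (measurable_stokeslet_apply (by fun_prop)
    (measurable_secondDeriv Y))) (ae_restrict_of_ae ?_)
  filter_upwards [hY.ae_ne hws x] with r hr
  refine (norm_stokeslet_apply_le hr _).trans ?_
  rw [Real.norm_of_nonneg (by positivity)]
  have h1 : ‖x - Y r‖ ^ (1 / 4 : ℝ) ≤ (‖x‖ + R) ^ (1 / 4 : ℝ) :=
    Real.rpow_le_rpow (norm_nonneg _) ((norm_sub_le _ _).trans (by linarith [hR r])) (by norm_num)
  have h2 : ‖x - Y r‖ ^ (1 / 4 : ℝ) * ‖secondDeriv Y r‖ ≤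
      (‖x‖ + R) ^ (1 / 4 : ℝ) * ‖secondDeriv Y r‖ := by gcongr
  linarith

theorem IsH2Curve.integrable_pressure {Y : ℝ → Plane} (hY : IsH2Curve Y) {x : Plane}
    (hx : x ∉ range Y) :
    IntervalIntegrable (fun r => (inner ℝ (pressureKernel (x - Y r)) (secondDeriv Y r) : ℝ))
      volume 0 (2 * Real.pi) := by
  have hc := hY.continuous
  have hne : ∀ r, ‖x - Y r‖ ≠ 0 := fun r h =>
    hx ⟨r, (sub_eq_zero.1 (norm_eq_zero.1 h)).symm⟩
  have hcont : Continuous fun r => ‖x - Y r‖⁻¹ := Continuous.inv₀ (by fun_prop) hne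
  refine ((hY.integrable 0 (2 * Real.pi)).norm.continuousOn_mul hcont.continuousOn).mono_fun
    (Measurable.aestronglyMeasurable (measurable_inner_pressureKernel (by fun_prop)
    (measurable_secondDeriv Y))) (Eventually.of_forall fun r => ?_)
  simp only
  rw [Real.norm_of_nonneg (by positivity : 0 ≤ ‖x - Y r‖⁻¹ * ‖secondDeriv Y r‖)]
  exact abs_inner_pressureKernel_le _ _

/-- The Hölder estimate for the kernel integrates, by the uniform weighted bound, to Hölder
continuity of exponent `1/4` on the whole plane, including across the string. -/
theorem IsH2Curve.continuous_velocityOf {Y : ℝ → Plane} (hY : IsH2Curve Y)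
    (hws : WellStretched Y) : Continuous (velocityOf Y) := by
  obtain ⟨M, hM⟩ := hY.exists_integral_weight_le hws
  have key : ∀ x y, ‖velocityOf Y x - velocityOf Y y‖ ≤ ‖x - y‖ ^ (1 / 4 : ℝ) * (M + M) := by
    intro x y
    unfold velocityOf
    rw [← intervalIntegral.integral_sub (hY.integrable_stokeslet hws x)
      (hY.integrable_stokeslet hws y)]
    have hb := ((hM x).1.add (hM y).1).const_mul (‖x - y‖ ^ (1 / 4 : ℝ))
    refine (intervalIntegral.norm_integral_le_of_norm_le Real.two_pi_pos.le ?_ hb).trans ?_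
    · filter_upwards [hY.ae_ne hws x, hY.ae_ne hws y] with r hx hy _
      have := norm_stokeslet_sub_apply_le hx hy (secondDeriv Y r)
      rw [sub_sub_sub_cancel_right] at this
      refine this.trans (le_of_eq (by ring))
    · rw [intervalIntegral.integral_const_mul, intervalIntegral.integral_add (hM x).1 (hM y).1]
      gcongr
      exacts [(hM x).2, (hM y).2]
  refine continuous_iff_continuousAt.2 fun y => ?_
  rw [ContinuousAt, tendsto_iff_norm_sub_tendsto_zero]
  refine squeeze_zero (fun _ => norm_nonneg _) (fun x => key x y) ?_
  have hc : Continuous fun x : Plane => ‖x - y‖ ^ (1 / 4 : ℝ) * (M + M) :=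
    ((by fun_prop : Continuous fun x : Plane => ‖x - y‖).rpow_const
      (fun _ => Or.inr (by norm_num))).mul continuous_const
  have := hc.tendsto y
  simpa [Real.zero_rpow] using this

theorem half_norm_le_norm_sub {x y : Plane} {R : ℝ} (hy : ‖y‖ ≤ R) (hx : 2 * R ≤ ‖x‖) :
    ‖x‖ / 2 ≤ ‖x - y‖ := by
  have := norm_sub_norm_le x y
  linarith

/-- Since `∫ Y'' = 0`, the constant matrix `G(x)` may be subtracted from the kernel. What remains is
`G(x - Y) - G(x)`, of size `|x|^(-1/4)` by the Hölder estimate. -/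
theorem IsH2Curve.tendsto_velocityOf {Y : ℝ → Plane} (hY : IsH2Curve Y)
    (hws : WellStretched Y) : Tendsto (velocityOf Y) (cocompact Plane) (𝓝 0) := by
  obtain ⟨R, hR0, hR⟩ := hY.exists_norm_le
  set K := ∫ r in (0 : ℝ)..(2 * Real.pi), ‖secondDeriv Y r‖
  have key : ∀ x : Plane, 2 * R + 1 ≤ ‖x‖ → ‖velocityOf Y x‖ ≤
      R ^ (1 / 4 : ℝ) * (2 * (‖x‖ / 2) ^ (-(1 / 4) : ℝ)) * K := by
    intro x hx
    have hx0 : x ≠ 0 := norm_pos_iff.1 (by linarith)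
    have e : velocityOf Y x = ∫ r in (0 : ℝ)..(2 * Real.pi),
        (stokeslet (x - Y r) (secondDeriv Y r) - stokeslet x (secondDeriv Y r)) := by
      rw [intervalIntegral.integral_sub (hY.integrable_stokeslet hws x),
        ContinuousLinearMap.intervalIntegral_comp_comm _ (hY.integrable _ _),
        hY.integral_secondDeriv_eq_zero, map_zero, sub_zero]
      · rfl
      · exact ⟨(stokeslet x).integrable_comp (hY.integrable _ _).1,
          (stokeslet x).integrable_comp (hY.integrable _ _).2⟩
    rw [e]
    refine (intervalIntegral.norm_integral_le_of_norm_le Real.two_pi_pos.le ?_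
      ((hY.integrable 0 (2 * Real.pi)).norm.const_mul
        (R ^ (1 / 4 : ℝ) * (2 * (‖x‖ / 2) ^ (-(1 / 4) : ℝ))))).trans
      (le_of_eq (intervalIntegral.integral_const_mul _ _))
    filter_upwards [hY.ae_ne hws x] with r hr _
    refine (norm_stokeslet_sub_apply_le hr hx0 _).trans ?_
    have hpos : 0 < ‖x‖ / 2 := by linarith
    have h1 : ‖x - Y r - x‖ ^ (1 / 4 : ℝ) ≤ R ^ (1 / 4 : ℝ) := by
      refine Real.rpow_le_rpow (norm_nonneg _) ?_ (by norm_num)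
      rw [sub_sub_cancel_left, norm_neg]
      exact hR r
    have h2 : ‖x - Y r‖ ^ (-(1 / 4) : ℝ) ≤ (‖x‖ / 2) ^ (-(1 / 4) : ℝ) :=
      Real.rpow_le_rpow_of_nonpos hpos (half_norm_le_norm_sub (hR r) (by linarith)) (by norm_num)
    have h3 : ‖x‖ ^ (-(1 / 4) : ℝ) ≤ (‖x‖ / 2) ^ (-(1 / 4) : ℝ) :=
      Real.rpow_le_rpow_of_nonpos hpos (by linarith) (by norm_num)
    have h4 : ‖x - Y r‖ ^ (-(1 / 4) : ℝ) + ‖x‖ ^ (-(1 / 4) : ℝ) ≤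
      2 * (‖x‖ / 2) ^ (-(1 / 4) : ℝ) := by linarith
    gcongr
  refine squeeze_zero_norm' ?_ (?_ : Tendsto (fun x : Plane =>
      R ^ (1 / 4 : ℝ) * (2 * (‖x‖ / 2) ^ (-(1 / 4) : ℝ)) * K) (cocompact Plane) (𝓝 0))
  · filter_upwards [(tendsto_norm_cocompact_atTop (E := Plane)).eventually_ge_atTop (2 * R + 1)]
      with x hx using key x hx
  · have h := ((tendsto_rpow_neg_atTop (show (0 : ℝ) < 1 / 4 by norm_num)).comp
      ((tendsto_norm_cocompact_atTop (E := Plane)).atTop_div_const (show (0 : ℝ) < 2 by norm_num)))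
    simpa using ((h.const_mul 2).const_mul (R ^ (1 / 4 : ℝ))).mul_const K

theorem IsH2Curve.tendsto_pressureOf {Y : ℝ → Plane} (hY : IsH2Curve Y) :
    Tendsto (pressureOf Y) (cocompact Plane) (𝓝 0) := by
  obtain ⟨R, hR0, hR⟩ := hY.exists_norm_le
  set K := ∫ r in (0 : ℝ)..(2 * Real.pi), ‖secondDeriv Y r‖
  have key : ∀ x : Plane, 2 * R + 1 ≤ ‖x‖ → ‖pressureOf Y x‖ ≤ (‖x‖ / 2)⁻¹ * K := by
    intro x hx
    refine (intervalIntegral.norm_integral_le_of_norm_le Real.two_pi_pos.le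
      (Eventually.of_forall fun r _ => ?_)
      ((hY.integrable 0 (2 * Real.pi)).norm.const_mul ((‖x‖ / 2)⁻¹))).trans
      (le_of_eq (intervalIntegral.integral_const_mul _ _))
    refine (abs_inner_pressureKernel_le _ _).trans ?_
    have hpos : 0 < ‖x‖ / 2 := by linarith
    gcongr
    exact half_norm_le_norm_sub (hR r) (by linarith)
  refine squeeze_zero_norm' ?_ (?_ : Tendsto (fun x : Plane =>
      (‖x‖ / 2)⁻¹ * K) (cocompact Plane) (𝓝 0))
  · filter_upwards [(tendsto_norm_cocompact_atTop (E := Plane)).eventually_ge_atTop (2 * R + 1)]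
      with x hx using key x hx
  · have h := (tendsto_inv_atTop_zero.comp
      ((tendsto_norm_cocompact_atTop (E := Plane)).atTop_div_const (show (0 : ℝ) < 2 by norm_num)))
    simpa using h.mul_const K

/-! ### The contour kernel and its integral -/

theorem contDiffAt_stokeslet {x : Plane} (hx : x ≠ 0) : ContDiffAt ℝ 1 stokeslet x := by
  have hn : ContDiffAt ℝ 1 (fun y : Plane => ‖y‖) x := contDiffAt_id.norm ℝ hx
  have h0 : ‖x‖ ≠ 0 := norm_ne_zero_iff.2 hx
  have hin : ContDiffAt ℝ 1 (fun y : Plane => (innerSL ℝ y).smulRight y) x := by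
    have h1 : ContDiffAt ℝ 1 (fun y : Plane => innerSL ℝ y) x := (innerSL ℝ).contDiff.contDiffAt
    exact h1.smulRight contDiffAt_id
  have h1 : ContDiffAt ℝ 1 (fun y : Plane => Real.log ‖y‖ • ContinuousLinearMap.id ℝ Plane) x :=
    (hn.log h0).smul contDiffAt_const
  have h2 : ContDiffAt ℝ 1 (fun y : Plane => (1 / ‖y‖ ^ 2)) x :=
    contDiffAt_const.div (hn.pow 2) (pow_ne_zero 2 h0)
  exact (h1.neg.add (h2.smul hin)).const_smul (1 / (4 * Real.pi))

/-- The derivative need not be computed: a local Lipschitz constant bounds it. The factor `2` covers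
points `y` near `x` with `|x| / 2 < |y| ≤ |x|`. -/
theorem norm_fderiv_stokeslet_le {x : Plane} (hx : x ≠ 0) :
    ‖fderiv ℝ stokeslet x‖ ≤ 2 / ‖x‖ := by
  have hx' := norm_pos_iff.2 hx
  have hd := ((contDiffAt_stokeslet hx).differentiableAt (by norm_num)).hasFDerivAt
  refine hd.le_of_lip' (by positivity) ?_
  have hev : ∀ᶠ y : Plane in 𝓝 x, ‖x‖ / 2 < ‖y‖ :=
    (continuous_norm.tendsto x).eventually (lt_mem_nhds (by linarith))
  filter_upwards [hev] with y hy
  have hy0 : y ≠ 0 := norm_pos_iff.1 (by linarith)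
  refine ContinuousLinearMap.opNorm_le_bound _ (by positivity) fun F => ?_
  rw [sub_apply]
  rcases le_total ‖x‖ ‖y‖ with h | h
  · rw [norm_sub_rev, norm_sub_rev y]
    refine (norm_stokeslet_sub_apply_le_div hx h F).trans ?_
    gcongr
    rw [div_mul_eq_mul_div]
    gcongr
    linarith [norm_nonneg (x - y)]
  · refine (norm_stokeslet_sub_apply_le_div hy0 h F).trans ?_
    gcongr
    rw [div_le_iff₀ (by linarith), mul_assoc, mul_comm, mul_assoc]
    have : 1 ≤ ‖y‖ * (2 / ‖x‖) := by
      rw [← mul_div_assoc, le_div_iff₀ hx']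
      linarith
    nlinarith [norm_nonneg (y - x)]

/-- Integration by parts of a `C¹` family of linear maps against a primitive. -/
theorem integral_clm_apply_eq_sub {f : ℝ → Plane →L[ℝ] Plane} {Z W : ℝ → Plane} {a b : ℝ}
    (hf : ∀ x ∈ uIcc a b, ContDiffAt ℝ 1 f x) (hZ : IntervalIntegrable Z volume a b)
    (hWc : Continuous W) (hW : ∀ x ∈ uIcc a b, W x = W a + ∫ t in a..x, Z t) :
    IntervalIntegrable (fun x => deriv f x (W x)) volume a b ∧
    ∫ x in a..b, f x (Z x) = f b (W b) - f a (W a) - ∫ x in a..b, deriv f x (W x) := by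
  -- Passing to matrix entries reduces the claim to the scalar integration by parts.
  set A : Fin 2 → Fin 2 → ℝ → ℝ := fun i j x => f x (EuclideanSpace.single j 1) i with hA
  have hAd : ∀ i j, ∀ x ∈ uIcc a b, ContDiffAt ℝ 1 (A i j) x := fun i j x hx =>
    (coordinate i).contDiff.contDiffAt.comp x ((hf x hx).clm_apply contDiffAt_const)
  have hAc : ∀ i j, ContDiffOn ℝ 1 (A i j) (uIcc a b) := fun i j x hx =>
    (hAd i j x hx).contDiffWithinAt
  have hderiv : ∀ i j, ∀ x ∈ uIcc a b,
      deriv (A i j) x = deriv f x (EuclideanSpace.single j 1) i := fun i j x hx => by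
    have h1 := ((hf x hx).differentiableAt (by norm_num)).hasDerivAt
    have h2 := h1.clm_apply (hasDerivAt_const x (EuclideanSpace.single j (1 : ℝ)))
    have h3 := (coordinate i).hasFDerivAt.comp_hasDerivAt x h2
    simp only [map_zero, add_zero] at h3
    exact h3.deriv
  have hsum : ∀ (T : Plane →L[ℝ] Plane) (v : Plane) (i : Fin 2),
      (T v) i = ∑ j, (T (EuclideanSpace.single j 1)) i * v j := fun T v i => by
    have hv : v = ∑ j, v j • EuclideanSpace.single j (1 : ℝ) := by
      ext k
      fin_cases k <;> simp [Fin.sum_univ_two]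
    conv_lhs => rw [hv]
    rw [map_sum, Fin.sum_univ_two, Fin.sum_univ_two]
    simp only [map_smul, PiLp.add_apply, PiLp.smul_apply, smul_eq_mul]
    ring
  have hdc : ContinuousOn (deriv f) (uIcc a b) := fun x hx => by
    have h1 : ContinuousAt (fderiv ℝ f) x :=
      ((hf x hx).fderiv_right (m := 0) (by norm_num)).continuousAt
    have h2 : deriv f = fun y => fderiv ℝ f y 1 := by ext1 y; exact fderiv_apply_one_eq_deriv.symm
    rw [h2]
    exact (h1.clm_apply continuousAt_const).continuousWithinAt
  have hfc : ContinuousOn f (uIcc a b) := fun x hx => (hf x hx).continuousAt.continuousWithinAt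
  have i1 : IntervalIntegrable (fun x => deriv f x (W x)) volume a b :=
    (hdc.clm_apply hWc.continuousOn).intervalIntegrable
  have hcomp : ∀ i j, ∫ x in a..b, A i j x * Z x j =
      A i j b * W b j - A i j a * W a j - ∫ x in a..b, deriv (A i j) x * W x j := fun i j =>
    integral_mul_eq_sub_of_primitive (W := fun x => W x j) (hAc i j)
      (intervalIntegrable_component hZ j) (fun x hx => by
        have hZx : IntervalIntegrable Z volume a x := hZ.mono_set (uIcc_subset_uIcc_left hx)
        simp only
        rw [hW x hx, PiLp.add_apply, intervalIntegral_component hZx])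
  have iA : ∀ i j, IntervalIntegrable (fun x => A i j x * Z x j) volume a b := fun i j =>
    (intervalIntegrable_component hZ j).continuousOn_mul (hAc i j).continuousOn
  have iB : ∀ i j, IntervalIntegrable (fun x => deriv (A i j) x * W x j) volume a b := fun i j =>
    (hAc i j).absolutelyContinuousOnInterval.intervalIntegrable_deriv.mul_continuousOn
      ((coordinate j).continuous.comp hWc).continuousOn
  have hZ' : ∀ x i, f x (Z x) i = A i 0 x * Z x 0 + A i 1 x * Z x 1 := fun x i => by
    rw [hsum, Fin.sum_univ_two]
  have hW' : ∀ x i, deriv f x (W x) i = deriv f x (EuclideanSpace.single 0 1) i * W x 0 +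
      deriv f x (EuclideanSpace.single 1 1) i * W x 1 := fun x i => by
    rw [hsum, Fin.sum_univ_two]
  have i2 : IntervalIntegrable (fun x => f x (Z x)) volume a b := by
    have hc : ∀ i, IntervalIntegrable (fun x => f x (Z x) i) volume a b := fun i => by
      simp only [hZ']
      exact (iA i 0).add (iA i 1)
    have := ((hc 0).smul_continuousOn (g := fun _ => EuclideanSpace.single (0 : Fin 2) (1 : ℝ))
      continuousOn_const).add ((hc 1).smul_continuousOn
      (g := fun _ => EuclideanSpace.single (1 : Fin 2) (1 : ℝ)) continuousOn_const)
    refine this.congr fun x _ => ?_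
    ext i
    fin_cases i <;> simp
  refine ⟨i1, ?_⟩
  ext i
  rw [intervalIntegral_component i2, PiLp.sub_apply, PiLp.sub_apply, intervalIntegral_component i1,
    hsum (f b), hsum (f a)]
  simp only [hZ', hW', Fin.sum_univ_two]
  have e : ∫ x in a..b, ((deriv f x) (EuclideanSpace.single 0 1) i * W x 0 +
      (deriv f x) (EuclideanSpace.single 1 1) i * W x 1) =
      ∫ x in a..b, (deriv (A i 0) x * W x 0 + deriv (A i 1) x * W x 1) :=
    intervalIntegral.integral_congr fun x hx => by
      simp only
      rw [hderiv i 0 x hx, hderiv i 1 x hx]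
  rw [e, intervalIntegral.integral_add (iB i 0) (iB i 1),
    intervalIntegral.integral_add (iA i 0) (iA i 1), hcomp, hcomp]
  ring

theorem IsH2Curve.exists_norm_deriv_le {Y : ℝ → Plane} (hY : IsH2Curve Y) :
    ∃ R, 0 ≤ R ∧ ∀ r, ‖deriv Y r‖ ≤ R := by
  obtain ⟨R, hR⟩ := isCompact_Icc.exists_bound_of_continuousOn
    (hY.continuous_deriv.continuousOn (s := Icc 0 (2 * Real.pi)))
  have h : ∀ r, ‖deriv Y r‖ ≤ R := fun r => by
    obtain ⟨r', hr', e⟩ := hY.periodic_deriv.exists_mem_Ico₀ Real.two_pi_pos r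
    rw [e]
    exact hR r' (Ico_subset_Icc_self hr')
  exact ⟨R, (norm_nonneg _).trans (h 0), h⟩

theorem IsH2Curve.contDiff {Y : ℝ → Plane} (hY : IsH2Curve Y) : ContDiff ℝ 1 Y :=
  contDiff_one_iff_deriv.2 ⟨fun s => (hY.hasDerivAt s).differentiableAt, hY.continuous_deriv⟩

/-- The derivative of an `H²` curve is Hölder continuous of exponent `1/2`. -/
theorem IsH2Curve.exists_holder {Y : ℝ → Plane} (hY : IsH2Curve Y) (s : ℝ) :
    ∃ K, 0 ≤ K ∧ ∀ r, |r - s| ≤ Real.pi → ‖deriv Y r - deriv Y s‖ ≤ K * |r - s| ^ (1 / 2 : ℝ) := by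
  have hper : Function.Periodic (fun r => ‖secondDeriv Y r‖ ^ 2) (2 * Real.pi) := fun r => by
    simp only [hY.periodic_secondDeriv r]
  have hsq := hper.intervalIntegrable₀ Real.two_pi_pos.ne' hY.integrable_sq
  set I := ∫ r in Ioc (s - Real.pi) (s + Real.pi), ‖secondDeriv Y r‖ ^ 2 with hI
  have hI0 : 0 ≤ I := integral_nonneg fun _ => by positivity
  refine ⟨(1 + I) / 2, by positivity, fun r hr => ?_⟩
  rcases eq_or_ne r s with rfl | hne
  · simp
  have hd : 0 < |r - s| := abs_pos.2 (sub_ne_zero.2 hne)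
  set d := |r - s| with hdd
  -- In place of Cauchy–Schwarz, `|Y''|` is bounded by `1/(2q) + q |Y''|²/2`. Over an interval of
  -- length `q²` both terms contribute a multiple of `q`.
  set q := d ^ (1 / 2 : ℝ) with hq
  have hq0 : 0 < q := by positivity
  have hqq : q * q = d := by
    rw [hq, ← Real.rpow_add hd]; norm_num
  have hsub : uIoc s r ⊆ Ioc (s - Real.pi) (s + Real.pi) := by
    intro x hx
    have hr' := abs_le.1 hr
    rcases mem_uIoc.1 hx with h | h
    · exact ⟨by linarith [Real.pi_pos], by linarith⟩
    · exact ⟨by linarith, by linarith [Real.pi_pos]⟩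
  have hsqI : IntegrableOn (fun r => ‖secondDeriv Y r‖ ^ 2) (Ioc (s - Real.pi) (s + Real.pi)) :=
    (hsq _ _).1
  rw [← hY.integral_secondDeriv]
  have hvol : (volume (uIoc s r)).toReal = d := by
    rw [Real.volume_uIoc, ENNReal.toReal_ofReal (abs_nonneg _)]
  have hcI : IntegrableOn (fun _ : ℝ => 1 / q / 2) (uIoc s r) :=
    integrableOn_const (by rw [Real.volume_uIoc]; exact ENNReal.ofReal_ne_top)
  have hdI : IntegrableOn (fun x => q / 2 * ‖secondDeriv Y x‖ ^ 2) (uIoc s r) :=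
    (hsqI.mono_set hsub).const_mul _
  calc ‖∫ x in s..r, secondDeriv Y x‖ ≤ ∫ x in uIoc s r, ‖secondDeriv Y x‖ :=
        intervalIntegral.norm_integral_le_integral_norm_uIoc
    _ ≤ ∫ x in uIoc s r, (1 / q / 2 + q / 2 * ‖secondDeriv Y x‖ ^ 2) := by
        refine setIntegral_mono_on
          (intervalIntegrable_iff.1 (hY.integrable s r)).norm (hcI.add hdI) measurableSet_uIoc
          fun x _ => ?_
        have h : 0 ≤ (1 - q * ‖secondDeriv Y x‖) ^ 2 / q := by positivity
        have e : (1 - q * ‖secondDeriv Y x‖) ^ 2 / q =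
          1 / q - 2 * ‖secondDeriv Y x‖ + q * ‖secondDeriv Y x‖ ^ 2 := by
          field_simp
          ring
        rw [e] at h
        linarith
    _ = d * (1 / q / 2) + q / 2 * ∫ x in uIoc s r, ‖secondDeriv Y x‖ ^ 2 := by
        rw [integral_add hcI hdI, setIntegral_const, integral_const_mul, measureReal_def, hvol,
          smul_eq_mul]
    _ ≤ d * (1 / q / 2) + q / 2 * I := by
        gcongr
        exact setIntegral_mono_set hsqI (Eventually.of_forall fun _ => by positivity)
          hsub.eventuallyLE
    _ = (1 + I) / 2 * q := by
        rw [← hqq]; field_simp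

theorem IsH2Curve.contDiffAt_kernel {Y : ℝ → Plane} (hY : IsH2Curve Y) {s r : ℝ}
    (h : Y s - Y r ≠ 0) : ContDiffAt ℝ 1 (fun r : ℝ => stokeslet (Y s - Y r)) r :=
  ContDiffAt.comp (g := stokeslet) (f := fun r => Y s - Y r) r (contDiffAt_stokeslet h)
    (contDiffAt_const.sub hY.contDiff.contDiffAt)

theorem IsH2Curve.norm_Gamma0_le {Y : ℝ → Plane} (hY : IsH2Curve Y) {s r : ℝ}
    (h : Y s - Y r ≠ 0) :
    ‖Gamma0 Y s r‖ ≤ 2 / ‖Y s - Y r‖ * ‖deriv Y r‖ * ‖deriv Y r - deriv Y s‖ := by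
  have h1 := ((contDiffAt_stokeslet h).differentiableAt (by norm_num)).hasFDerivAt
  have h2 : HasDerivAt (fun r => stokeslet (Y s - Y r))
      (fderiv ℝ stokeslet (Y s - Y r) (-deriv Y r)) r :=
    HasFDerivAt.comp_hasDerivAt (l := stokeslet) (f := fun r => Y s - Y r) r h1 ((hY.hasDerivAt r).const_sub (Y s))
  rw [Gamma0, h2.deriv, norm_neg]
  refine (ContinuousLinearMap.le_opNorm _ _).trans ?_
  gcongr
  refine (ContinuousLinearMap.le_opNorm _ _).trans ?_
  rw [norm_neg]
  gcongr
  exact norm_fderiv_stokeslet_le h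

theorem IsH2Curve.periodic_Gamma0 {Y : ℝ → Plane} (hY : IsH2Curve Y) (s : ℝ) :
    Function.Periodic (Gamma0 Y s) (2 * Real.pi) := fun r => by
  unfold Gamma0
  rw [hY.periodic_deriv r, ← deriv_comp_add_const]
  simp only [hY.periodic _]

theorem stronglyMeasurable_Gamma0 {Y : ℝ → Plane} (hY : IsH2Curve Y) (s : ℝ) :
    StronglyMeasurable (Gamma0 Y s) := by
  unfold Gamma0
  have h1 : StronglyMeasurable (deriv fun r : ℝ => stokeslet (Y s - Y r)) :=
    stronglyMeasurable_deriv _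
  have h2 : StronglyMeasurable fun r => deriv Y r - deriv Y s :=
    (hY.continuous_deriv.sub continuous_const).stronglyMeasurable
  exact (isBoundedBilinearMap_apply.continuous.comp_stronglyMeasurable (h1.prodMk h2)).neg

theorem WellStretched.norm_sub_ge {Y : ℝ → Plane} {lam : ℝ}
    (hw : ∀ s₁ s₂ : ℝ, lam * torusDist s₁ s₂ ≤ ‖Y s₁ - Y s₂‖) {s r : ℝ} (h : |r - s| ≤ Real.pi) :
    lam * |r - s| ≤ ‖Y s - Y r‖ := by
  have := hw s r
  rw [abs_sub_comm] at h ⊢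
  rwa [torusDist_eq_abs h] at this

/-- `∇G` costs `|r - s|⁻¹` and the Hölder factor gains `|r - s|^(1/2)`, leaving the integrable `|r -
s|^(-1/2)`. The value at `r = s` is irrelevant. -/
theorem IsH2Curve.integrable_Gamma0 {Y : ℝ → Plane} (hY : IsH2Curve Y) (hws : WellStretched Y)
    (s a b : ℝ) : IntervalIntegrable (Gamma0 Y s) volume a b := by
  obtain ⟨lam, hlam, hw⟩ := hws
  obtain ⟨K, hK0, hK⟩ := hY.exists_holder s
  obtain ⟨R, hR0, hR⟩ := hY.exists_norm_deriv_le
  have hle : s - Real.pi ≤ s + Real.pi := by linarith [Real.pi_pos]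
  have e : s + Real.pi = s - Real.pi + 2 * Real.pi := by ring
  refine (hY.periodic_Gamma0 s).intervalIntegrable Real.two_pi_pos.ne' (t := s - Real.pi) ?_ a b
  rw [← e]
  have hgi : IntervalIntegrable (fun r => 2 * R * K / lam * (1 * |r - s|) ^ (-(1 / 2) : ℝ)) volume
      (s - Real.pi) (s + Real.pi) := by
    have := (intervalIntegrable_abs_rpow zero_le_one).comp_sub_right s
    rw [add_comm Real.pi, neg_add_eq_sub] at this
    exact this.const_mul _
  rw [intervalIntegrable_iff_integrableOn_Ioc_of_le hle] at hgi ⊢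
  refine Integrable.mono' hgi (stronglyMeasurable_Gamma0 hY s).aestronglyMeasurable ?_
  filter_upwards [ae_restrict_mem measurableSet_Ioc, ae_restrict_of_ae (Measure.ae_ne volume s)]
    with r hr hne
  have habs : |r - s| ≤ Real.pi := by rw [abs_le]; constructor <;> linarith [hr.1, hr.2]
  have hd : 0 < |r - s| := abs_pos.2 (sub_ne_zero.2 hne)
  have hlow := WellStretched.norm_sub_ge hw habs
  have hld : 0 < lam * |r - s| := mul_pos hlam hd
  have hne' : Y s - Y r ≠ 0 := norm_pos_iff.1 (hld.trans_le hlow)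
  refine (hY.norm_Gamma0_le hne').trans ?_
  calc 2 / ‖Y s - Y r‖ * ‖deriv Y r‖ * ‖deriv Y r - deriv Y s‖
      ≤ 2 / (lam * |r - s|) * R * (K * |r - s| ^ (1 / 2 : ℝ)) := by
        gcongr
        exacts [hR r, hK r habs]
    _ = 2 * R * K / lam * (1 * |r - s|) ^ (-(1 / 2) : ℝ) := by
        rw [one_mul, show (-(1 / 2) : ℝ) = 1 / 2 - 1 by norm_num, Real.rpow_sub_one hd.ne']
        field_simp

/-- Among the primitives of `Y''`, the one vanishing at `s` is used, so that the boundary terms can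
survive the limit at the singularity. -/
theorem IsH2Curve.integral_Gamma0_of_ne {Y : ℝ → Plane} (hY : IsH2Curve Y) {s a b : ℝ}
    (h : ∀ r ∈ uIcc a b, Y s - Y r ≠ 0) :
    ∫ r in a..b, stokeslet (Y s - Y r) (secondDeriv Y r) =
      stokeslet (Y s - Y b) (deriv Y b - deriv Y s) -
      stokeslet (Y s - Y a) (deriv Y a - deriv Y s) + ∫ r in a..b, Gamma0 Y s r := by
  have := (integral_clm_apply_eq_sub (f := fun r : ℝ => stokeslet (Y s - Y r))
    (W := fun r => deriv Y r - deriv Y s) (fun r hr => hY.contDiffAt_kernel (h r hr))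
    (hY.integrable a b) (hY.continuous_deriv.sub continuous_const) (fun x _ => by
      rw [hY.integral_secondDeriv]; abel)).2
  rw [this, sub_eq_add_neg _ (∫ x in a..b, _), ← intervalIntegral.integral_neg]
  rfl

/-- The kernel is at most a constant plus a multiple of `|r - s|^(-1/4)`, while `Y' r - Y' s` is of
order `|r - s|^(1/2)`. -/
theorem IsH2Curve.tendsto_boundary_term {Y : ℝ → Plane} (hY : IsH2Curve Y)
    (hws : WellStretched Y) (s : ℝ) :
    Tendsto (fun r => stokeslet (Y s - Y r) (deriv Y r - deriv Y s)) (𝓝 s) (𝓝 0) := by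
  obtain ⟨lam, hlam, hw⟩ := hws
  obtain ⟨K, hK0, hK⟩ := hY.exists_holder s
  obtain ⟨R, hR0, hR⟩ := hY.exists_norm_le
  set C := 4 * (R + R) ^ (1 / 4 : ℝ) + 1 with hC
  have hlim : Tendsto (fun r : ℝ => C * K * |r - s| ^ (1 / 2 : ℝ) +
      4 * lam ^ (-(1 / 4) : ℝ) * K * |r - s| ^ (1 / 4 : ℝ)) (𝓝 s) (𝓝 0) := by
    have hc : Continuous fun r : ℝ => C * K * |r - s| ^ (1 / 2 : ℝ) +
      4 * lam ^ (-(1 / 4) : ℝ) * K * |r - s| ^ (1 / 4 : ℝ) := by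
      have h0 : Continuous fun r : ℝ => |r - s| := by fun_prop
      exact (continuous_const.mul (h0.rpow_const fun _ => Or.inr (by norm_num))).add
        (continuous_const.mul (h0.rpow_const fun _ => Or.inr (by norm_num)))
    have := hc.tendsto s
    simpa [Real.zero_rpow] using this
  refine squeeze_zero_norm' ?_ hlim
  have hev : ∀ᶠ r in 𝓝 s, |r - s| < Real.pi := by
    have : Tendsto (fun r : ℝ => |r - s|) (𝓝 s) (𝓝 |s - s|) :=
      (by fun_prop : Continuous fun r : ℝ => |r - s|).tendsto s
    refine this.eventually (gt_mem_nhds ?_)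
    simpa using Real.pi_pos
  filter_upwards [hev] with r hr
  rcases eq_or_ne r s with rfl | hne
  · simp [Real.zero_rpow]
  have hd : 0 < |r - s| := abs_pos.2 (sub_ne_zero.2 hne)
  have hlow := WellStretched.norm_sub_ge hw hr.le
  have hld : 0 < lam * |r - s| := mul_pos hlam hd
  have hne' : Y s - Y r ≠ 0 := norm_pos_iff.1 (hld.trans_le hlow)
  refine (norm_stokeslet_apply_le hne' _).trans ?_
  have h1 : ‖Y s - Y r‖ ^ (1 / 4 : ℝ) ≤ (R + R) ^ (1 / 4 : ℝ) :=
    Real.rpow_le_rpow (norm_nonneg _) ((norm_sub_le _ _).trans (add_le_add (hR s) (hR r)))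
      (by norm_num)
  have h2 : ‖Y s - Y r‖ ^ (-(1 / 4) : ℝ) ≤ (lam * |r - s|) ^ (-(1 / 4) : ℝ) :=
    Real.rpow_le_rpow_of_nonpos hld hlow (by norm_num)
  calc (4 * ‖Y s - Y r‖ ^ (1 / 4 : ℝ) + 4 * ‖Y s - Y r‖ ^ (-(1 / 4) : ℝ) + 1) *
        ‖deriv Y r - deriv Y s‖
      ≤ (4 * (R + R) ^ (1 / 4 : ℝ) + 4 * (lam * |r - s|) ^ (-(1 / 4) : ℝ) + 1) *
        (K * |r - s| ^ (1 / 2 : ℝ)) := by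
        gcongr
        exact hK r hr.le
    _ = _ := by
        rw [Real.mul_rpow hlam.le hd.le, hC]
        have e : |r - s| ^ (1 / 4 : ℝ) = |r - s| ^ (-(1 / 4) : ℝ) * |r - s| ^ (1 / 2 : ℝ) := by
          rw [← Real.rpow_add hd]; norm_num
        rw [e]
        ring

/-- On the curve, the single layer potential is the integral of the contour kernel. -/
theorem IsH2Curve.velocityOf_eq_integral_Gamma0 {Y : ℝ → Plane} (hY : IsH2Curve Y)
    (hws : WellStretched Y) (s : ℝ) :
    velocityOf Y (Y s) = ∫ r in (0 : ℝ)..(2 * Real.pi), Gamma0 Y s r := by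
  set U : ℝ → Plane := fun r => stokeslet (Y s - Y r) (secondDeriv Y r) with hU
  set B : ℝ → Plane := fun r => stokeslet (Y s - Y r) (deriv Y r - deriv Y s) with hB
  have hUper : Function.Periodic U (2 * Real.pi) := fun r => by
    simp only [hU, hY.periodic r, hY.periodic_secondDeriv r]
  have hUi := hUper.intervalIntegrable₀ Real.two_pi_pos.ne' (hY.integrable_stokeslet hws (Y s))
  have hGi := hY.integrable_Gamma0 hws s
  -- It suffices that `H` integrates to zero over a period. Away from `s` its integral is a
  -- difference of values of `B`, and integrability of `H` carries this up to `s`.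
  set H : ℝ → Plane := fun r => U r - Gamma0 Y s r with hH
  have hHi : ∀ a b, IntervalIntegrable H volume a b := fun a b => (hUi a b).sub (hGi a b)
  have hHper : Function.Periodic H (2 * Real.pi) := fun r => by
    simp only [hH, hUper r, hY.periodic_Gamma0 s r]
  have hB0 := hY.tendsto_boundary_term hws s
  have hne : ∀ r, |r - s| ≤ Real.pi → r ≠ s → Y s - Y r ≠ 0 := fun r hr hrs => by
    obtain ⟨lam, hlam, hw⟩ := hws
    exact norm_pos_iff.1 ((mul_pos hlam (abs_pos.2 (sub_ne_zero.2 hrs))).trans_le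
      (WellStretched.norm_sub_ge hw hr))
  have hval : ∀ a b, (∀ r ∈ uIcc a b, Y s - Y r ≠ 0) → ∫ r in a..b, H r = B b - B a := by
    intro a b h
    rw [intervalIntegral.integral_sub (hUi a b) (hGi a b), hY.integral_Gamma0_of_ne h]
    simp only [hB]
    abel
  have hside : ∀ c, (∀ r ∈ uIcc c s, |r - s| ≤ Real.pi) → c ≠ s → ∫ r in c..s, H r = - B c := by
    intro c hc hcs
    have hcont : Tendsto (fun x => ∫ r in c..x, H r) (𝓝 s) (𝓝 (∫ r in c..s, H r)) :=
      (intervalIntegral.continuous_primitive hHi c).tendsto s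
    have hlim : Tendsto (fun x => B x - B c) (𝓝 s) (𝓝 (0 - B c)) := hB0.sub_const (B c)
    rw [zero_sub] at hlim
    -- The sequence starts at `c` and approaches `s` from that side without reaching it, so the
    -- segments from `c` to `x n` avoid the singularity.
    set x : ℕ → ℝ := fun n => s + (c - s) * (1 / ((n : ℝ) + 1)) with hx
    have hxs : Tendsto x atTop (𝓝 s) := by
      simpa [hx] using (tendsto_one_div_add_atTop_nhds_zero_nat.const_mul (c - s)).const_add s
    refine tendsto_nhds_unique (hcont.comp hxs) ((hlim.comp hxs).congr fun n => ?_)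
    have hn : 0 < 1 / ((n : ℝ) + 1) := by positivity
    have hn1 : 1 / ((n : ℝ) + 1) ≤ 1 := by
      rw [div_le_one (by positivity)]
      linarith [(Nat.cast_nonneg n : (0 : ℝ) ≤ n)]
    refine (hval c (x n) fun r hr => ?_).symm
    have hr2 : r ∈ uIcc c s ∧ r ≠ s := by
      rcases lt_or_gt_of_ne hcs with h | h
      · have hxn : x n < s := by simp only [hx]; nlinarith
        have hcx : c ≤ x n := by simp only [hx]; nlinarith
        rw [uIcc_of_le hcx] at hr
        rw [uIcc_of_le h.le]
        exact ⟨⟨hr.1, hr.2.trans hxn.le⟩, (hr.2.trans_lt hxn).ne⟩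
      · have hxn : s < x n := by simp only [hx]; nlinarith
        have hcx : x n ≤ c := by simp only [hx]; nlinarith
        rw [uIcc_of_ge hcx] at hr
        rw [uIcc_of_ge h.le]
        exact ⟨⟨hxn.le.trans hr.1, hr.2⟩, (hxn.trans_le hr.1).ne'⟩
    exact hne r (hc r hr2.1) hr2.2
  have hpi := Real.pi_pos
  have h1 := hside (s - Real.pi) (fun r hr => by
    rw [uIcc_of_le (by linarith)] at hr
    rw [abs_le]; constructor <;> linarith [hr.1, hr.2]) (by linarith)
  have h2 := hside (s + Real.pi) (fun r hr => by
    rw [uIcc_of_ge (by linarith)] at hr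
    rw [abs_le]; constructor <;> linarith [hr.1, hr.2]) (by linarith)
  -- The two outer boundary terms sit at the same point of the torus, and so cancel.
  have hBper : B (s + Real.pi) = B (s - Real.pi) := by
    have e : s + Real.pi = s - Real.pi + 2 * Real.pi := by ring
    simp only [hB]
    rw [e, hY.periodic, hY.periodic_deriv]
  have h3 : ∫ r in (s - Real.pi)..(s - Real.pi + 2 * Real.pi), H r = 0 := by
    rw [show s - Real.pi + 2 * Real.pi = s + Real.pi by ring,
      ← intervalIntegral.integral_add_adjacent_intervals (hHi _ s) (hHi _ _), h1,
      intervalIntegral.integral_symm, h2, hBper]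
    abel
  rw [hHper.intervalIntegral_add_eq _ 0, zero_add,
    intervalIntegral.integral_sub (hUi _ _) (hGi _ _)] at h3
  exact sub_eq_zero.1 h3

/-! ### Test functions on the plane -/

/-- The partial derivative in direction `j`. -/
def partialD (j : Fin 2) (f : Plane → ℝ) (x : Plane) : ℝ :=
  fderiv ℝ f x (EuclideanSpace.single j 1)

/-- The Laplacian as a sum of second partial derivatives. -/
def lap (f : Plane → ℝ) (x : Plane) : ℝ :=
  partialD 0 (partialD 0 f) x + partialD 1 (partialD 1 f) x

/-- Smooth compactly supported real functions on the plane. -/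
structure IsTest (ψ : Plane → ℝ) : Prop where
  smooth : ContDiff ℝ ∞ ψ
  compact : HasCompactSupport ψ

theorem contDiff_coord (j : Fin 2) {n : WithTop ℕ∞} : ContDiff ℝ n fun x : Plane => x j :=
  (coordinate j).contDiff

theorem hasFDerivAt_coord (j : Fin 2) (x : Plane) :
    HasFDerivAt (fun x : Plane => x j) (coordinate j) x :=
  (coordinate j).hasFDerivAt

namespace IsTest

variable {ψ χ : Plane → ℝ}

theorem differentiableAt (h : IsTest ψ) (x : Plane) : DifferentiableAt ℝ ψ x :=
  h.smooth.differentiable (by simp) x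

theorem partialD (h : IsTest ψ) (j : Fin 2) : IsTest (partialD j ψ) :=
  ⟨(h.smooth.fderiv_right (m := ∞) (by simp)).clm_apply contDiff_const,
    (h.compact.fderiv (𝕜 := ℝ)).comp_left
      (g := fun T : Plane →L[ℝ] ℝ => T (EuclideanSpace.single j 1)) rfl⟩

theorem add (h : IsTest ψ) (h' : IsTest χ) : IsTest fun x => ψ x + χ x :=
  ⟨h.smooth.add h'.smooth, h.compact.add h'.compact⟩

theorem mul_left {f : Plane → ℝ} (hf : ContDiff ℝ ∞ f) (h : IsTest ψ) : IsTest fun x => f x * ψ x :=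
  ⟨hf.mul h.smooth, h.compact.mul_left⟩

theorem coord_mul (h : IsTest ψ) (j : Fin 2) : IsTest fun x => x j * ψ x :=
  h.mul_left (contDiff_coord j)

theorem const_mul (h : IsTest ψ) (c : ℝ) : IsTest fun x => c * ψ x :=
  h.mul_left contDiff_const

theorem lap (h : IsTest ψ) : IsTest (lap ψ) :=
  ((h.partialD 0).partialD 0).add ((h.partialD 1).partialD 1)

theorem comp_add (h : IsTest ψ) (y : Plane) : IsTest fun x => ψ (x + y) :=
  ⟨h.smooth.comp (contDiff_id.add contDiff_const),
    h.compact.comp_homeomorph (Homeomorph.addRight y)⟩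

theorem continuous (h : IsTest ψ) : Continuous ψ := h.smooth.continuous

theorem integrable_mul (h : IsTest ψ) {k : Plane → ℝ} (hk : LocallyIntegrable k volume) :
    Integrable fun x => k x * ψ x := by
  simpa [mul_comm] using
    hk.integrable_smul_left_of_hasCompactSupport h.continuous h.compact

end IsTest

theorem partialD_add {f g : Plane → ℝ} {x : Plane} (hf : DifferentiableAt ℝ f x)
    (hg : DifferentiableAt ℝ g x) (j : Fin 2) :
    partialD j (fun x => f x + g x) x = partialD j f x + partialD j g x := by
  unfold partialD
  rw [(hf.hasFDerivAt.fun_add hg.hasFDerivAt).fderiv]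
  rfl

theorem partialD_mul {f g : Plane → ℝ} {x : Plane} (hf : DifferentiableAt ℝ f x)
    (hg : DifferentiableAt ℝ g x) (j : Fin 2) :
    partialD j (fun x => f x * g x) x = f x * partialD j g x + g x * partialD j f x := by
  unfold partialD
  rw [(hf.hasFDerivAt.fun_mul hg.hasFDerivAt).fderiv]
  rfl

theorem partialD_coord (i j : Fin 2) (x : Plane) :
    partialD i (fun x : Plane => x j) x = if i = j then 1 else 0 := by
  unfold partialD
  rw [(hasFDerivAt_coord j x).fderiv, coordinate_apply]
  simp [eq_comm]

theorem partialD_coord_mul {ψ : Plane → ℝ} (h : IsTest ψ) (i j : Fin 2) (x : Plane) :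
    partialD i (fun x => x j * ψ x) x = x j * partialD i ψ x + if i = j then ψ x else 0 := by
  rw [partialD_mul (hasFDerivAt_coord j x).differentiableAt (h.differentiableAt x), partialD_coord]
  split_ifs <;> simp

theorem partialD_comm {ψ : Plane → ℝ} (h : IsTest ψ) (i j : Fin 2) :
    partialD i (partialD j ψ) = partialD j (partialD i ψ) := by
  ext1 x
  have hd : DifferentiableAt ℝ (fderiv ℝ ψ) x :=
    (h.smooth.fderiv_right (m := ∞) (by simp)).differentiable (by simp) x
  have e : ∀ i j, partialD i (partialD j ψ) x = fderiv ℝ (fderiv ℝ ψ) x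
      (EuclideanSpace.single i 1) (EuclideanSpace.single j 1) := fun i j => by
    have := (hd.hasFDerivAt.clm_apply
      (hasFDerivAt_const (EuclideanSpace.single j (1 : ℝ)) x)).fderiv
    unfold partialD
    rw [this]
    simp
  rw [e, e]
  exact (h.smooth.contDiffAt.isSymmSndFDerivAt (by
    rw [minSmoothness_of_isRCLikeNormedField]; exact WithTop.coe_le_coe.2 le_top)) _ _

theorem partialD_comp_add (f : Plane → ℝ) (y : Plane) (j : Fin 2) :
    partialD j (fun x => f (x + y)) = fun x => partialD j f (x + y) := by
  ext1 x
  unfold partialD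
  rw [fderiv_comp_add_right]

theorem lap_comp_add (f : Plane → ℝ) (y : Plane) :
    lap (fun x => f (x + y)) = fun x => lap f (x + y) := by
  ext1 x
  simp only [lap, partialD_comp_add]

theorem lap_coord_mul {ψ : Plane → ℝ} (h : IsTest ψ) (j : Fin 2) (x : Plane) :
    lap (fun x => x j * ψ x) x = x j * lap ψ x + 2 * partialD j ψ x := by
  have e : ∀ i, partialD i (partialD i fun x => x j * ψ x) x =
      x j * partialD i (partialD i ψ) x + if i = j then 2 * partialD j ψ x else 0 := by
    intro i
    have h1 : (partialD i fun x => x j * ψ x) =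
        fun x => x j * partialD i ψ x + (if i = j then 1 else 0) * ψ x := by
      ext1 y
      rw [partialD_coord_mul h]
      split_ifs <;> simp
    rw [h1, partialD_add (((h.partialD i).coord_mul j).differentiableAt x)
      ((h.const_mul _).differentiableAt x), partialD_coord_mul (h.partialD i),
      partialD_mul (differentiableAt_const _) (h.differentiableAt x)]
    have hc : partialD i (fun _ : Plane => (if i = j then (1 : ℝ) else 0)) x = 0 := by
      unfold partialD; simp
    rw [hc]
    split_ifs with hij
    · subst hij; ring
    · ring
  unfold lap
  rw [e, e]
  fin_cases j <;> simp <;> ring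

theorem integral_mul_partialD {f ψ : Plane → ℝ} (hf : ContDiff ℝ 1 f) (h : IsTest ψ) (j : Fin 2) :
    ∫ x, f x * partialD j ψ x = -∫ x, partialD j f x * ψ x := by
  have hf' : Continuous (partialD j f) :=
    (hf.continuous_fderiv (by norm_num)).clm_apply continuous_const
  exact integral_mul_fderiv_eq_neg_fderiv_mul_of_integrable
    (h.integrable_mul hf'.locallyIntegrable)
    ((h.partialD j).integrable_mul hf.continuous.locallyIntegrable)
    (h.integrable_mul hf.continuous.locallyIntegrable)
    (fun x _ => hf.differentiable (by norm_num) x) (fun x _ => h.differentiableAt x)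

/-! ### Singular kernels on the plane -/

theorem finrank_plane : Module.finrank ℝ Plane = 2 := by simp

/-- In polar coordinates the Jacobian `r` cancels the singularity. -/
theorem locallyIntegrable_norm_inv : LocallyIntegrable (fun x : Plane => ‖x‖⁻¹) volume := by
  intro x
  refine ⟨Metric.ball 0 (‖x‖ + 1), Metric.isOpen_ball.mem_nhds (by simp), ?_⟩
  rw [integrableOn_fun_norm_addHaar volume (f := fun y : ℝ => y⁻¹), finrank_plane]
  refine (integrableOn_const (C := (1 : ℝ)) (by simp)).congr_fun (fun y hy => ?_) measurableSet_Ioo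
  have : y ≠ 0 := hy.1.ne'
  simp [this]

theorem LocallyIntegrable.of_norm_le {f g : Plane → ℝ} (hg : LocallyIntegrable g volume)
    (hf : Measurable f) (hfg : ∀ x, ‖f x‖ ≤ g x) : LocallyIntegrable f volume :=
  hg.mono hf.aestronglyMeasurable (Eventually.of_forall fun x => (hfg x).trans (le_abs_self _))

theorem abs_log_le {r : ℝ} (hr : 0 ≤ r) : |Real.log r| ≤ r + r⁻¹ := by
  rcases hr.eq_or_lt with rfl | h
  · simp
  have h1 := Real.log_le_sub_one_of_pos h
  have h2 := Real.log_le_sub_one_of_pos (inv_pos.2 h)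
  rw [Real.log_inv] at h2
  have := inv_pos.2 h
  rw [abs_le]
  constructor <;> linarith

theorem locallyIntegrable_norm_add_inv :
    LocallyIntegrable (fun x : Plane => ‖x‖ + ‖x‖⁻¹) volume :=
  continuous_norm.locallyIntegrable.add locallyIntegrable_norm_inv

/-- The logarithmic kernel. -/
def logKernel (x : Plane) : ℝ := Real.log ‖x‖

/-- The gradient of the logarithmic kernel. -/
def gradLogKernel (j : Fin 2) (x : Plane) : ℝ := x j / ‖x‖ ^ 2

theorem measurable_coord (j : Fin 2) : Measurable fun x : Plane => x j :=
  (coordinate j).measurable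

theorem measurable_logKernel : Measurable logKernel := by unfold logKernel; fun_prop

theorem measurable_gradLogKernel (j : Fin 2) : Measurable (gradLogKernel j) :=
  (measurable_coord j).div (by fun_prop)

theorem locallyIntegrable_logKernel : LocallyIntegrable logKernel volume :=
  LocallyIntegrable.of_norm_le locallyIntegrable_norm_add_inv measurable_logKernel
    fun x => abs_log_le (norm_nonneg x)

theorem abs_coord_le (x : Plane) (j : Fin 2) : |x j| ≤ ‖x‖ := PiLp.norm_apply_le x j

theorem abs_coord_div_le (x : Plane) (j : Fin 2) (ε : ℝ) :
    |x j / (‖x‖ ^ 2 + ε ^ 2)| ≤ ‖x‖⁻¹ := by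
  rcases eq_or_ne x 0 with rfl | hx
  · simp
  have hx' := norm_pos_iff.2 hx
  rw [abs_div, abs_of_pos (by positivity : 0 < ‖x‖ ^ 2 + ε ^ 2), div_le_iff₀ (by positivity)]
  refine (abs_coord_le x j).trans ?_
  rw [inv_mul_eq_div, le_div_iff₀ hx']
  nlinarith [sq_nonneg ε]

theorem abs_gradLogKernel_le (j : Fin 2) (x : Plane) : |gradLogKernel j x| ≤ ‖x‖⁻¹ := by
  simpa [gradLogKernel] using abs_coord_div_le x j 0

theorem locallyIntegrable_gradLogKernel (j : Fin 2) :
    LocallyIntegrable (gradLogKernel j) volume :=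
  LocallyIntegrable.of_norm_le locallyIntegrable_norm_inv (measurable_gradLogKernel j)
    (abs_gradLogKernel_le j)

/-! ### Regularised kernels and the distributional derivatives of the logarithm. -/

theorem norm_sq_eq_coord (x : Plane) : ‖x‖ ^ 2 = x 0 ^ 2 + x 1 ^ 2 := by
  rw [EuclideanSpace.norm_sq_eq, Fin.sum_univ_two]
  simp

theorem contDiff_norm_sq_add (ε : ℝ) {n : WithTop ℕ∞} :
    ContDiff ℝ n fun x : Plane => ‖x‖ ^ 2 + ε ^ 2 :=
  (contDiff_norm_sq ℝ).add contDiff_const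

theorem partialD_norm_sq_add (ε : ℝ) (j : Fin 2) (x : Plane) :
    partialD j (fun x : Plane => ‖x‖ ^ 2 + ε ^ 2) x = 2 * x j := by
  unfold partialD
  rw [((hasStrictFDerivAt_norm_sq x).hasFDerivAt.add_const (ε ^ 2)).fderiv]
  simp [EuclideanSpace.inner_single_right]

theorem partialD_comp_real {f : Plane → ℝ} {g : ℝ → ℝ} {g' : ℝ} {x : Plane}
    (hf : DifferentiableAt ℝ f x) (hg : HasDerivAt g g' (f x)) (j : Fin 2) :
    partialD j (fun x => g (f x)) x = g' * partialD j f x := by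
  unfold partialD
  have e : fderiv ℝ (fun x => g (f x)) x = g' • fderiv ℝ f x :=
    (hg.comp_hasFDerivAt x hf.hasFDerivAt).fderiv
  rw [e]
  rfl

/-- Replacing `|x|²` by `|x|² + ε²` removes the singularity, so ordinary integration by parts
applies; the singular identities follow as `ε → 0`. -/
theorem contDiff_regLog {ε : ℝ} (hε : 0 < ε) :
    ContDiff ℝ 1 fun x : Plane => Real.log (‖x‖ ^ 2 + ε ^ 2) / 2 :=
  ((contDiff_norm_sq_add ε).log fun x => by positivity).div_const 2

theorem partialD_regLog {ε : ℝ} (hε : 0 < ε) (j : Fin 2) (x : Plane) :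
    partialD j (fun x : Plane => Real.log (‖x‖ ^ 2 + ε ^ 2) / 2) x = x j / (‖x‖ ^ 2 + ε ^ 2) := by
  have hpos : 0 < ‖x‖ ^ 2 + ε ^ 2 := by positivity
  rw [partialD_comp_real (f := fun x : Plane => ‖x‖ ^ 2 + ε ^ 2) (g := fun t => Real.log t / 2)
    ((contDiff_norm_sq_add ε (n := 1)).differentiable (by norm_num) x)
    ((Real.hasDerivAt_log hpos.ne').div_const 2), partialD_norm_sq_add]
  field_simp

theorem contDiff_regGrad {ε : ℝ} (hε : 0 < ε) (j : Fin 2) :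
    ContDiff ℝ 1 fun x : Plane => x j / (‖x‖ ^ 2 + ε ^ 2) :=
  (contDiff_coord j).div (contDiff_norm_sq_add ε) fun x => by positivity

theorem partialD_regGrad {ε : ℝ} (hε : 0 < ε) (j : Fin 2) (x : Plane) :
    partialD j (fun x : Plane => x j / (‖x‖ ^ 2 + ε ^ 2)) x =
      1 / (‖x‖ ^ 2 + ε ^ 2) - 2 * x j ^ 2 / (‖x‖ ^ 2 + ε ^ 2) ^ 2 := by
  have hpos : 0 < ‖x‖ ^ 2 + ε ^ 2 := by positivity
  have hd := (contDiff_norm_sq_add ε (n := 1)).differentiable (by norm_num) x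
  have hi : DifferentiableAt ℝ (fun x : Plane => (‖x‖ ^ 2 + ε ^ 2)⁻¹) x := hd.inv hpos.ne'
  simp only [div_eq_mul_inv (_ : ℝ) (‖_‖ ^ 2 + ε ^ 2)]
  rw [partialD_mul (hasFDerivAt_coord j x).differentiableAt hi, partialD_coord,
    partialD_comp_real (f := fun x : Plane => ‖x‖ ^ 2 + ε ^ 2) (g := fun t => t⁻¹) hd
    (hasDerivAt_inv hpos.ne'), partialD_norm_sq_add]
  simp only [if_true]
  field_simp
  ring

theorem tendsto_integral_regGrad (j : Fin 2) {ψ : Plane → ℝ} (h : IsTest ψ) :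
    Tendsto (fun ε : ℝ => ∫ x, x j / (‖x‖ ^ 2 + ε ^ 2) * ψ x) (𝓝[>] 0)
      (𝓝 (∫ x, gradLogKernel j x * ψ x)) := by
  refine tendsto_integral_filter_of_dominated_convergence (fun x => ‖x‖⁻¹ * |ψ x|) ?_ ?_ ?_ ?_
  · refine Eventually.of_forall fun ε => Measurable.aestronglyMeasurable ?_
    have := measurable_coord j
    have := h.continuous.measurable
    fun_prop
  · refine Eventually.of_forall fun ε => Eventually.of_forall fun x => ?_
    rw [norm_mul, Real.norm_eq_abs, Real.norm_eq_abs]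
    gcongr
    exact abs_coord_div_le x j ε
  · have := (h.integrable_mul locallyIntegrable_norm_inv).norm
    simpa [abs_mul] using this
  · filter_upwards [Measure.ae_ne volume (0 : Plane)] with x hx
    have hx' := norm_pos_iff.2 hx
    have hc : ContinuousAt (fun ε : ℝ => x j / (‖x‖ ^ 2 + ε ^ 2) * ψ x) 0 := by
      refine ContinuousAt.mul (ContinuousAt.div continuousAt_const (by fun_prop) ?_)
        continuousAt_const
      positivity
    have := hc.tendsto.mono_left (nhdsWithin_le_nhds (s := Ioi 0))
    simpa [gradLogKernel] using this

theorem tendsto_integral_regLog {ψ : Plane → ℝ} (h : IsTest ψ) :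
    Tendsto (fun ε : ℝ => ∫ x : Plane, Real.log (‖x‖ ^ 2 + ε ^ 2) / 2 * ψ x) (𝓝[>] 0)
      (𝓝 (∫ x, logKernel x * ψ x)) := by
  refine tendsto_integral_filter_of_dominated_convergence
    (fun x => (‖x‖ + ‖x‖⁻¹ + (‖x‖ ^ 2 + 1)) * |ψ x|) ?_ ?_ ?_ ?_
  · refine Eventually.of_forall fun ε => Measurable.aestronglyMeasurable ?_
    have := h.continuous.measurable
    fun_prop
  · filter_upwards [Ioc_mem_nhdsGT (zero_lt_one : (0 : ℝ) < 1)] with ε hε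
    filter_upwards [Measure.ae_ne volume (0 : Plane)] with x hx
    have hx' := norm_pos_iff.2 hx
    rw [norm_mul, Real.norm_eq_abs, Real.norm_eq_abs]
    gcongr
    have hpos : 0 < ‖x‖ ^ 2 + ε ^ 2 := by positivity
    have h1 := Real.log_le_sub_one_of_pos hpos
    have h2 : Real.log (‖x‖ ^ 2) ≤ Real.log (‖x‖ ^ 2 + ε ^ 2) :=
      Real.log_le_log (by positivity) (by nlinarith [hε.1])
    rw [Real.log_pow] at h2
    push_cast at h2
    have h3 := abs_le.1 (abs_log_le hx'.le)
    have h4 : ε ^ 2 ≤ 1 := by nlinarith [hε.1, hε.2]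
    have h5 : 0 < ‖x‖⁻¹ := by positivity
    rw [abs_le]
    constructor <;> nlinarith [h3.1, h3.2, sq_nonneg ‖x‖]
  · have hk : LocallyIntegrable (fun x : Plane => ‖x‖ + ‖x‖⁻¹ + (‖x‖ ^ 2 + 1)) volume :=
      locallyIntegrable_norm_add_inv.add (by fun_prop : Continuous fun x : Plane =>
        ‖x‖ ^ 2 + 1).locallyIntegrable
    have := (h.integrable_mul hk).norm
    refine this.congr (Eventually.of_forall fun x => ?_)
    simp only
    rw [norm_mul, Real.norm_of_nonneg (by positivity), Real.norm_eq_abs]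
  · filter_upwards [Measure.ae_ne volume (0 : Plane)] with x hx
    have hx' := norm_pos_iff.2 hx
    have hc : ContinuousAt (fun ε : ℝ => Real.log (‖x‖ ^ 2 + ε ^ 2) / 2 * ψ x) 0 := by
      refine ContinuousAt.mul (ContinuousAt.div_const (ContinuousAt.log (by fun_prop) ?_) 2)
        continuousAt_const
      positivity
    have := hc.tendsto.mono_left (nhdsWithin_le_nhds (s := Ioi 0))
    have e : Real.log (‖x‖ ^ 2 + 0 ^ 2) / 2 * ψ x = logKernel x * ψ x := by
      rw [logKernel, zero_pow two_ne_zero, add_zero, Real.log_pow]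
      push_cast
      ring
    rwa [e] at this

theorem integral_logKernel_partialD {ψ : Plane → ℝ} (h : IsTest ψ) (j : Fin 2) :
    ∫ x, logKernel x * partialD j ψ x = -∫ x, gradLogKernel j x * ψ x := by
  refine tendsto_nhds_unique (tendsto_integral_regLog (h.partialD j))
    ((tendsto_integral_regGrad j h).neg.congr' ?_)
  filter_upwards [self_mem_nhdsWithin] with ε hε
  rw [integral_mul_partialD (contDiff_regLog hε) h]
  simp only [partialD_regLog hε]

theorem integrable_blob : Integrable fun y : Plane => 2 / (‖y‖ ^ 2 + 1) ^ 2 := by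
  have h := integrable_rpow_neg_one_add_norm_sq (E := Plane) (μ := volume) (r := 4)
    (by rw [finrank_plane]; norm_num)
  refine (h.const_mul 2).congr (Eventually.of_forall fun y => ?_)
  simp only
  rw [show (-4 / 2 : ℝ) = -(2 : ℕ) by norm_num, Real.rpow_neg (by positivity), Real.rpow_natCast,
    add_comm, div_eq_mul_inv]

theorem integral_blob : ∫ y : Plane, 2 / (‖y‖ ^ 2 + 1) ^ 2 = 2 * Real.pi := by
  rw [integral_fun_norm_addHaar volume (fun t : ℝ => 2 / (t ^ 2 + 1) ^ 2), finrank_plane]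
  have hvol : volume.real (Metric.ball (0 : Plane) 1) = Real.pi := by
    rw [measureReal_def, EuclideanSpace.volume_ball_fin_two]
    simp [ENNReal.toReal_ofReal Real.pi_pos.le]
  have hint : ∫ y in Ioi (0 : ℝ), y ^ (2 - 1) • (2 / (y ^ 2 + 1) ^ 2) = 1 := by
    -- The radial density has an explicit primitive, so the integral is evaluated from its values at
    -- `0` and infinity.
    have hd : ∀ y ∈ Ici (0 : ℝ), HasDerivAt (fun y : ℝ => -(y ^ 2 + 1)⁻¹)
        (y ^ (2 - 1) • (2 / (y ^ 2 + 1) ^ 2)) y := fun y _ => by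
      have h1 : HasDerivAt (fun y : ℝ => y ^ 2 + 1) (2 * y) y := by
        simpa using (hasDerivAt_pow 2 y).add_const 1
      have h2 := (h1.inv (by positivity)).neg
      convert! h2 using 1
      simp only [smul_eq_mul]
      ring
    have hlim : Tendsto (fun y : ℝ => -(y ^ 2 + 1)⁻¹) atTop (𝓝 0) := by
      have : Tendsto (fun y : ℝ => y ^ 2 + 1) atTop atTop :=
        tendsto_atTop_add_const_right _ _ (tendsto_pow_atTop two_ne_zero)
      simpa using (tendsto_inv_atTop_zero.comp this).neg
    rw [integral_Ioi_of_hasDerivAt_of_nonneg' hd (fun y hy => by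
      have : (0 : ℝ) < y := hy
      positivity) hlim]
    norm_num
  rw [hvol, hint]
  simp

/-- Substituting `x = ε y` turns the kernel into a fixed density of mass `2π` and the test function
into `ψ (ε y)`, which tends to `ψ 0` under bounded domination. -/
theorem tendsto_integral_blob {ψ : Plane → ℝ} (h : IsTest ψ) :
    Tendsto (fun ε : ℝ => ∫ x : Plane, 2 * ε ^ 2 / (‖x‖ ^ 2 + ε ^ 2) ^ 2 * ψ x) (𝓝[>] 0)
      (𝓝 (2 * Real.pi * ψ 0)) := by
  obtain ⟨C, hC⟩ := h.compact.exists_bound_of_continuous h.continuous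
  have hlim : Tendsto (fun ε : ℝ => ∫ y : Plane, 2 / (‖y‖ ^ 2 + 1) ^ 2 * ψ (ε • y)) (𝓝[>] 0)
      (𝓝 (∫ y : Plane, 2 / (‖y‖ ^ 2 + 1) ^ 2 * ψ 0)) := by
    refine tendsto_integral_filter_of_dominated_convergence
      (fun y => 2 / (‖y‖ ^ 2 + 1) ^ 2 * C) ?_ ?_ (integrable_blob.mul_const C) ?_
    · refine Eventually.of_forall fun ε => Measurable.aestronglyMeasurable ?_
      have : Measurable fun y : Plane => ψ (ε • y) :=
        (h.continuous.comp (continuous_const_smul ε)).measurable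
      exact Measurable.mul (by fun_prop) this
    · refine Eventually.of_forall fun ε => Eventually.of_forall fun x => ?_
      rw [norm_mul, Real.norm_of_nonneg (by positivity)]
      gcongr
      exact hC _
    · refine Eventually.of_forall fun y => ?_
      have hc : Continuous fun ε : ℝ => 2 / (‖y‖ ^ 2 + 1) ^ 2 * ψ (ε • y) :=
        continuous_const.mul (h.continuous.comp (by fun_prop))
      have := (hc.tendsto 0).mono_left (nhdsWithin_le_nhds (s := Ioi 0))
      simpa using this
  rw [integral_mul_const, integral_blob] at hlim
  refine hlim.congr' ?_
  filter_upwards [self_mem_nhdsWithin] with ε hε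
  have hε' : (0 : ℝ) < ε := hε
  have := Measure.integral_comp_smul volume
    (fun x : Plane => 2 * ε ^ 2 / (‖x‖ ^ 2 + ε ^ 2) ^ 2 * ψ x) ε
  rw [finrank_plane, abs_of_pos (by positivity), smul_eq_mul, eq_inv_mul_iff_mul_eq₀
    (by positivity)] at this
  rw [← this, ← integral_const_mul]
  refine integral_congr_ae (Eventually.of_forall fun y => ?_)
  simp only
  rw [norm_smul, Real.norm_of_nonneg hε'.le]
  have : (ε * ‖y‖) ^ 2 + ε ^ 2 = ε ^ 2 * (‖y‖ ^ 2 + 1) := by ring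
  rw [this]
  field_simp

/-- The divergence of the regularised gradient `x / (|x|² + ε²)` is `2ε² / (|x|² + ε²)²`, an
approximation of `2πδ`. -/
theorem integral_gradLogKernel_partialD {ψ : Plane → ℝ} (h : IsTest ψ) :
    (∫ x, gradLogKernel 0 x * partialD 0 ψ x) + ∫ x, gradLogKernel 1 x * partialD 1 ψ x =
      -(2 * Real.pi * ψ 0) := by
  refine tendsto_nhds_unique ((tendsto_integral_regGrad 0 (h.partialD 0)).add
    (tendsto_integral_regGrad 1 (h.partialD 1))) ((tendsto_integral_blob h).neg.congr' ?_)
  filter_upwards [self_mem_nhdsWithin] with ε hε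
  have hε' : (0 : ℝ) < ε := hε
  rw [integral_mul_partialD (contDiff_regGrad hε 0) h, integral_mul_partialD (contDiff_regGrad hε 1) h,
    ← neg_add, ← integral_add]
  · congr 1
    refine integral_congr_ae (Eventually.of_forall fun x => ?_)
    simp only [partialD_regGrad hε]
    rw [← add_mul]
    congr 1
    have hpos : 0 < ‖x‖ ^ 2 + ε ^ 2 := by positivity
    have e := norm_sq_eq_coord x
    field_simp
    linear_combination (-2) * e
  all_goals
    refine h.integrable_mul (Continuous.locallyIntegrable ?_)
    exact ((contDiff_regGrad hε _).continuous_fderiv (by norm_num)).clm_apply continuous_const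

/-! ### The fundamental solution in the sense of distributions -/

theorem integral_logKernel_lap {ψ : Plane → ℝ} (h : IsTest ψ) :
    ∫ x, logKernel x * lap ψ x = 2 * Real.pi * ψ 0 := by
  have h0 := (((h.partialD 0).partialD 0).integrable_mul locallyIntegrable_logKernel)
  have h1 := (((h.partialD 1).partialD 1).integrable_mul locallyIntegrable_logKernel)
  simp only [lap, mul_add]
  rw [integral_add h0 h1, integral_logKernel_partialD (h.partialD 0),
    integral_logKernel_partialD (h.partialD 1), ← neg_add, integral_gradLogKernel_partialD h, neg_neg]

/-- `4π ∫ (G e_j) · w` for a vector field with components `w₀`, `w₁`. -/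
def stokesletPairing (j : Fin 2) (w : Fin 2 → Plane → ℝ) : ℝ :=
  -(∫ x, logKernel x * w j x) + ((∫ x, gradLogKernel 0 x * (x j * w 0 x)) +
    ∫ x, gradLogKernel 1 x * (x j * w 1 x))

theorem lap_partialD_add {φ₀ φ₁ : Plane → ℝ} (h₀ : IsTest φ₀) (h₁ : IsTest φ₁) (x : Plane) :
    lap (fun x => partialD 0 φ₀ x + partialD 1 φ₁ x) x =
      partialD 0 (lap φ₀) x + partialD 1 (lap φ₁) x := by
  have e : ∀ {a b : Plane → ℝ}, IsTest a → IsTest b → ∀ i,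
      partialD i (fun x => a x + b x) = fun x => partialD i a x + partialD i b x :=
    fun ha hb i => funext fun y => partialD_add (ha.differentiableAt y) (hb.differentiableAt y) i
  unfold lap
  have a0 := h₀.partialD 0
  have b0 := h₁.partialD 1
  rw [e a0 b0 0, e a0 b0 1, e (a0.partialD 0) (b0.partialD 0), e (a0.partialD 1) (b0.partialD 1),
    e ((h₀.partialD 0).partialD 0) ((h₀.partialD 1).partialD 1),
    e ((h₁.partialD 0).partialD 0) ((h₁.partialD 1).partialD 1),
    partialD_comm h₀ 1 0, partialD_comm (h₀.partialD 1) 1 0, partialD_comm h₁ 0 1,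
    partialD_comm (h₁.partialD 0) 0 1]
  ring

/-- Write `x_i / |x|²` as `∂_i log |x|` and move the derivative across. With `d = div φ`, the
divergence of `x_j Δφ` is `x_j Δd + Δφ_j`. The last term doubles the contribution of `log |x|`,
whence `4π φ_j(0)`. For the other, `Δ(x_j d) = x_j Δd + 2 ∂_j d`, and pairing `Δ(x_j d)` with `log
|x|` gives zero because `x_j d` vanishes at the origin. -/
theorem stokesletPairing_lap {φ : Fin 2 → Plane → ℝ} (h : ∀ i, IsTest (φ i)) (j : Fin 2) :
    stokesletPairing j (fun i => lap (φ i)) = -(4 * Real.pi * φ j 0) -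
      2 * ∫ x, gradLogKernel j x * (partialD 0 (φ 0) x + partialD 1 (φ 1) x) := by
  have hd : IsTest fun x => partialD 0 (φ 0) x + partialD 1 (φ 1) x :=
    ((h 0).partialD 0).add ((h 1).partialD 1)
  have hk := locallyIntegrable_logKernel
  set d := fun x => partialD 0 (φ 0) x + partialD 1 (φ 1) x with hdd
  have e1 : (∫ x, gradLogKernel 0 x * (x j * lap (φ 0) x)) +
      (∫ x, gradLogKernel 1 x * (x j * lap (φ 1) x)) =
      -((∫ x, logKernel x * (x j * lap d x)) + ∫ x, logKernel x * lap (φ j) x) := by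
    have f0 := integral_logKernel_partialD ((h 0).lap.coord_mul j) 0
    have f1 := integral_logKernel_partialD ((h 1).lap.coord_mul j) 1
    have hsum : ((∫ x, logKernel x * partialD 0 (fun x => x j * lap (φ 0) x) x) +
        ∫ x, logKernel x * partialD 1 (fun x => x j * lap (φ 1) x) x) =
        (∫ x, logKernel x * (x j * lap d x)) + ∫ x, logKernel x * lap (φ j) x := by
      rw [← integral_add ((((h 0).lap.coord_mul j).partialD 0).integrable_mul hk)
        ((((h 1).lap.coord_mul j).partialD 1).integrable_mul hk),
        ← integral_add ((hd.lap.coord_mul j).integrable_mul hk) ((h j).lap.integrable_mul hk)]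
      refine integral_congr_ae (Eventually.of_forall fun x => ?_)
      simp only
      rw [partialD_coord_mul (h 0).lap, partialD_coord_mul (h 1).lap, hdd,
        lap_partialD_add (h 0) (h 1)]
      fin_cases j <;> simp <;> ring
    linarith
  have e2 : ∫ x, logKernel x * (x j * lap d x) = 2 * ∫ x, gradLogKernel j x * d x := by
    have g := integral_logKernel_lap (hd.coord_mul j)
    simp only [lap_coord_mul hd j, mul_add] at g
    have g2 := integral_logKernel_partialD hd j
    have hi : Integrable fun x => logKernel x * (2 * partialD j d x) :=
      ((hd.partialD j).const_mul 2).integrable_mul hk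
    rw [integral_add ((hd.lap.coord_mul j).integrable_mul hk) hi] at g
    simp only [mul_left_comm (logKernel _) 2] at g
    rw [integral_const_mul, g2] at g
    simp only [PiLp.zero_apply, zero_mul, mul_zero] at g
    linarith
  unfold stokesletPairing
  rw [e1, e2, integral_logKernel_lap (h j)]
  ring

/-- The columns of `G` are divergence free. Here this is the identity `Δ log |x| = 2πδ` tested on
`x_j ψ`, which vanishes at the origin. -/
theorem stokesletPairing_grad {ψ : Plane → ℝ} (h : IsTest ψ) (j : Fin 2) :
    stokesletPairing j (fun i => partialD i ψ) = 0 := by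
  have e := integral_gradLogKernel_partialD (h.coord_mul j)
  have hk := fun i => locallyIntegrable_gradLogKernel i
  have hs : ∀ i, ∫ x, gradLogKernel i x * partialD i (fun x => x j * ψ x) x =
      (∫ x, gradLogKernel i x * (x j * partialD i ψ x)) +
        if i = j then ∫ x, gradLogKernel i x * ψ x else 0 := fun i => by
    split_ifs with hij
    · rw [← integral_add (((h.partialD i).coord_mul j).integrable_mul (hk i))
        (h.integrable_mul (hk i))]
      refine integral_congr_ae (Eventually.of_forall fun x => ?_)
      simp only [partialD_coord_mul h, hij, if_true]
      ring
    · rw [add_zero]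
      refine integral_congr_ae (Eventually.of_forall fun x => ?_)
      simp only [partialD_coord_mul h, hij, if_false, add_zero]
  rw [hs, hs] at e
  unfold stokesletPairing
  rw [integral_logKernel_partialD h, neg_neg]
  simp only [PiLp.zero_apply, zero_mul, mul_zero, neg_zero] at e
  fin_cases j
  · simp only [Fin.zero_eta, Fin.isValue, if_true, one_ne_zero, if_false, add_zero] at e ⊢
    linarith
  · simp only [Fin.mk_one, Fin.isValue, if_true, zero_ne_one, if_false, add_zero] at e ⊢
    linarith

theorem inner_stokeslet_eq (x F w : Plane) :
    (inner ℝ (stokeslet x F) w : ℝ) = (1 / (4 * Real.pi)) *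
      (F 0 * (-(logKernel x * w 0) + (gradLogKernel 0 x * (x 0 * w 0) +
        gradLogKernel 1 x * (x 0 * w 1))) +
      F 1 * (-(logKernel x * w 1) + (gradLogKernel 0 x * (x 1 * w 0) +
        gradLogKernel 1 x * (x 1 * w 1)))) := by
  rw [stokeslet_apply, logKernel, gradLogKernel, gradLogKernel]
  simp only [PiLp.inner_apply, Fin.sum_univ_two, PiLp.smul_apply, PiLp.add_apply, PiLp.neg_apply,
    smul_eq_mul, RCLike.inner_apply, conj_trivial]
  ring

theorem inner_pressureKernel_eq (x F : Plane) :
    (inner ℝ (pressureKernel x) F : ℝ) = (1 / (2 * Real.pi)) *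
      (F 0 * gradLogKernel 0 x + F 1 * gradLogKernel 1 x) := by
  rw [pressureKernel, gradLogKernel, gradLogKernel]
  simp only [PiLp.inner_apply, Fin.sum_univ_two, PiLp.smul_apply,
    smul_eq_mul, RCLike.inner_apply, conj_trivial]
  field_simp

theorem integral_inner_stokeslet {w : Plane → Plane} (hw : ∀ i, IsTest fun x => w x i) (F : Plane) :
    ∫ x, (inner ℝ (stokeslet x F) (w x) : ℝ) = (1 / (4 * Real.pi)) *
      (F 0 * stokesletPairing 0 (fun i x => w x i) + F 1 * stokesletPairing 1 (fun i x => w x i)) := by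
  have hl := fun i => (hw i).integrable_mul locallyIntegrable_logKernel
  have hg := fun i j => ((hw i).coord_mul j).integrable_mul (locallyIntegrable_gradLogKernel i)
  have hS : ∀ j, stokesletPairing j (fun i x => w x i) = ∫ x, (-(logKernel x * w x j) +
      (gradLogKernel 0 x * (x j * w x 0) + gradLogKernel 1 x * (x j * w x 1))) := fun j => by
    unfold stokesletPairing
    rw [← integral_neg, ← integral_add (hg 0 j) (hg 1 j)]
    exact (integral_add (hl j).neg ((hg 0 j).add (hg 1 j))).symm
  have hSi : ∀ j, Integrable fun x => (-(logKernel x * w x j) +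
      (gradLogKernel 0 x * (x j * w x 0) + gradLogKernel 1 x * (x j * w x 1))) := fun j =>
    (hl j).neg.add ((hg 0 j).add (hg 1 j))
  rw [hS, hS, ← integral_const_mul, ← integral_const_mul, ← integral_add ((hSi 0).const_mul _)
    ((hSi 1).const_mul _), ← integral_const_mul]
  exact integral_congr_ae (Eventually.of_forall fun x => inner_stokeslet_eq x F (w x))

theorem isTest_component {φ : Plane → Plane} (h : ContDiff ℝ ∞ φ) (hc : HasCompactSupport φ)
    (i : Fin 2) : IsTest fun x => φ x i :=
  ⟨(coordinate i).contDiff.comp h, hc.comp_left (g := fun v : Plane => v i) rfl⟩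

theorem laplacian_eq_lap {ψ : Plane → ℝ} (h : ContDiff ℝ ∞ ψ) (x : Plane) :
    Laplacian.laplacian ψ x = lap ψ x := by
  rw [InnerProductSpace.laplacian_eq_iteratedFDeriv_orthonormalBasis ψ
    (EuclideanSpace.basisFun (Fin 2) ℝ)]
  have hd : DifferentiableAt ℝ (fderiv ℝ ψ) x :=
    (h.fderiv_right (m := ∞) (by simp)).differentiable (by simp) x
  have e : ∀ i, partialD i (partialD i ψ) x = fderiv ℝ (fderiv ℝ ψ) x
      (EuclideanSpace.single i 1) (EuclideanSpace.single i 1) := fun i => by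
    have := (hd.hasFDerivAt.clm_apply
      (hasFDerivAt_const (EuclideanSpace.single i (1 : ℝ)) x)).fderiv
    unfold partialD
    rw [this]
    simp
  simp [Fin.sum_univ_two, iteratedFDeriv_two_apply, lap, e]

theorem laplacian_component {φ : Plane → Plane} (h : ContDiff ℝ ∞ φ) (x : Plane) (i : Fin 2) :
    Laplacian.laplacian φ x i = lap (fun x => φ x i) x := by
  rw [← laplacian_eq_lap (ψ := fun x => φ x i) ((coordinate i).contDiff.comp h)]
  exact (ContDiffAt.laplacian_CLM_comp_left (l := coordinate i)
    ((h.of_le (by exact WithTop.coe_le_coe.2 le_top)).contDiffAt)).symm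

theorem divergence_eq_partialD {φ : Plane → Plane} (h : ContDiff ℝ ∞ φ) (x : Plane) :
    divergence φ x = partialD 0 (fun x => φ x 0) x + partialD 1 (fun x => φ x 1) x := by
  have hd : DifferentiableAt ℝ φ x := h.differentiable (by simp) x
  have e : ∀ i, partialD i (fun x => φ x i) x = (fderiv ℝ φ x (EuclideanSpace.single i 1)) i :=
    fun i => by
      have e : fderiv ℝ (fun x => φ x i) x = (coordinate i).comp (fderiv ℝ φ x) :=
        ((coordinate i).hasFDerivAt.comp x hd.hasFDerivAt).fderiv
      unfold partialD
      rw [e]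
      rfl
  rw [divergence, Fin.sum_univ_two, e, e]

/-- After translating `y` to the origin, the divergence term left by the velocity pairing is
cancelled by the pressure kernel, and only `F · φ(y)` remains. -/
theorem stokes_fundamental_solution {φ : Plane → Plane} (h : ContDiff ℝ ∞ φ)
    (hc : HasCompactSupport φ) (F y : Plane) :
    -(∫ x, (inner ℝ (stokeslet (x - y) F) (Laplacian.laplacian φ x) : ℝ)) -
      ∫ x, (inner ℝ (pressureKernel (x - y)) F : ℝ) * divergence φ x = inner ℝ F (φ y) := by
  set η : Fin 2 → Plane → ℝ := fun i x => φ (x + y) i with hη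
  have hηt : ∀ i, IsTest (η i) := fun i => (isTest_component h hc i).comp_add y
  have hlapη : ∀ i x, Laplacian.laplacian φ (x + y) i = lap (η i) x := fun i x => by
    rw [laplacian_component h, hη, lap_comp_add (fun x => φ x i) y]
  have hdivη : ∀ x, divergence φ (x + y) = partialD 0 (η 0) x + partialD 1 (η 1) x := fun x => by
    rw [divergence_eq_partialD h, hη, partialD_comp_add (fun x => φ x 0) y,
      partialD_comp_add (fun x => φ x 1) y]
  rw [← integral_add_right_eq_self _ y,
    ← integral_add_right_eq_self (fun x => (inner ℝ (pressureKernel (x - y)) F : ℝ) *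
      divergence φ x) y]
  simp only [add_sub_cancel_right]
  have hw : ∀ i, IsTest fun x => Laplacian.laplacian φ (x + y) i := fun i => by
    simp only [hlapη]
    exact (hηt i).lap
  rw [integral_inner_stokeslet hw]
  have hpair : ∀ j, stokesletPairing j (fun i x => Laplacian.laplacian φ (x + y) i) =
      stokesletPairing j fun i => lap (η i) := fun j => by
    congr 1
    ext i x
    exact hlapη i x
  rw [hpair, hpair, stokesletPairing_lap hηt, stokesletPairing_lap hηt]
  have hdt : IsTest fun x => partialD 0 (η 0) x + partialD 1 (η 1) x :=
    ((hηt 0).partialD 0).add ((hηt 1).partialD 1)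
  have hp : ∫ x, (inner ℝ (pressureKernel x) F : ℝ) * divergence φ (x + y) =
      (1 / (2 * Real.pi)) * (F 0 * (∫ x, gradLogKernel 0 x *
        (partialD 0 (η 0) x + partialD 1 (η 1) x)) + F 1 * ∫ x, gradLogKernel 1 x *
        (partialD 0 (η 0) x + partialD 1 (η 1) x)) := by
    have hi := fun j => hdt.integrable_mul (locallyIntegrable_gradLogKernel j)
    rw [← integral_const_mul, ← integral_const_mul, ← integral_add ((hi 0).const_mul _)
      ((hi 1).const_mul _), ← integral_const_mul]
    refine integral_congr_ae (Eventually.of_forall fun x => ?_)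
    simp only
    rw [inner_pressureKernel_eq, hdivη]
    ring
  rw [hp]
  simp only [hη, zero_add, PiLp.inner_apply, Fin.sum_univ_two, RCLike.inner_apply, conj_trivial]
  have := Real.pi_ne_zero
  field_simp
  ring

theorem stokeslet_divergence_free {ψ : Plane → ℝ} (h : IsTest ψ) (F y : Plane) :
    ∫ x, fderiv ℝ ψ x (stokeslet (x - y) F) = 0 := by
  rw [← integral_add_right_eq_self _ y]
  simp only [add_sub_cancel_right]
  have hη := h.comp_add y
  set η : Plane → ℝ := fun x => ψ (x + y) with hηd
  set w : Plane → Plane := fun x => WithLp.toLp 2 fun i => partialD i η x with hw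
  have e : ∀ x, fderiv ℝ ψ (x + y) (stokeslet x F) = inner ℝ (stokeslet x F) (w x) := fun x => by
    set v := stokeslet x F
    have hv : v = v 0 • EuclideanSpace.single 0 (1 : ℝ) + v 1 • EuclideanSpace.single 1 (1 : ℝ) := by
      ext k
      fin_cases k <;> simp
    conv_lhs => rw [hv]
    rw [map_add, map_smul, map_smul]
    have hp : ∀ i, fderiv ℝ ψ (x + y) (EuclideanSpace.single i 1) = partialD i η x := fun i => by
      rw [hηd, partialD_comp_add]; rfl
    rw [hp, hp]
    simp [PiLp.inner_apply, Fin.sum_univ_two, hw, mul_comm]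
  simp only [e]
  rw [integral_inner_stokeslet (w := w) (fun i => hη.partialD i)]
  have hpair : ∀ j, stokesletPairing j (fun i x => w x i) = 0 := fun j => stokesletPairing_grad hη j
  rw [hpair, hpair]
  simp

/-! ### The single layer potentials solve the Stokes equations -/

theorem locallyIntegrable_weight :
    LocallyIntegrable (fun z : Plane => 1 + ‖z‖ + ‖z‖⁻¹) volume :=
  (by fun_prop : Continuous fun z : Plane => 1 + ‖z‖).locallyIntegrable.add
    locallyIntegrable_norm_inv

/-- The majorant for Fubini is integrated first in `x`: by translation invariance that integral is a
constant times `|Y'' s|`, so integrability of `Y''` suffices and well-stretchedness plays no role.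
-/
theorem IsH2Curve.integrable_prod {Y : ℝ → Plane} (hY : IsH2Curve Y) {Φ : Plane × ℝ → ℝ}
    (hΦ : Measurable Φ) {θ : Plane → ℝ} {C R : ℝ} (hC : ∀ x, θ x ≤ C) (h0 : ∀ x, 0 ≤ θ x)
    (hR : ∀ x, R < ‖x‖ → θ x = 0)
    (hle : ∀ x s, |Φ (x, s)| ≤ (1 + ‖x - Y s‖ + ‖x - Y s‖⁻¹) * ‖secondDeriv Y s‖ * θ x) :
    Integrable Φ ((volume : Measure Plane).prod (volume.restrict (Ioc 0 (2 * Real.pi)))) := by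
  obtain ⟨B, hB0, hB⟩ := hY.exists_norm_le
  -- With `|x| ≤ R` and `|Y s| ≤ B`, the difference `x - Y s` stays in this ball.
  set h : Plane → ℝ := (Metric.closedBall 0 (R + B)).indicator
    fun z : Plane => 1 + ‖z‖ + ‖z‖⁻¹ with hh
  have hhm : Measurable h := Measurable.indicator (by fun_prop) Metric.isClosed_closedBall.measurableSet
  have hhi : Integrable h :=
    (locallyIntegrable_weight.integrableOn_isCompact (isCompact_closedBall _ _)).integrable_indicator
      Metric.isClosed_closedBall.measurableSet
  have hh0 : ∀ z, 0 ≤ h z := fun z => indicator_nonneg (fun _ _ => by positivity) z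
  have hYc := hY.continuous
  have hm2 := measurable_secondDeriv Y
  have hYi : IntegrableOn (secondDeriv Y) (Ioc 0 (2 * Real.pi)) := (hY.integrable _ _).1
  have hdom : Integrable (fun q : Plane × ℝ => C * (h (q.1 - Y q.2) * ‖secondDeriv Y q.2‖))
      ((volume : Measure Plane).prod (volume.restrict (Ioc 0 (2 * Real.pi)))) := by
    refine Integrable.const_mul ?_ C
    have hm : Measurable fun q : Plane × ℝ => h (q.1 - Y q.2) * ‖secondDeriv Y q.2‖ := by fun_prop
    rw [integrable_prod_iff' hm.aestronglyMeasurable]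
    refine ⟨Eventually.of_forall fun s => (hhi.comp_sub_right (Y s)).mul_const ‖secondDeriv Y s‖, ?_⟩
    have e : ∀ s, ∫ x, ‖h (x - Y s) * ‖secondDeriv Y s‖‖ = (∫ x, h x) * ‖secondDeriv Y s‖ := by
      intro s
      have : ∀ x, ‖h (x - Y s) * ‖secondDeriv Y s‖‖ = h (x - Y s) * ‖secondDeriv Y s‖ := fun x =>
        Real.norm_of_nonneg (mul_nonneg (hh0 _) (norm_nonneg _))
      simp only [this]
      rw [integral_mul_const, integral_sub_right_eq_self]
    simp only [e]
    exact hYi.norm.const_mul _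
  refine hdom.mono' hΦ.aestronglyMeasurable (Eventually.of_forall fun ⟨x, s⟩ => ?_)
  have hC0 : 0 ≤ C := (h0 x).trans (hC x)
  refine (hle x s).trans ?_
  rcases lt_or_ge R ‖x‖ with hx | hx
  · rw [hR x hx, mul_zero]
    exact mul_nonneg hC0 (mul_nonneg (hh0 _) (norm_nonneg _))
  · have hmem : x - Y s ∈ Metric.closedBall (0 : Plane) (R + B) := by
      rw [mem_closedBall_zero_iff]
      exact (norm_sub_le _ _).trans (add_le_add hx (hB s))
    simp only [hh]
    rw [indicator_of_mem hmem, mul_comm C]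
    gcongr
    exact hC x

theorem exists_bound_and_radius {w : Plane → Plane} (hw : Continuous w)
    (hc : HasCompactSupport w) : ∃ C R, (∀ x, ‖w x‖ ≤ C) ∧ ∀ x, R < ‖x‖ → ‖w x‖ = 0 := by
  obtain ⟨C, hC⟩ := hc.exists_bound_of_continuous hw
  obtain ⟨R, hR⟩ := hc.isBounded.subset_closedBall 0
  refine ⟨C, R, hC, fun x hx => ?_⟩
  rw [norm_eq_zero]
  by_contra hne
  have := hR (subset_tsupport w hne)
  rw [mem_closedBall_zero_iff] at this
  linarith

theorem norm_stokeslet_apply_le_weight (z F : Plane) :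
    ‖stokeslet z F‖ ≤ (1 + ‖z‖ + ‖z‖⁻¹) * ‖F‖ := by
  refine (norm_stokeslet_apply_le_log z F).trans
    (mul_le_mul_of_nonneg_right ?_ (norm_nonneg _))
  linarith [abs_log_le (norm_nonneg z)]

theorem IsH2Curve.integrable_prod_stokeslet {Y : ℝ → Plane} (hY : IsH2Curve Y) {w : Plane → Plane}
    (hw : Continuous w) (hc : HasCompactSupport w) :
    Integrable (fun q : Plane × ℝ => (inner ℝ (stokeslet (q.1 - Y q.2) (secondDeriv Y q.2)) (w q.1) : ℝ))
      ((volume : Measure Plane).prod (volume.restrict (Ioc 0 (2 * Real.pi)))) := by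
  obtain ⟨C, R, hC, hR⟩ := exists_bound_and_radius hw hc
  have hYc := hY.continuous
  have hm2 := measurable_secondDeriv Y
  have hm : Measurable fun q : Plane × ℝ => stokeslet (q.1 - Y q.2) (secondDeriv Y q.2) :=
    measurable_stokeslet_apply (by fun_prop) (by fun_prop)
  refine hY.integrable_prod (hm.inner (by fun_prop)) hC (fun _ => norm_nonneg _) hR fun x s => ?_
  refine (abs_real_inner_le_norm _ _).trans ?_
  gcongr
  exact norm_stokeslet_apply_le_weight _ _

theorem IsH2Curve.integral_inner_velocityOf {Y : ℝ → Plane} (hY : IsH2Curve Y)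
    (hws : WellStretched Y) {w : Plane → Plane} (hw : Continuous w) (hc : HasCompactSupport w) :
    IntervalIntegrable (fun s => ∫ x, (inner ℝ (stokeslet (x - Y s) (secondDeriv Y s)) (w x) : ℝ))
      volume 0 (2 * Real.pi) ∧
    ∫ x, (inner ℝ (velocityOf Y x) (w x) : ℝ) = ∫ s in (0 : ℝ)..(2 * Real.pi),
      ∫ x, (inner ℝ (stokeslet (x - Y s) (secondDeriv Y s)) (w x) : ℝ) := by
  have hi := hY.integrable_prod_stokeslet hw hc
  refine ⟨?_, ?_⟩
  · rw [intervalIntegrable_iff_integrableOn_Ioc_of_le Real.two_pi_pos.le]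
    exact hi.integral_prod_right
  · rw [intervalIntegral.integral_of_le Real.two_pi_pos.le, ← integral_integral_swap hi]
    refine integral_congr_ae (Eventually.of_forall fun x => ?_)
    have hx := (hY.integrable_stokeslet hws x).1
    simp only [velocityOf]
    rw [intervalIntegral.integral_of_le Real.two_pi_pos.le, real_inner_comm, ← integral_inner hx]
    simp only [real_inner_comm]

theorem IsH2Curve.integrable_prod_pressure {Y : ℝ → Plane} (hY : IsH2Curve Y) {θ : Plane → ℝ}
    (hθ : Measurable θ) {C R : ℝ} (hC : ∀ x, |θ x| ≤ C) (hR : ∀ x, R < ‖x‖ → |θ x| = 0) :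
    Integrable (fun q : Plane × ℝ =>
      (inner ℝ (pressureKernel (q.1 - Y q.2)) (secondDeriv Y q.2) : ℝ) * θ q.1)
      ((volume : Measure Plane).prod (volume.restrict (Ioc 0 (2 * Real.pi)))) := by
  have hYc := hY.continuous
  have hm2 := measurable_secondDeriv Y
  have hm : Measurable fun q : Plane × ℝ =>
      (inner ℝ (pressureKernel (q.1 - Y q.2)) (secondDeriv Y q.2) : ℝ) :=
    measurable_inner_pressureKernel (by fun_prop) (by fun_prop)
  refine hY.integrable_prod (hm.mul (by fun_prop)) hC (fun _ => abs_nonneg _) hR fun x s => ?_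
  rw [abs_mul]
  gcongr
  refine (abs_inner_pressureKernel_le _ _).trans ?_
  gcongr
  linarith [norm_nonneg (x - Y s)]

/-- The multiplier `θ` is only measurable, bounded and zero outside a ball. This covers divergences
of test fields in the momentum equation, and indicators of balls for local integrability of the
pressure. -/
theorem IsH2Curve.integral_pressureOf {Y : ℝ → Plane} (hY : IsH2Curve Y) {θ : Plane → ℝ}
    (hθ : Measurable θ) {C R : ℝ} (hC : ∀ x, |θ x| ≤ C) (hR : ∀ x, R < ‖x‖ → |θ x| = 0) :
    IntervalIntegrable (fun s => ∫ x,
      (inner ℝ (pressureKernel (x - Y s)) (secondDeriv Y s) : ℝ) * θ x) volume 0 (2 * Real.pi) ∧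
    Integrable (fun x => pressureOf Y x * θ x) ∧
    ∫ x, pressureOf Y x * θ x = ∫ s in (0 : ℝ)..(2 * Real.pi),
      ∫ x, (inner ℝ (pressureKernel (x - Y s)) (secondDeriv Y s) : ℝ) * θ x := by
  have hi := hY.integrable_prod_pressure hθ hC hR
  have e : ∀ x, pressureOf Y x * θ x = ∫ s in Ioc 0 (2 * Real.pi),
      (inner ℝ (pressureKernel (x - Y s)) (secondDeriv Y s) : ℝ) * θ x := fun x => by
    rw [integral_mul_const, pressureOf, intervalIntegral.integral_of_le Real.two_pi_pos.le]
  refine ⟨?_, ?_, ?_⟩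
  · rw [intervalIntegrable_iff_integrableOn_Ioc_of_le Real.two_pi_pos.le]
    exact hi.integral_prod_right
  · simp only [e]
    exact hi.integral_prod_left
  · simp only [e]
    rw [intervalIntegral.integral_of_le Real.two_pi_pos.le]
    exact integral_integral_swap (f := fun x s =>
      (inner ℝ (pressureKernel (x - Y s)) (secondDeriv Y s) : ℝ) * θ x) hi

theorem IsH2Curve.locallyIntegrable_pressureOf {Y : ℝ → Plane} (hY : IsH2Curve Y) :
    LocallyIntegrable (pressureOf Y) volume := by
  intro x
  refine ⟨Metric.ball x 1, Metric.ball_mem_nhds x one_pos, ?_⟩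
  rw [← integrable_indicator_iff Metric.isOpen_ball.measurableSet]
  have := (hY.integral_pressureOf (θ := (Metric.ball x 1).indicator fun _ => (1 : ℝ))
    (measurable_const.indicator Metric.isOpen_ball.measurableSet) (C := 1) (R := ‖x‖ + 1)
    (fun y => by
      by_cases h : y ∈ Metric.ball x 1
      · rw [indicator_of_mem h]; simp
      · rw [indicator_of_notMem h]; simp)
    (fun y hy => by
      rw [indicator_of_notMem, abs_zero]
      intro h
      rw [mem_ball_iff_norm] at h
      linarith [norm_sub_norm_le y x])).2.1
  refine this.congr (Eventually.of_forall fun y => ?_)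
  by_cases h : y ∈ Metric.ball x 1
  · simp [indicator_of_mem h]
  · simp [indicator_of_notMem h]

theorem continuous_hasCompactSupport_of_components {w : Plane → Plane}
    (h : ∀ i, IsTest fun x => w x i) : Continuous w ∧ HasCompactSupport w := by
  refine ⟨?_, ?_⟩
  · have : w = fun x => WithLp.toLp 2 fun i => w x i := by ext x i; rfl
    rw [this]
    exact (PiLp.continuous_toLp 2 (fun _ : Fin 2 => ℝ)).comp
      (continuous_pi fun i => (h i).continuous)
  · refine HasCompactSupport.intro ((h 0).compact.isCompact.union (h 1).compact.isCompact)
      fun x hx => ?_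
    rw [mem_union, not_or] at hx
    ext i
    fin_cases i
    · exact image_eq_zero_of_notMem_tsupport (f := fun x => w x 0) hx.1
    · exact image_eq_zero_of_notMem_tsupport (f := fun x => w x 1) hx.2

theorem isTest_laplacian_component {φ : Plane → Plane} (h : ContDiff ℝ ∞ φ)
    (hc : HasCompactSupport φ) (i : Fin 2) : IsTest fun x => Laplacian.laplacian φ x i := by
  simp only [laplacian_component h]
  exact (isTest_component h hc i).lap

theorem isTest_divergence {φ : Plane → Plane} (h : ContDiff ℝ ∞ φ)
    (hc : HasCompactSupport φ) : IsTest (divergence φ) := by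
  have : divergence φ = fun x => partialD 0 (fun x => φ x 0) x + partialD 1 (fun x => φ x 1) x :=
    funext (divergence_eq_partialD h)
  rw [this]
  exact ((isTest_component h hc 0).partialD 0).add ((isTest_component h hc 1).partialD 1)

theorem IsTest.exists_bound_and_radius {θ : Plane → ℝ} (h : IsTest θ) :
    ∃ C R, (∀ x, |θ x| ≤ C) ∧ ∀ x, R < ‖x‖ → |θ x| = 0 := by
  obtain ⟨C, hC⟩ := h.compact.exists_bound_of_continuous h.continuous
  obtain ⟨R, hR⟩ := h.compact.isBounded.subset_closedBall 0
  refine ⟨C, R, hC, fun x hx => ?_⟩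
  rw [abs_eq_zero]
  by_contra hne
  have := hR (subset_tsupport θ hne)
  rw [mem_closedBall_zero_iff] at this
  linarith

/-- The gradient of a test function, as a vector field. -/
def gradField (ψ : Plane → ℝ) (x : Plane) : Plane := WithLp.toLp 2 fun i => partialD i ψ x

theorem fderiv_apply_eq_inner (ψ : Plane → ℝ) (x v : Plane) :
    fderiv ℝ ψ x v = inner ℝ v (gradField ψ x) := by
  have hv : v = v 0 • EuclideanSpace.single 0 (1 : ℝ) + v 1 • EuclideanSpace.single 1 (1 : ℝ) := by
    ext k
    fin_cases k <;> simp
  conv_lhs => rw [hv]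
  rw [map_add, map_smul, map_smul]
  simp [PiLp.inner_apply, Fin.sum_univ_two, gradField, partialD, mul_comm]

/-- The single layer potentials solve the Stokes equations. -/
theorem IsH2Curve.isStokesFlow {Y : ℝ → Plane} (hY : IsH2Curve Y) (hws : WellStretched Y) :
    IsStokesFlow Y (velocityOf Y) (pressureOf Y) where
  continuous_u := hY.continuous_velocityOf hws
  locallyIntegrable_p := hY.locallyIntegrable_pressureOf
  momentum := fun φ h hc => by
    obtain ⟨hwc, hws'⟩ := continuous_hasCompactSupport_of_components (isTest_laplacian_component h hc)
    have hdt := isTest_divergence h hc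
    obtain ⟨C, R, hC, hR⟩ := hdt.exists_bound_and_radius
    obtain ⟨i1, e1⟩ := hY.integral_inner_velocityOf hws hwc hws'
    obtain ⟨i2, -, e2⟩ := hY.integral_pressureOf hdt.continuous.measurable hC hR
    rw [e1, e2, ← intervalIntegral.integral_neg]
    refine (intervalIntegral.integral_sub i1.neg i2).symm.trans ?_
    exact intervalIntegral.integral_congr fun s _ => stokes_fundamental_solution h hc _ _
  incompressible := fun ψ h hc => by
    have ht : IsTest ψ := ⟨h, hc⟩
    obtain ⟨hwc, hws'⟩ := continuous_hasCompactSupport_of_components (w := gradField ψ)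
      fun i => ht.partialD i
    simp only [fderiv_apply_eq_inner]
    rw [(hY.integral_inner_velocityOf hws hwc hws').2]
    simp only [← fderiv_apply_eq_inner, stokeslet_divergence_free ht]
    simp
  decay_u := hY.tendsto_velocityOf hws
  decay_p := hY.tendsto_pressureOf.mono_left inf_le_left

/-! ### Uniqueness of decaying Stokes flows -/

theorem hasDerivAt_comp_line {f : Plane → ℝ} (hf : Differentiable ℝ f) (j : Fin 2) (x : Plane) (t : ℝ) :
    HasDerivAt (fun t : ℝ => f (x + t • EuclideanSpace.single j 1))
      (partialD j f (x + t • EuclideanSpace.single j 1)) t := by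
  have h1 : HasDerivAt (fun t : ℝ => x + t • EuclideanSpace.single j (1 : ℝ))
      (EuclideanSpace.single j 1) t := by
    simpa using ((hasDerivAt_id t).smul_const (EuclideanSpace.single j (1 : ℝ))).const_add x
  exact (hf _).hasFDerivAt.comp_hasDerivAt t h1

/-- Were it positive, the restriction to a line would also have a local minimum there. It would then
be locally constant, with zero second derivative. -/
theorem partialD_partialD_nonpos_of_isLocalMax {f : Plane → ℝ} (hf : Differentiable ℝ f)
    {j : Fin 2} (hf' : Differentiable ℝ (partialD j f)) {x : Plane} (h : IsLocalMax f x) :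
    partialD j (partialD j f) x ≤ 0 := by
  by_contra! hpos
  set g : ℝ → ℝ := fun t => f (x + t • EuclideanSpace.single j 1) with hg
  have hd : deriv g = fun t => partialD j f (x + t • EuclideanSpace.single j 1) :=
    funext fun t => (hasDerivAt_comp_line hf j x t).deriv
  have hdd : deriv (deriv g) 0 = partialD j (partialD j f) x := by
    rw [hd]
    simpa using (hasDerivAt_comp_line hf' j x 0).deriv
  have hc : ContinuousAt g 0 := (hasDerivAt_comp_line hf j x 0).continuousAt
  have hmax : IsLocalMax g 0 := by
    have ht : Tendsto (fun t : ℝ => x + t • EuclideanSpace.single j (1 : ℝ)) (𝓝 0) (𝓝 x) := by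
      have : Continuous fun t : ℝ => x + t • EuclideanSpace.single j (1 : ℝ) := by fun_prop
      simpa using this.tendsto 0
    filter_upwards [ht.eventually h] with t ht
    simpa [hg] using ht
  have hmin : IsLocalMin g 0 :=
    isLocalMin_of_deriv_deriv_pos (by rw [hdd]; exact hpos) hmax.deriv_eq_zero hc
  have hconst : g =ᶠ[𝓝 0] fun _ => g 0 := by
    filter_upwards [hmax, hmin] with t h1 h2 using le_antisymm h1 h2
  have := hconst.deriv.deriv.eq_of_nhds
  rw [hdd] at this
  simp at this
  linarith

theorem differentiable_partialD {f : Plane → ℝ} (hf : ContDiff ℝ 2 f) (j : Fin 2) :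
    Differentiable ℝ (partialD j f) :=
  ((hf.fderiv_right (m := 1) (by norm_num)).clm_apply contDiff_const).differentiable (by norm_num)

theorem exists_radius_of_eventually_cocompact {P : Plane → Prop}
    (h : ∀ᶠ x in cocompact Plane, P x) : ∃ r : ℝ, 0 < r ∧ ∀ x, r ≤ ‖x‖ → P x := by
  rw [← Metric.cobounded_eq_cocompact, ← comap_norm_atTop] at h
  obtain ⟨r, hr⟩ := eventually_atTop.1 (eventually_comap.1 h)
  exact ⟨max r 1, by positivity, fun x hx => hr _ ((le_max_left _ _).trans hx) x rfl⟩

/-- Weak maximum principle: adding `δ |x|²` makes the Laplacian strictly positive, which rules out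
an interior maximum, while decay makes the boundary values too small for a maximum there. -/
theorem nonpos_of_lap_eq_zero {f : Plane → ℝ} (hf : ContDiff ℝ 2 f) (hl : ∀ x, lap f x = 0)
    (h0 : Tendsto f (cocompact Plane) (𝓝 0)) (x₀ : Plane) : f x₀ ≤ 0 := by
  by_contra! hpos
  have hev : ∀ᶠ x in cocompact Plane, f x < f x₀ / 2 := h0.eventually_lt_const (by linarith)
  obtain ⟨r, hr0, hr⟩ := exists_radius_of_eventually_cocompact hev
  have hx₀ : ‖x₀‖ < r := by
    by_contra! h
    linarith [hr x₀ h]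
  -- On the sphere of radius `r` the perturbation equals `f x₀ / 4`, so there the sum stays below `3
  -- f x₀ / 4`. The `0 ^ 2` in `g` matches the regularised norm with `ε = 0`.
  set δ : ℝ := f x₀ / (4 * r ^ 2) with hδ
  have hδ0 : 0 < δ := by positivity
  have hδr : δ * r ^ 2 = f x₀ / 4 := by rw [hδ]; field_simp
  set g : Plane → ℝ := fun x => f x + δ * (‖x‖ ^ 2 + 0 ^ 2) with hg
  have hn2 : ContDiff ℝ 2 fun x : Plane => δ * (‖x‖ ^ 2 + 0 ^ 2) :=
    contDiff_const.mul (contDiff_norm_sq_add 0)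
  have hgc : ContDiff ℝ 2 g := hf.add hn2
  obtain ⟨m, hm, hmax⟩ := (isCompact_closedBall (0 : Plane) r).exists_isMaxOn
    ⟨0, by simpa using hr0.le⟩ hgc.continuous.continuousOn
  have hgm : f x₀ ≤ g m := by
    have h1 : g x₀ ≤ g m := hmax (by simpa using hx₀.le)
    have h2 : f x₀ ≤ g x₀ := by simp only [hg]; nlinarith [sq_nonneg ‖x₀‖]
    linarith
  have hmr : ‖m‖ < r := by
    rw [mem_closedBall_zero_iff] at hm
    refine hm.lt_of_ne fun h => ?_
    have := hr m h.ge
    simp only [hg, h] at hgm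
    linarith
  have hloc : IsLocalMax g m :=
    hmax.isLocalMax (mem_of_superset (Metric.isOpen_ball.mem_nhds (by simpa using hmr))
      Metric.ball_subset_closedBall)
  have e1 : ∀ j, partialD j g = fun x => partialD j f x + δ * (2 * x j) := fun j => by
    ext1 x
    rw [hg, partialD_add (hf.differentiable (by norm_num) x)
      (hn2.differentiable (by norm_num) x), partialD_mul (differentiableAt_const _)
      ((contDiff_norm_sq_add 0 (n := 1)).differentiable (by norm_num) x), partialD_norm_sq_add]
    simp [partialD]
  have hlin : ∀ j : Fin 2, Differentiable ℝ fun x : Plane => δ * (2 * x j) := fun j =>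
    ((contDiff_const.mul (contDiff_const.mul (contDiff_coord j))) :
      ContDiff ℝ 1 fun x : Plane => δ * (2 * x j)).differentiable (by norm_num)
  have e2 : ∀ j, partialD j (partialD j g) m = partialD j (partialD j f) m + δ * 2 := fun j => by
    rw [e1, partialD_add (differentiable_partialD hf j m) (hlin j m)]
    congr 1
    have := (((hasFDerivAt_coord j m).const_mul 2).const_mul δ).fderiv
    simp only [partialD]
    rw [this]
    simp [coordinate_apply]
  have h2 := fun j => partialD_partialD_nonpos_of_isLocalMax (hgc.differentiable (by norm_num))
    (differentiable_partialD hgc j) hloc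
  have h20 := h2 0
  have h21 := h2 1
  rw [e2] at h20 h21
  have := hl m
  rw [lap] at this
  linarith

theorem lap_neg (f : Plane → ℝ) (x : Plane) : lap (fun x => -f x) x = -lap f x := by
  have e : ∀ (f : Plane → ℝ) j, partialD j (fun x => -f x) = fun x => -partialD j f x :=
    fun f j => by
      ext1 x
      simp [partialD, fderiv_fun_neg]
  simp only [lap, e]
  ring

theorem eq_zero_of_lap_eq_zero {f : Plane → ℝ} (hf : ContDiff ℝ 2 f) (hl : ∀ x, lap f x = 0)
    (h0 : Tendsto f (cocompact Plane) (𝓝 0)) (x : Plane) : f x = 0 := by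
  refine le_antisymm (nonpos_of_lap_eq_zero hf hl h0 x) ?_
  have := nonpos_of_lap_eq_zero hf.neg (fun x => by rw [lap_neg, hl, neg_zero])
    (by simpa using h0.neg) x
  linarith

theorem IsTest.comp_sub_left {ψ : Plane → ℝ} (h : IsTest ψ) (x : Plane) :
    IsTest fun t => ψ (x - t) :=
  ⟨h.smooth.comp (contDiff_const.sub contDiff_id),
    h.compact.comp_homeomorph (Homeomorph.subLeft x)⟩

theorem lap_comp_sub_left {ψ : Plane → ℝ} (h : IsTest ψ) (x t : Plane) :
    lap (fun t => ψ (x - t)) t = lap ψ (x - t) := by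
  have e : ∀ {χ : Plane → ℝ}, IsTest χ → ∀ j,
      partialD j (fun t => χ (x - t)) = fun t => -partialD j χ (x - t) := fun {χ} hχ j => by
    ext1 t
    have := ((hχ.differentiableAt (x - t)).hasFDerivAt.comp t
      ((hasFDerivAt_id t).const_sub x)).fderiv
    simp only [partialD]
    rw [Function.comp_def] at this
    rw [this]
    simp
  have e' : ∀ {χ : Plane → ℝ}, IsTest χ → ∀ j,
      partialD j (fun t => -χ (x - t)) = fun t => partialD j χ (x - t) := fun {χ} hχ j => by
    have := e (hχ.const_mul (-1)) j
    simp only [neg_mul, one_mul] at this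
    rw [this]
    ext1 t
    simp [partialD, fderiv_fun_neg]
  simp only [lap, e h, e' (h.partialD _)]

/-! ### Mollification and Liouville's theorem for weakly harmonic functions. -/

open scoped Convolution in
theorem partialD_convolution {k ψ : Plane → ℝ} (hk : LocallyIntegrable k volume) (h : IsTest ψ)
    (j : Fin 2) : partialD j (k ⋆[ContinuousLinearMap.mul ℝ ℝ, volume] ψ) =
      k ⋆[ContinuousLinearMap.mul ℝ ℝ, volume] partialD j ψ := by
  ext1 x
  have := (h.compact.hasFDerivAt_convolution_right (ContinuousLinearMap.mul ℝ ℝ) hk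
    (h.smooth.of_le (by simp)) x).fderiv
  rw [partialD, this]
  exact convolution_precompR_apply _ hk (h.compact.fderiv (𝕜 := ℝ))
    (h.smooth.continuous_fderiv (by simp)) _ _

-- For `x` far out, the support of `ψ (x - ·)` lies where `k` is small almost everywhere. Smoothing
-- thus turns decay outside a null set into genuine decay.
open scoped Convolution in
theorem tendsto_convolution {k ψ : Plane → ℝ} (h : IsTest ψ)
    (h0 : Tendsto k (cocompact Plane ⊓ ae volume) (𝓝 0)) :
    Tendsto (k ⋆[ContinuousLinearMap.mul ℝ ℝ, volume] ψ) (cocompact Plane) (𝓝 0) := by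
  rw [Metric.tendsto_nhds]
  intro ε hε
  set I := ∫ x, |ψ x| with hI
  have hI0 : 0 ≤ I := integral_nonneg fun _ => abs_nonneg _
  have hψi : Integrable ψ := h.continuous.integrable_of_hasCompactSupport h.compact
  have hη : 0 < ε / (I + 1) := by positivity
  have hev := (Metric.tendsto_nhds.1 h0) _ hη
  obtain ⟨s, hs, t, ht, hst⟩ := eventually_inf.1 hev
  obtain ⟨r, -, hr⟩ := exists_radius_of_eventually_cocompact hs
  obtain ⟨C, R, -, hR⟩ := h.exists_bound_and_radius
  have hfar : ∀ᶠ x in cocompact Plane, r + R ≤ ‖x‖ :=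
    (tendsto_norm_cocompact_atTop (E := Plane)).eventually_ge_atTop _
  filter_upwards [hfar] with x hx
  rw [dist_zero_right, convolution_def]
  have hb : ∀ᵐ y, ‖ContinuousLinearMap.mul ℝ ℝ (k y) (ψ (x - y))‖ ≤ ε / (I + 1) * |ψ (x - y)| := by
    filter_upwards [ht] with y hy
    rw [ContinuousLinearMap.mul_apply', norm_mul, Real.norm_eq_abs (ψ _)]
    rcases lt_or_ge R ‖x - y‖ with hxy | hxy
    · rw [hR _ hxy, mul_zero, mul_zero]
    · have := hst y ⟨hr y (by linarith [norm_sub_norm_le x y]), hy⟩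
      rw [dist_zero_right] at this
      gcongr
  calc _ ≤ ∫ y, ε / (I + 1) * |ψ (x - y)| :=
        norm_integral_le_of_norm_le ((hψi.abs.comp_sub_left x).const_mul _) hb
    _ = ε / (I + 1) * I := by
        rw [integral_const_mul, integral_sub_left_eq_self (fun y => |ψ y|) volume x]
    _ < ε := by
        rw [div_mul_eq_mul_div, div_lt_iff₀ (by positivity)]
        nlinarith

/-- A locally integrable function which is harmonic in the sense of distributions and decays at
infinity vanishes almost everywhere. -/
theorem ae_eq_zero_of_weakly_harmonic {k : Plane → ℝ} (hk : LocallyIntegrable k volume)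
    (hl : ∀ ψ, IsTest ψ → ∫ x, k x * lap ψ x = 0)
    (h0 : Tendsto k (cocompact Plane ⊓ ae volume) (𝓝 0)) : ∀ᵐ x, k x = 0 := by
  refine ae_eq_zero_of_integral_contDiff_smul_eq_zero hk fun g hg hgc => ?_
  have hgt : IsTest g := ⟨hg, hgc⟩
  -- The reflection makes the value at `0` of the convolution equal to `∫ k g`. The convolution is
  -- `C²`, harmonic and decaying, so this value is zero.
  have ht : IsTest fun t => g (-t) := by simpa using hgt.comp_sub_left 0
  have hc := ht.compact.contDiff_convolution_right (n := 2) (ContinuousLinearMap.mul ℝ ℝ) hk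
    (ht.smooth.of_le (by exact WithTop.coe_le_coe.2 le_top))
  have hz := eq_zero_of_lap_eq_zero hc (fun x => by
    rw [lap, partialD_convolution hk ht, partialD_convolution hk ht,
      partialD_convolution hk (ht.partialD 0), partialD_convolution hk (ht.partialD 1)]
    rw [convolution_def, convolution_def]
    simp only [ContinuousLinearMap.mul_apply']
    rw [← integral_add ((((ht.partialD 0).partialD 0).comp_sub_left x).integrable_mul hk)
      ((((ht.partialD 1).partialD 1).comp_sub_left x).integrable_mul hk),
      ← hl _ (ht.comp_sub_left x)]
    refine integral_congr_ae (Eventually.of_forall fun t => ?_)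
    simp only
    rw [lap_comp_sub_left ht, lap]
    ring) (tendsto_convolution ht h0) 0
  rw [convolution_def] at hz
  simpa [mul_comm] using hz

theorem lap_partialD {ψ : Plane → ℝ} (h : IsTest ψ) (j : Fin 2) :
    lap (partialD j ψ) = partialD j (lap ψ) := by
  ext1 x
  have a := fun i => (h.partialD i).partialD i
  have e : partialD j (lap ψ) x =
      partialD j (partialD 0 (partialD 0 ψ)) x + partialD j (partialD 1 (partialD 1 ψ)) x :=
    partialD_add ((a 0).differentiableAt x) ((a 1).differentiableAt x) j
  rw [e, lap, partialD_comm h 0 j, partialD_comm h 1 j, partialD_comm (h.partialD 0) 0 j,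
    partialD_comm (h.partialD 1) 1 j]

theorem contDiff_hasCompactSupport_of_components {w : Plane → Plane}
    (h : ∀ i, IsTest fun x => w x i) : ContDiff ℝ ∞ w ∧ HasCompactSupport w :=
  ⟨contDiff_euclidean.2 fun i => (h i).smooth, (continuous_hasCompactSupport_of_components h).2⟩

theorem IsStokesFlow.momentum_sub {Y : ℝ → Plane} {u u' : Plane → Plane} {p p' : Plane → ℝ}
    (h : IsStokesFlow Y u p) (h' : IsStokesFlow Y u' p') {φ : Plane → Plane}
    (hφ : ContDiff ℝ ∞ φ) (hc : HasCompactSupport φ) :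
    (∫ x, (inner ℝ (u x - u' x) (Laplacian.laplacian φ x) : ℝ)) +
      ∫ x, (p x - p' x) * divergence φ x = 0 := by
  obtain ⟨hwc, hws⟩ := continuous_hasCompactSupport_of_components (isTest_laplacian_component hφ hc)
  have hdt := isTest_divergence hφ hc
  have hi : ∀ {v : Plane → Plane}, Continuous v →
      Integrable fun x => (inner ℝ (v x) (Laplacian.laplacian φ x) : ℝ) := fun hv =>
    (hv.inner hwc).integrable_of_hasCompactSupport
      (hws.mono fun x hx hz => hx (by simp only; rw [hz, inner_zero_right]))
  simp only [inner_sub_left, sub_mul]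
  rw [integral_sub (hi h.continuous_u) (hi h'.continuous_u),
    integral_sub (hdt.integrable_mul h.locallyIntegrable_p)
      (hdt.integrable_mul h'.locallyIntegrable_p)]
  linarith [h.momentum φ hφ hc, h'.momentum φ hφ hc]

/-- Test the momentum difference with `∇ψ`. The velocity term pairs with `Δ∇ψ = ∇Δψ` and vanishes by
incompressibility; the pressure term pairs with `div ∇ψ = Δψ`. -/
theorem IsStokesFlow.integral_sub_mul_lap {Y : ℝ → Plane} {u u' : Plane → Plane}
    {p p' : Plane → ℝ} (h : IsStokesFlow Y u p) (h' : IsStokesFlow Y u' p') {ψ : Plane → ℝ}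
    (hψ : IsTest ψ) : ∫ x, (p x - p' x) * lap ψ x = 0 := by
  obtain ⟨hg, hgc⟩ := contDiff_hasCompactSupport_of_components (w := gradField ψ)
    fun i => hψ.partialD i
  obtain ⟨hl, hlc⟩ := contDiff_hasCompactSupport_of_components (w := gradField (lap ψ))
    fun i => hψ.lap.partialD i
  have e := h.momentum_sub h' hg hgc
  have hlap : ∀ x, Laplacian.laplacian (gradField ψ) x = gradField (lap ψ) x := fun x => by
    ext i
    rw [laplacian_component hg]
    exact congrFun (lap_partialD hψ i) x
  have hdiv : ∀ x, divergence (gradField ψ) x = lap ψ x := fun x => divergence_eq_partialD hg x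
  have hi : ∀ {v : Plane → Plane}, Continuous v →
      Integrable fun x => (inner ℝ (v x) (gradField (lap ψ) x) : ℝ) := fun hv =>
    (hv.inner hl.continuous).integrable_of_hasCompactSupport
      (hlc.mono fun x hx hz => hx (by simp only; rw [hz, inner_zero_right]))
  simp only [hlap, hdiv, inner_sub_left] at e
  rw [integral_sub (hi h.continuous_u) (hi h'.continuous_u)] at e
  simp only [← fderiv_apply_eq_inner] at e
  rw [h.incompressible _ hψ.lap.smooth hψ.lap.compact,
    h'.incompressible _ hψ.lap.smooth hψ.lap.compact] at e
  linarith

theorem IsStokesFlow.pressure_unique {Y : ℝ → Plane} {u u' : Plane → Plane}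
    {p p' : Plane → ℝ} (h : IsStokesFlow Y u p) (h' : IsStokesFlow Y u' p') :
    p =ᵐ[volume] p' := by
  have := ae_eq_zero_of_weakly_harmonic (k := fun x => p x - p' x)
    (h.locallyIntegrable_p.sub h'.locallyIntegrable_p)
    (fun ψ hψ => h.integral_sub_mul_lap h' hψ) (by simpa using h.decay_p.sub h'.decay_p)
  filter_upwards [this] with x hx using sub_eq_zero.1 hx

/-- Once the pressures agree, testing with `ψ e_i` shows that each component of the velocity
difference is weakly harmonic. Continuity upgrades almost everywhere equality to equality. -/
theorem IsStokesFlow.velocity_unique {Y : ℝ → Plane} {u u' : Plane → Plane}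
    {p p' : Plane → ℝ} (h : IsStokesFlow Y u p) (h' : IsStokesFlow Y u' p') : u = u' := by
  have hp := h.pressure_unique h'
  have hcw : Continuous fun x => u x - u' x := h.continuous_u.sub h'.continuous_u
  have hdw : Tendsto (fun x => u x - u' x) (cocompact Plane) (𝓝 0) := by
    simpa using h.decay_u.sub h'.decay_u
  have key : ∀ i, (fun x => (u x - u' x) i) = fun _ => 0 := fun i => by
    have hci : Continuous fun x => (u x - u' x) i := (coordinate i).continuous.comp hcw
    refine (hci.ae_eq_iff_eq volume continuous_const).1
      (ae_eq_zero_of_weakly_harmonic hci.locallyIntegrable (fun ψ hψ => ?_) ?_)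
    · have hcomp : ∀ j, (fun x => (ψ x • EuclideanSpace.single i (1 : ℝ) : Plane) j) =
          fun x => (if j = i then 1 else 0) * ψ x := fun j => by
        ext1 x
        by_cases hji : j = i <;> simp [hji]
      obtain ⟨hφ, hφc⟩ := contDiff_hasCompactSupport_of_components
        (w := fun x => ψ x • EuclideanSpace.single i (1 : ℝ))
        fun j => by rw [hcomp]; exact hψ.const_mul _
      have e := h.momentum_sub h' hφ hφc
      have hpz : ∫ x, (p x - p' x) * divergence
          (fun x => ψ x • EuclideanSpace.single i (1 : ℝ)) x = 0 := by
        rw [integral_eq_zero_of_ae]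
        filter_upwards [hp] with x hx
        simp [hx]
      rw [hpz, add_zero] at e
      rw [← e]
      refine integral_congr_ae (Eventually.of_forall fun x => ?_)
      have hlapc : ∀ j, Laplacian.laplacian (fun x => ψ x • EuclideanSpace.single i (1 : ℝ)) x j =
          (if j = i then 1 else 0) * lap ψ x := fun j => by
        rw [laplacian_component hφ, hcomp]
        have e1 : ∀ {χ : Plane → ℝ}, IsTest χ → ∀ (c : ℝ) l,
            partialD l (fun x => c * χ x) = fun x => c * partialD l χ x := fun hχ c l => by
          ext1 x
          simp [partialD, fderiv_const_mul (hχ.differentiableAt x)]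
        simp only [lap, e1 hψ, e1 (hψ.partialD _)]
        ring
      simp only [PiLp.inner_apply, Fin.sum_univ_two, hlapc]
      fin_cases i <;> simp [mul_comm]
    · exact (((coordinate i).continuous.tendsto' 0 0 (map_zero _)).comp hdw).mono_left inf_le_left
  ext x i
  exact sub_eq_zero.1 (congrFun (key i) x)

theorem IsStokesFlow.congr_pressure {Y : ℝ → Plane} {u : Plane → Plane} {p p' : Plane → ℝ}
    (h : IsStokesFlow Y u p) (hp : p =ᵐ[volume] p') : IsStokesFlow Y u p' where
  continuous_u := h.continuous_u
  locallyIntegrable_p := fun x => by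
    obtain ⟨s, hs, hi⟩ := h.locallyIntegrable_p x
    exact ⟨s, hs, hi.congr (ae_restrict_of_ae hp)⟩
  momentum := fun φ hφ hc => by
    rw [← h.momentum φ hφ hc]
    congr 1
    refine integral_congr_ae ?_
    filter_upwards [hp] with x hx
    rw [hx]
  incompressible := h.incompressible
  decay_u := h.decay_u
  decay_p := h.decay_p.congr' (hp.filter_mono inf_le_right)

/-! ### The immersed boundary problem and the contour dynamic formulation -/

/-- The two copies of the half Laplacian cancel identically, whatever its value, leaving the
integral of `Γ₀`. -/
theorem MemH2Torus.evolution_eq {Y : ℝ → Plane} (hY : MemH2Torus Y) (hws : WellStretched Y)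
    (s : ℝ) : opL Y s + gTerm Y s = velocityOf Y (Y s) := by
  rw [hY.isH2Curve.velocityOf_eq_integral_Gamma0 hws, opL, gTerm]
  module

/-- Uniqueness forces any flow in the problem to be the single layer potential, and existence
supplies that flow; the kinematic and contour equations then coincide at each time. -/
theorem isImmersedBoundarySolution_iff {J : Set ℝ} {X : ℝ → ℝ → Plane} {X₀ : ℝ → Plane}
    (hH2 : ∀ t ∈ J, MemH2Torus (X t)) (hws : ∀ t ∈ J, WellStretched (X t))
    {u : ℝ → Plane → Plane} {p : ℝ → Plane → ℝ} :
    IsImmersedBoundarySolution J X X₀ u p ↔ IsContourSolution J X X₀ ∧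
      ∀ t ∈ J, u t = velocityOf (X t) ∧ p t =ᵐ[volume] pressureOf (X t) := by
  have hflow := fun t ht => (hH2 t ht).isH2Curve.isStokesFlow (hws t ht)
  refine ⟨fun h => ?_, fun ⟨h, hup⟩ => ?_⟩
  · have hu : ∀ t ∈ J, u t = velocityOf (X t) := fun t ht =>
      (h.stokes t ht).velocity_unique (hflow t ht)
    refine ⟨⟨fun t ht s => ?_, h.initial⟩, fun t ht =>
      ⟨hu t ht, (h.stokes t ht).pressure_unique (hflow t ht)⟩⟩
    rw [(hH2 t ht).evolution_eq (hws t ht), ← hu t ht]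
    exact h.kinematic t ht s
  · refine ⟨fun t ht => ?_, fun t ht s => ?_, h.initial⟩
    · rw [(hup t ht).1]
      exact (hflow t ht).congr_pressure (hup t ht).2.symm
    · rw [(hup t ht).1, ← (hH2 t ht).evolution_eq (hws t ht)]
      exact h.evolution t ht s

end StokesIB

end

/-! ### The equivalence of the two formulations. -/

theorem proposition1p1
    (J : Set ℝ) (hJ : J ⊆ Set.Ioi 0)
    (X : ℝ → ℝ → StokesIB.Plane) (X₀ : ℝ → StokesIB.Plane)
    (hH2 : ∀ t ∈ J, StokesIB.MemH2Torus (X t))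
    (hws : ∀ t ∈ J, StokesIB.WellStretched (X t)) :
    -- the integrals converge, and the two definitions of the half Laplacian agree
    (∀ t ∈ J,
      (∀ x : StokesIB.Plane, IntervalIntegrable
        (fun r => StokesIB.stokeslet (x - X t r) (StokesIB.secondDeriv (X t) r))
        volume 0 (2 * Real.pi)) ∧
      (∀ x ∉ Set.range (X t), IntervalIntegrable
        (fun r => inner ℝ (StokesIB.pressureKernel (x - X t r)) (StokesIB.secondDeriv (X t) r))
        volume 0 (2 * Real.pi)) ∧
      (∀ s : ℝ, IntervalIntegrable (StokesIB.Gamma0 (X t) s) volume 0 (2 * Real.pi)) ∧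
      (∀ s : ℝ, Tendsto (StokesIB.halfLaplacianTrunc (X t) s) (𝓝[>] (0 : ℝ))
        (𝓝 (StokesIB.halfLaplacian (X t) s))) ∧
      (∀ (s : ℝ) (i : Fin 2), HasSum
        (fun k : ℤ => ((|k| : ℤ) : ℂ) * StokesIB.fourierCoef (X t) i k *
          Complex.exp (Complex.I * (k : ℂ) * (s : ℂ)))
        ((StokesIB.halfLaplacian (X t) s i : ℝ) : ℂ))) ∧
    -- the two formulations of the evolution of the string are equivalent
    ((∃ (u : ℝ → StokesIB.Plane → StokesIB.Plane) (p : ℝ → StokesIB.Plane → ℝ),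
        StokesIB.IsImmersedBoundarySolution J X X₀ u p) ↔
      StokesIB.IsContourSolution J X X₀) ∧
    -- the flow is determined by the string, and is recovered from the fundamental solution
    (∀ (u : ℝ → StokesIB.Plane → StokesIB.Plane) (p : ℝ → StokesIB.Plane → ℝ),
      StokesIB.IsImmersedBoundarySolution J X X₀ u p ↔
        StokesIB.IsContourSolution J X X₀ ∧
          ∀ t ∈ J, u t = StokesIB.velocityOf (X t) ∧
            p t =ᵐ[volume] StokesIB.pressureOf (X t)) := by
  refine ⟨fun t ht => ?_, ?_, fun u p => StokesIB.isImmersedBoundarySolution_iff hH2 hws⟩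
  · have hY := (hH2 t ht).isH2Curve
    have hhalf := StokesIB.tendsto_halfLaplacianTrunc (hH2 t ht).periodic (hH2 t ht).continuous
      fun i => (hH2 t ht).summable_abs_mul_fourierCoef i
    exact ⟨hY.integrable_stokeslet (hws t ht), fun x hx => hY.integrable_pressure hx,
      fun s => hY.integrable_Gamma0 (hws t ht) s _ _, fun s => (hhalf s).1, fun s => (hhalf s).2⟩
  · refine ⟨fun ⟨u, p, h⟩ => ((StokesIB.isImmersedBoundarySolution_iff hH2 hws).1 h).1, fun h =>
      ⟨fun t => StokesIB.velocityOf (X t), fun t => StokesIB.pressureOf (X t),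
        (StokesIB.isImmersedBoundarySolution_iff hH2 hws).2 ⟨h, fun t _ =>
          ⟨rfl, Filter.EventuallyEq.rfl⟩⟩⟩⟩
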